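/- **Conventions.** Graphs are finite and simple, without loops; they are either undirected or directed (in which case both arcs $uv$ and $vu$ may be present). Let $|G|=|V(G)|+|E(G)|$. For a set $X$ of vertices, $\mathtt{cc}(X)$ is the number of connected components of the (underlying undirected) induced subgraph $G[X]$; for a set $Y$ of edges, $\mathtt{cc}(Y)$ is the number of connected components of the graph $(V(Y),Y)$, where $V(Y)$ is the set of endpoints of the edges in $Y$. **CML.** A set $S\subseteq\mathbb N$ is *finitely recognizable* if $S=\alpha^{-1}(F)$ for a homomorphism $\alpha$ from $(\mathbb N,+)$ to a finite monoid $M$ and some $F\subseteq M$. Formulas of *Counting Modal Logic* (CML) are built from vertex-set symbols $X_i$ and edge-set symbols $Y_j$ (for directed graphs also $\downarrow,\uparrow$) by $\neg,\wedge,\vee,\Rightarrow,\Leftrightarrow$ and the quantifiers $\diamondsuit^S,\square^S$ with $S$ finitely recognizable; the symbols $Y_j,\downarrow,\uparrow$ may occur only in the scope of a quantifier. A formula is evaluated in a vertex $v$: $X_i$ holds iff $v\in X_i$; $Y_j$ holds iff the edge that was used to access $v$ lies in $Y_j$; $\downarrow$ (resp. $\uparrow$) holds iff that arc is directed towards $v$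 (resp. away from $v$); $\diamondsuit^S\psi$ holds in $v$ iff the number of edges (arcs, in either direction) $vw$ such that $\psi$ holds in $w$, when accessed by that edge, belongs to $S$; $\square^S\psi$ means $\neg\diamondsuit^S\neg\psi$. **ECML+C.** An *instance* is $I=(G,\overline{FX},\overline{FY},\overline k)$: a graph with a vector of fixed vertex sets, a vector of fixed edge sets and a vector of integer parameters. A class $\mathcal K$ of instances (all with directed or all with undirected graphs, and with the same lengths of vectors) is *expressible in ECML+C* if there is a formula $$\varphi=\exists_{\overline X}\,\exists_{\overline Y}\,\bigl[\phi\wedge\forall_v\; G,\overline{FX},\overline{FY},\overline X,\overline Y,v\models\psi\bigr]$$ such that $I\in\mathcal K$ iff $I$ satisfies $\varphi$. Here $\overline X,\overline Y$ are vectors of fixed lengths of sets of vertices and of edges, $\psi$ is a CML formula, and $\phi$ is a quantifier-free arithmetic formula (a Boolean combination of equalities and inequalities between integer polynomials) in the parameters $\overline k$, the numbers $|V|$ and $|E|$, and the cardinalities and the numbers of connected components of all the fixed and quantified sets, such that for every variable $y$ of $\phi$ that stands for $\mathtt{cc}(X_i)$ or $\mathtt{cc}(Y_j)$ of a quantified set,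 $\phi$ is *monotone* over $y$: $\phi(\overline x,y)\Rightarrow\phi(\overline x,y')$ whenever $y\ge y'$ (the count variables range over $\mathbb N$, the parameters over $\mathbb Z$). **Theorem 2.** If the class of instances $\mathcal K$ is expressible in ECML+C, then there are a randomized algorithm and constants $c,d$ such that the following holds for every instance $I=(G,\overline{FX},\overline{FY},\overline k)$ and every tree decomposition $\mathbb T$ of $G$, where $t$ is the width of $\mathbb T$ and $|\mathbb T|$ its number of nodes. Given $I$ and $\mathbb T$, whatever the outcomes of its coin tosses, the algorithm answers YES or NO in at most $c^{t}\,(|G|+|\mathbb T|+1)^{d}$ steps (for a graph without vertices, $t$ is read as $0$). If $I\notin\mathcal K$, it never answers YES. If $I\in\mathcal K$, it answers NO with probability at most $\frac12$. Here an algorithm is a program in a fixed list-processing language with while loops and fair coin tosses, over pairs and integers; every elementary operation (pairing, taking components, testing, addition, subtraction, multiplication and comparison of integers, tossing a coin) takes one step, and all the integers computed have absolute value at most $(|G|+|\mathbb T|+\sum_i|k_i|+1)^{d}$, i.e. they fit in machine words of $O(\log(|G|+|\mathbb T|+\sum_i|k_i|+1))$ bits. -/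

import Mathlib

/-! ## Finite graphs -/

/-- A finite simple loopless graph, directed (`dir = true`) or undirected (`dir = false`), presented
as it is given to an algorithm: the vertices are `0, …, n - 1`, the edges (arcs) are
`0, …, m - 1`, and `ends e` lists the two endpoints of the edge `e`.  In a directed graph
`ends e = (u, v)` is the arc from `u` to `v`, and both arcs `(u, v)` and `(v, u)` may be present;
in an undirected graph the order of the endpoints carries no meaning. -/
structure FinGraph (dir : Bool) where
  n : ℕ
  m : ℕ
  ends : Fin m → Fin n × Fin n
  loopless : ∀ e, (ends e).1 ≠ (ends e).2
  simple : Function.Injective ends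
  simple_undirected : dir = false → Function.Injective fun e => s((ends e).1, (ends e).2)

namespace FinGraph

variable {dir : Bool} (G : FinGraph dir)

/-- `|G| = |V| + |E|`. -/
def size : ℕ := G.n + G.m

/-- The edge (arc, in either direction) `e` joins `v` to `w`. -/
def Joins (e : Fin G.m) (v w : Fin G.n) : Prop :=
  G.ends e = (v, w) ∨ G.ends e = (w, v)

/-- The (underlying) undirected graph with the edges from `Y` only, on all the vertices. -/
def edgeGraph (Y : Set (Fin G.m)) : SimpleGraph (Fin G.n) :=
  SimpleGraph.fromEdgeSet ((fun e => s((G.ends e).1, (G.ends e).2)) '' Y)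

/-- The underlying undirected graph. -/
def toSimpleGraph : SimpleGraph (Fin G.n) := G.edgeGraph Set.univ

/-- The set `V(Y)` of the endpoints of the edges from `Y`. -/
def endpoints (Y : Set (Fin G.m)) : Set (Fin G.n) :=
  {v | ∃ e ∈ Y, (G.ends e).1 = v ∨ (G.ends e).2 = v}

/-- The number of connected components of the subgraph induced by a set of vertices. -/
noncomputable def ccV (X : Finset (Fin G.n)) : ℕ :=
  Nat.card (G.toSimpleGraph.induce (X : Set (Fin G.n))).ConnectedComponent

/-- The number of connected components of the graph `(V(Y), Y)`, for a set of edges `Y`. -/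
noncomputable def ccE (Y : Finset (Fin G.m)) : ℕ :=
  Nat.card ((G.edgeGraph (Y : Set (Fin G.m))).induce
    (G.endpoints (Y : Set (Fin G.m)))).ConnectedComponent

end FinGraph

/-- A tree decomposition of a graph. -/
structure TreeDecomp {dir : Bool} (G : FinGraph dir) where
  tree : FinGraph false
  isTree : tree.toSimpleGraph.IsTree
  bag : Fin tree.n → Finset (Fin G.n)
  vertex_cover : ∀ v, ∃ x, v ∈ bag x
  edge_cover : ∀ e, ∃ x, (G.ends e).1 ∈ bag x ∧ (G.ends e).2 ∈ bag x
  path_closed : ∀ (v : Fin G.n) (x y z : Fin tree.n) (p : tree.toSimpleGraph.Walk x y),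
    p.IsPath → z ∈ p.support → v ∈ bag x → v ∈ bag y → v ∈ bag z

/-- The width: the size of the largest bag minus one (`0` for a graph without vertices). -/
def TreeDecomp.width {dir : Bool} {G : FinGraph dir} (T : TreeDecomp G) : ℕ :=
  (Finset.univ.sup fun x => (T.bag x).card) - 1

/-! ## Counting Modal Logic -/

/-- `S` is the preimage of a subset of a finite monoid under a monoid homomorphism. -/
def FinitelyRecognizable (S : Set ℕ) : Prop :=
  ∃ (M : Type) (_ : AddMonoid M) (_ : Finite M) (F : Set M) (α : ℕ →+ M), S = α ⁻¹' F

/-- Formulas of Counting Modal Logic with vertex-set symbols `ιX` and edge-set symbols `ιY`.  The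
index tells whether the formula is in the scope of a modal quantifier: edge operators occur only
there.  The operators `down` (`↓`) and `up` (`↑`) are available for directed graphs only. -/
inductive CML (dir : Bool) (ιX ιY : Type) : Bool → Type
  | neg {b : Bool} (ψ : CML dir ιX ιY b) : CML dir ιX ιY b
  | and {b : Bool} (ψ χ : CML dir ιX ιY b) : CML dir ιX ιY b
  | or {b : Bool} (ψ χ : CML dir ιX ιY b) : CML dir ιX ιY b
  | imp {b : Bool} (ψ χ : CML dir ιX ιY b) : CML dir ιX ιY b
  | iff {b : Bool} (ψ χ : CML dir ιX ιY b) : CML dir ιX ιY b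
  | inX {b : Bool} (i : ιX) : CML dir ιX ιY b
  | inY (j : ιY) : CML dir ιX ιY true
  | down (h : dir = true) : CML dir ιX ιY true
  | up (h : dir = true) : CML dir ιX ιY true
  | dia {b : Bool} (S : Set ℕ) (hS : FinitelyRecognizable S) (ψ : CML dir ιX ιY true) :
      CML dir ιX ιY b
  | box {b : Bool} (S : Set ℕ) (hS : FinitelyRecognizable S) (ψ : CML dir ιX ιY true) :
      CML dir ιX ιY b

/-- `ψ.Sat G X Y v a`: the formula `ψ` is true in the vertex `v` of `G` supplied with the sets `X`
and `Y`, where `a` is the edge that was used to access `v` (`none` outside of all the modal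
quantifiers).  A neighbour is counted once for every edge (arc) by which it is accessed. -/
def CML.Sat {dir : Bool} {ιX ιY : Type} (G : FinGraph dir)
    (X : ιX → Finset (Fin G.n)) (Y : ιY → Finset (Fin G.m)) :
    {b : Bool} → CML dir ιX ιY b → Fin G.n → Option (Fin G.m) → Prop
  | _, .neg ψ, v, a => ¬ ψ.Sat G X Y v a
  | _, .and ψ χ, v, a => ψ.Sat G X Y v a ∧ χ.Sat G X Y v a
  | _, .or ψ χ, v, a => ψ.Sat G X Y v a ∨ χ.Sat G X Y v a
  | _, .imp ψ χ, v, a => ψ.Sat G X Y v a → χ.Sat G X Y v a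
  | _, .iff ψ χ, v, a => (ψ.Sat G X Y v a ↔ χ.Sat G X Y v a)
  | _, .inX i, v, _ => v ∈ X i
  | _, .inY j, _, a => ∃ e, a = some e ∧ e ∈ Y j
  | _, .down _, v, a => ∃ e, a = some e ∧ (G.ends e).2 = v
  | _, .up _, v, a => ∃ e, a = some e ∧ (G.ends e).1 = v
  | _, .dia S _ ψ, v, _ =>
      Set.ncard {e : Fin G.m | ∃ w, G.Joins e v w ∧ ψ.Sat G X Y w (some e)} ∈ S
  | _, .box S _ ψ, v, _ =>
      ¬ Set.ncard {e : Fin G.m | ∃ w, G.Joins e v w ∧ ¬ ψ.Sat G X Y w (some e)} ∈ S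

/-! ## Quantifier-free arithmetic -/

/-- The count variables of an arithmetic formula: numbers of vertices and edges, cardinalities and
numbers of connected components of the `p₀ + q₀` fixed and of the `p₁ + q₁` quantified sets. -/
inductive CountVar (p₀ q₀ p₁ q₁ : ℕ) : Type
  | numV
  | numE
  | cardFX (i : Fin p₀)
  | cardFY (j : Fin q₀)
  | cardX (i : Fin p₁)
  | cardY (j : Fin q₁)
  | ccFX (i : Fin p₀)
  | ccFY (j : Fin q₀)
  | ccX (i : Fin p₁)
  | ccY (j : Fin q₁)
  deriving DecidableEq

/-- Terms over `r` integer parameters and the count variables in `C`. -/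
inductive ArTerm (r : ℕ) (C : Type) : Type
  | const (z : ℤ)
  | param (i : Fin r)
  | count (x : C)
  | add (s t : ArTerm r C)
  | sub (s t : ArTerm r C)
  | mul (s t : ArTerm r C)

/-- Quantifier-free arithmetic formulas. -/
inductive ArFormula (r : ℕ) (C : Type) : Type
  | eq (s t : ArTerm r C)
  | le (s t : ArTerm r C)
  | lt (s t : ArTerm r C)
  | neg (φ : ArFormula r C)
  | and (φ χ : ArFormula r C)
  | or (φ χ : ArFormula r C)

def ArTerm.eval {r : ℕ} {C : Type} (k : Fin r → ℤ) (c : C → ℕ) : ArTerm r C → ℤ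
  | .const z => z
  | .param i => k i
  | .count x => c x
  | .add s t => s.eval k c + t.eval k c
  | .sub s t => s.eval k c - t.eval k c
  | .mul s t => s.eval k c * t.eval k c

def ArFormula.Holds {r : ℕ} {C : Type} (k : Fin r → ℤ) (c : C → ℕ) : ArFormula r C → Prop
  | .eq s t => s.eval k c = t.eval k c
  | .le s t => s.eval k c ≤ t.eval k c
  | .lt s t => s.eval k c < t.eval k c
  | .neg φ => ¬ φ.Holds k c
  | .and φ χ => φ.Holds k c ∧ χ.Holds k c
  | .or φ χ => φ.Holds k c ∨ χ.Holds k c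

/-- `φ` is monotone over the variable `x`: it stays true when the value of `x` decreases. -/
def ArFormula.MonotoneOver {r : ℕ} {C : Type} [DecidableEq C] (φ : ArFormula r C) (x : C) : Prop :=
  ∀ (k : Fin r → ℤ) (c : C → ℕ) (y : ℕ), y ≤ c x →
    φ.Holds k c → φ.Holds k (Function.update c x y)

/-! ## Instances and the outer logic -/

/-- An instance: a graph with `p₀` fixed sets of vertices, `q₀` fixed sets of edges and `r` integer
parameters. -/
structure Inst (dir : Bool) (p₀ q₀ r : ℕ) where
  G : FinGraph dir
  FX : Fin p₀ → Finset (Fin G.n)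
  FY : Fin q₀ → Finset (Fin G.m)
  k : Fin r → ℤ

/-- A formula of ECML+C: `∃ X₁ … X_{p₁} ∃ Y₁ … Y_{q₁} [arith ∧ ∀ v, modal]`. -/
structure ECMLC (dir : Bool) (p₀ q₀ r : ℕ) where
  p₁ : ℕ
  q₁ : ℕ
  arith : ArFormula r (CountVar p₀ q₀ p₁ q₁)
  mono_ccX : ∀ i, arith.MonotoneOver (.ccX i)
  mono_ccY : ∀ j, arith.MonotoneOver (.ccY j)
  modal : CML dir (Fin p₀ ⊕ Fin p₁) (Fin q₀ ⊕ Fin q₁) false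

/-- The values of the count variables. -/
noncomputable def Inst.counts {dir : Bool} {p₀ q₀ r p₁ q₁ : ℕ} (I : Inst dir p₀ q₀ r)
    (X : Fin p₁ → Finset (Fin I.G.n)) (Y : Fin q₁ → Finset (Fin I.G.m)) :
    CountVar p₀ q₀ p₁ q₁ → ℕ
  | .numV => I.G.n
  | .numE => I.G.m
  | .cardFX i => (I.FX i).card
  | .cardFY j => (I.FY j).card
  | .cardX i => (X i).card
  | .cardY j => (Y j).card
  | .ccFX i => I.G.ccV (I.FX i)
  | .ccFY j => I.G.ccE (I.FY j)
  | .ccX i => I.G.ccV (X i)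
  | .ccY j => I.G.ccE (Y j)

/-- The instance `I` satisfies the formula `φ`. -/
def ECMLC.Holds {dir : Bool} {p₀ q₀ r : ℕ} (φ : ECMLC dir p₀ q₀ r) (I : Inst dir p₀ q₀ r) : Prop :=
  ∃ (X : Fin φ.p₁ → Finset (Fin I.G.n)) (Y : Fin φ.q₁ → Finset (Fin I.G.m)),
    φ.arith.Holds I.k (I.counts X Y) ∧
      ∀ v, φ.modal.Sat I.G (Sum.elim I.FX X) (Sum.elim I.FY Y) v none

/-- The class of instances `K` is expressible in ECML+C. -/
def ExpressibleECMLC {dir : Bool} {p₀ q₀ r : ℕ} (K : Set (Inst dir p₀ q₀ r)) : Prop :=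
  ∃ φ : ECMLC dir p₀ q₀ r, ∀ I, I ∈ K ↔ φ.Holds I

/-! ## Randomized programs with a step count

The machine model: list-processing programs over cons cells whose leaves are integers fitting in
machine words, with while loops and fair coin tosses.  Every operation takes one unit of time;
it amounts to a bounded number of pointer operations, arithmetic operations on words or coin tosses
of a random access machine (cells are immutable, so that copying means copying a pointer). -/

/-- Data: integers and pairs (cons cells). -/
inductive Data : Type
  | int (z : ℤ)
  | pair (a b : Data)

/-- Programs; a program transforms its input into its output. -/
inductive Prog : Type
  | id
  | const (z : ℤ)
  | pair (f g : Prog)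
  | fst
  | snd
  | isInt
  | add
  | sub
  | mul
  | le
  | coin
  | comp (f g : Prog)
  | cond (c f g : Prog)
  | loop (c f : Prog)

/-- `p.Eval W x l y s`: on the input `x`, the program `p` halts with the output `y` after `s` steps,
when its coin tosses come up as listed in `l`.  The integers handled by the program must have
absolute value at most `W`: an operation with a larger result cannot be executed (nor can an
operation whose argument is not of the required form), and then the program does not halt.  In tests
`0` stands for false and everything else for true. -/
inductive Prog.Eval (W : ℕ) : Prog → Data → List Bool → Data → ℕ → Prop
  | id (x : Data) : Eval W .id x [] x 1
  | const (z : ℤ) (x : Data) (h : z.natAbs ≤ W) : Eval W (.const z) x [] (.int z) 1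
  | pair {f g : Prog} {x y z : Data} {l l' : List Bool} {s s' : ℕ}
      (hf : Eval W f x l y s) (hg : Eval W g x l' z s') :
      Eval W (.pair f g) x (l ++ l') (.pair y z) (s + s' + 1)
  | fst (a b : Data) : Eval W .fst (.pair a b) [] a 1
  | snd (a b : Data) : Eval W .snd (.pair a b) [] b 1
  | isInt_int (z : ℤ) : Eval W .isInt (.int z) [] (.int 1) 1
  | isInt_pair (a b : Data) : Eval W .isInt (.pair a b) [] (.int 0) 1
  | add (a b : ℤ) (h : (a + b).natAbs ≤ W) :
      Eval W .add (.pair (.int a) (.int b)) [] (.int (a + b)) 1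
  | sub (a b : ℤ) (h : (a - b).natAbs ≤ W) :
      Eval W .sub (.pair (.int a) (.int b)) [] (.int (a - b)) 1
  | mul (a b : ℤ) (h : (a * b).natAbs ≤ W) :
      Eval W .mul (.pair (.int a) (.int b)) [] (.int (a * b)) 1
  | le (a b : ℤ) : Eval W .le (.pair (.int a) (.int b)) [] (.int (if a ≤ b then 1 else 0)) 1
  | coin (x : Data) (b : Bool) : Eval W .coin x [b] (.int (if b then 1 else 0)) 1
  | comp {f g : Prog} {x y z : Data} {l l' : List Bool} {s s' : ℕ}
      (hg : Eval W g x l y s) (hf : Eval W f y l' z s') :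
      Eval W (.comp f g) x (l ++ l') z (s + s' + 1)
  | cond_true {c f g : Prog} {x y z : Data} {l l' : List Bool} {s s' : ℕ}
      (hc : Eval W c x l y s) (hy : y ≠ .int 0) (hf : Eval W f x l' z s') :
      Eval W (.cond c f g) x (l ++ l') z (s + s' + 1)
  | cond_false {c f g : Prog} {x z : Data} {l l' : List Bool} {s s' : ℕ}
      (hc : Eval W c x l (.int 0) s) (hg : Eval W g x l' z s') :
      Eval W (.cond c f g) x (l ++ l') z (s + s' + 1)
  | loop_stop {c f : Prog} {x : Data} {l : List Bool} {s : ℕ}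
      (hc : Eval W c x l (.int 0) s) :
      Eval W (.loop c f) x l x (s + 1)
  | loop_step {c f : Prog} {x y x' z : Data} {l l' l'' : List Bool} {s s' s'' : ℕ}
      (hc : Eval W c x l y s) (hy : y ≠ .int 0) (hf : Eval W f x l' x' s')
      (hl : Eval W (.loop c f) x' l'' z s'') :
      Eval W (.loop c f) x (l ++ l' ++ l'') z (s + s' + s'' + 1)

/-- With the sequence `ω` of coin tosses and words for integers of absolute value at most `W`, the
program `p` halts on the input `x` after exactly `s` steps, with the answer YES (`ans = true`,
output `1`) or NO (`ans = false`, output `0`). -/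
def Prog.Answers (W : ℕ) (p : Prog) (x : Data) (ω : ℕ → Bool) (ans : Bool) (s : ℕ) : Prop :=
  ∃ j : ℕ, p.Eval W x ((List.range j).map ω) (.int (if ans then 1 else 0)) s

/-- The law of an infinite sequence of independent fair coin tosses. -/
noncomputable def coinMeasure : MeasureTheory.Measure (ℕ → Bool) :=
  MeasureTheory.Measure.infinitePi fun _ => (PMF.uniformOfFintype Bool).toMeasure

/-! ## The input of the algorithm -/

/-- A list is encoded by cons cells, and ends in `0`. -/
def Data.ofList {α : Type} (f : α → Data) : List α → Data
  | [] => .int 0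
  | a :: l => .pair (f a) (Data.ofList f l)

def Data.ofFin {n : ℕ} (i : Fin n) : Data := .int (i : ℕ)

/-- A set of numbers is encoded by its increasing list. -/
def Data.ofFinset {n : ℕ} (X : Finset (Fin n)) : Data :=
  Data.ofList Data.ofFin ((List.finRange n).filter (· ∈ X))

/-- A vector is encoded by the list of its entries. -/
def Data.ofVec {α : Type} {n : ℕ} (f : α → Data) (a : Fin n → α) : Data :=
  Data.ofList f (List.ofFn a)

/-- A graph is encoded by its number of vertices and the list of its edges. -/
def FinGraph.encode {dir : Bool} (G : FinGraph dir) : Data :=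
  .pair (.int G.n) (Data.ofVec (fun e => .pair (Data.ofFin e.1) (Data.ofFin e.2)) G.ends)

def Inst.encode {dir : Bool} {p₀ q₀ r : ℕ} (I : Inst dir p₀ q₀ r) : Data :=
  .pair I.G.encode
    (.pair (Data.ofVec Data.ofFinset I.FX)
      (.pair (Data.ofVec Data.ofFinset I.FY) (Data.ofVec Data.int I.k)))

def TreeDecomp.encode {dir : Bool} {G : FinGraph dir} (T : TreeDecomp G) : Data :=
  .pair T.tree.encode (Data.ofVec Data.ofFinset T.bag)

/-!
The algorithm is an instance of the *Cut & Count* method: it reduces the question to the parity of a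
number of labellings with local constraints, and computes this parity by dynamic programming.

**Local constraints.** A CML formula can be checked locally (`CML.locallyDefinable`). For every
subformula `◇^S ψ` every vertex guesses a bit, and the guess is verified through the sum, in a
finite commutative monoid that recognizes `S`, of the contributions of the neighbours. For given
sets there is exactly one right guess, so counting guesses is counting sets.

**Components.** Connectivity is not local. For every quantified set the algorithm also chooses a set
of marked vertices and a cut, that is, a union of components without marked vertices. If some
component is unmarked, adding it to or removing it from the cut pairs the cuts up, and otherwise the
empty cut is the only one; hence the number of cuts is odd if and only if every component is marked
(`odd_card_validCut`). Modulo two, only the choices with all components marked are counted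
(`ECMLC.exists_localSystem`). The number of marks is then at least the number of components, with
equality for some choice, and since the arithmetic formula is monotone in the numbers of components
of the quantified sets, the number of marks may be used in their place (`ECMLC.Marked.holds`,
`ECMLC.Holds.exists_marked`).

**Isolation.** Counting modulo two fails to see a solution that occurs an even number of times. So
every pair of a vertex or an edge and a set gets a random weight, and solutions are counted
separately for all the cardinalities and all the total weights. By the isolation lemma
(`card_not_isolated_le`), with probability at least one half some total weight is attained exactly
once among the solutions with suitable cardinalities, and the count for it is odd. Conversely an odd
count is not zero, so that a positive answer is right for all outcomes of the coin tosses
(`ECMLC.exists_accepts`).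

**Counting.** The counts modulo two are the coefficients of a product of local factors in a monoid
algebra over `ZMod 2`, from which the vertices are eliminated one at a time
(`LocalProblem.mem_result_iff`). A tree decomposition always has a vertex all of whose neighbours in
the bags, among the remaining vertices, lie together with it in one bag
(`TreeDecomp.exists_simplicial`): one whose topmost bag is as far from the root as possible.
Eliminating the vertices in such an order creates only tables that live on a bag, and these have at
most `C ^ (t + 1)` times polynomially many rows, for a constant `C` (`Table.length_elimAll_le`).

**Running time.** `Feas` expresses that a function of the input is computed by a program in
polynomially many steps, relative to a scale that contains the factor `C ^ t`, with integers of
polynomial size. Feasible functions are closed under composition, case distinctions and loops over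
lists (`Feas.foldl`), which reduces the complexity analysis to bounds for the lengths of lists. All
the coins are tossed at the beginning (`Feas.exists_toss`), so that only the rest of the program,
which is deterministic, has to be treated in this way.
-/

/-! ### Determinism of programs -/

/-- A program reads a determined initial segment of its coin tosses, and with it its output and its
number of steps are determined. -/
theorem Prog.Eval.det {W : ℕ} {p : Prog} {x y : Data} {l : List Bool} {s : ℕ}
    (h : Prog.Eval W p x l y s) :
    ∀ {l' r r' : List Bool} {y' : Data} {s' : ℕ}, Prog.Eval W p x l' y' s' →
      l ++ r = l' ++ r' → l = l' ∧ y = y' ∧ s = s' := by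
  induction h with
  | id x => intro l' r r' y' s' h' e; cases h'; simp
  | const z x h => intro l' r r' y' s' h' e; cases h'; simp
  | pair hf hg ihf ihg =>
    intro l' r r' y' s' h' e
    cases h' with
    | pair hf' hg' =>
      simp only [List.append_assoc] at e
      obtain ⟨rfl, rfl, rfl⟩ := ihf hf' e
      obtain ⟨rfl, rfl, rfl⟩ := ihg hg' (List.append_cancel_left e)
      simp
  | fst a b => intro l' r r' y' s' h' e; cases h'; simp
  | snd a b => intro l' r r' y' s' h' e; cases h'; simp
  | isInt_int z => intro l' r r' y' s' h' e; cases h'; simp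
  | isInt_pair a b => intro l' r r' y' s' h' e; cases h'; simp
  | add a b h => intro l' r r' y' s' h' e; cases h'; simp
  | sub a b h => intro l' r r' y' s' h' e; cases h'; simp
  | mul a b h => intro l' r r' y' s' h' e; cases h'; simp
  | le a b => intro l' r r' y' s' h' e; cases h'; simp
  | coin x b =>
    intro l' r r' y' s' h' e
    cases h'
    simp only [List.cons_append, List.nil_append, List.cons.injEq] at e
    simp [e.1]
  | comp hg hf ihg ihf =>
    intro l' r r' y' s' h' e
    cases h' with
    | comp hg' hf' =>
      simp only [List.append_assoc] at e
      obtain ⟨rfl, rfl, rfl⟩ := ihg hg' e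
      obtain ⟨rfl, rfl, rfl⟩ := ihf hf' (List.append_cancel_left e)
      simp
  | cond_true hc hy hf ihc ihf =>
    intro l' r r' y' s' h' e
    cases h' with
    | cond_true hc' hy' hf' =>
      simp only [List.append_assoc] at e
      obtain ⟨rfl, rfl, rfl⟩ := ihc hc' e
      obtain ⟨rfl, rfl, rfl⟩ := ihf hf' (List.append_cancel_left e)
      simp
    | cond_false hc' hg' =>
      simp only [List.append_assoc] at e
      exact absurd (ihc hc' e).2.1 hy
  | cond_false hc hg ihc ihg =>
    intro l' r r' y' s' h' e
    cases h' with
    | cond_true hc' hy' hf' =>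
      simp only [List.append_assoc] at e
      exact absurd (ihc hc' e).2.1.symm hy'
    | cond_false hc' hg' =>
      simp only [List.append_assoc] at e
      obtain ⟨rfl, -, rfl⟩ := ihc hc' e
      obtain ⟨rfl, rfl, rfl⟩ := ihg hg' (List.append_cancel_left e)
      simp
  | loop_stop hc ihc =>
    intro l' r r' y' s' h' e
    cases h' with
    | loop_stop hc' =>
      obtain ⟨rfl, -, rfl⟩ := ihc hc' e
      simp
    | loop_step hc' hy' hf' hl' =>
      simp only [List.append_assoc] at e
      exact absurd (ihc hc' e).2.1.symm hy'
  | loop_step hc hy hf hl ihc ihf ihl =>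
    intro l' r r' y' s' h' e
    cases h' with
    | loop_stop hc' =>
      simp only [List.append_assoc] at e
      exact absurd (ihc hc' e).2.1 hy
    | loop_step hc' hy' hf' hl' =>
      simp only [List.append_assoc] at e
      obtain ⟨rfl, rfl, rfl⟩ := ihc hc' e
      have e := List.append_cancel_left e
      obtain ⟨rfl, rfl, rfl⟩ := ihf hf' e
      obtain ⟨rfl, rfl, rfl⟩ := ihl hl' (List.append_cancel_left e)
      simp

/-- The answer to given coin tosses is unique, so that to exhibit one answer is to exclude the
other. -/
theorem Prog.Answers.ans_unique {W : ℕ} {p : Prog} {x : Data} {ω : ℕ → Bool} {a a' : Bool}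
    {s s' : ℕ} (h : p.Answers W x ω a s) (h' : p.Answers W x ω a' s') : a = a' := by
  obtain ⟨j, h⟩ := h
  obtain ⟨j', h'⟩ := h'
  have key : ∀ i k, i ≤ k → ∃ r, (List.range k).map ω = (List.range i).map ω ++ r := by
    intro i k hik
    obtain ⟨d, rfl⟩ := Nat.exists_eq_add_of_le hik
    exact ⟨((List.range d).map (i + ·)).map ω, by rw [List.range_add, List.map_append]⟩
  obtain ⟨r, hr⟩ := key j (max j j') (le_max_left _ _)
  obtain ⟨r', hr'⟩ := key j' (max j j') (le_max_right _ _)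
  have e := (h.det h' (hr.symm.trans hr')).2.1
  cases a <;> cases a' <;> simp_all

/-! ### Feasible functions -/

/-- `f` is bounded by a power of `b`. -/
def PolyBdd {S : Type} (b f : S → ℕ) : Prop := ∃ k, ∀ s, f s ≤ b s ^ k

/-- The yardsticks for the resources of a computation that depends on `s : S`: the number of steps
has to be polynomial in `time s`, and the integers have to be polynomial in `word s`. -/
structure Scale (S : Type) where
  time : S → ℕ
  word : S → ℕ
  two_le_time : ∀ s, 2 ≤ time s
  two_le_word : ∀ s, 2 ≤ word s

/-- Change of the domain along `π`. -/
def Scale.pull {S S' : Type} (κ : Scale S) (π : S' → S) : Scale S' where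
  time s := κ.time (π s)
  word s := κ.word (π s)
  two_le_time _ := κ.two_le_time _
  two_le_word _ := κ.two_le_word _

namespace PolyBdd

variable {S S' : Type} {b f g : S → ℕ}

theorem mono (hg : PolyBdd b g) (h : ∀ s, f s ≤ g s) : PolyBdd b f :=
  let ⟨k, hk⟩ := hg
  ⟨k, fun s => (h s).trans (hk s)⟩

theorem base : PolyBdd b b := ⟨1, fun s => by simp⟩

theorem const (hb : ∀ s, 2 ≤ b s) (c : ℕ) : PolyBdd b fun _ => c :=
  ⟨c, fun s => (Nat.lt_two_pow_self).le.trans (Nat.pow_le_pow_left (hb s) c)⟩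

theorem mul (hf : PolyBdd b f) (hg : PolyBdd b g) : PolyBdd b fun s => f s * g s :=
  let ⟨k, hk⟩ := hf
  let ⟨l, hl⟩ := hg
  ⟨k + l, fun s => by rw [pow_add]; exact Nat.mul_le_mul (hk s) (hl s)⟩

theorem add (hb : ∀ s, 2 ≤ b s) (hf : PolyBdd b f) (hg : PolyBdd b g) :
    PolyBdd b fun s => f s + g s := by
  obtain ⟨k, hk⟩ := hf
  obtain ⟨l, hl⟩ := hg
  refine ⟨k + l + 1, fun s => ?_⟩
  have h1 : 1 ≤ b s := one_le_two.trans (hb s)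
  have := (hk s).trans (Nat.pow_le_pow_right h1 (Nat.le_add_right k l))
  have := (hl s).trans (Nat.pow_le_pow_right h1 (Nat.le_add_left l k))
  calc f s + g s ≤ b s ^ (k + l) * 2 := by omega
    _ ≤ b s ^ (k + l) * b s := Nat.mul_le_mul_left _ (hb s)
    _ = _ := (pow_succ _ _).symm

theorem pow (hf : PolyBdd b f) (i : ℕ) : PolyBdd b fun s => f s ^ i :=
  let ⟨k, hk⟩ := hf
  ⟨k * i, fun s => by rw [pow_mul]; exact Nat.pow_le_pow_left (hk s) i⟩

theorem pull (hf : PolyBdd b f) (π : S' → S) : PolyBdd (fun s => b (π s)) fun s => f (π s) :=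
  let ⟨k, hk⟩ := hf
  ⟨k, fun s => hk (π s)⟩

end PolyBdd

/-- There is a program that computes `f s` from `a s`, without tossing coins, in a number of steps
polynomial in `κ.time s` and with integers polynomial in `κ.word s`.  Here `a s` is the environment:
the data at hand, usually nested pairs `.pair x₁ (.pair x₂ …)` of the values of the variables. -/
def Feas {S : Type} (κ : Scale S) (a f : S → Data) : Prop :=
  ∃ (p : Prog) (d : ℕ), ∀ s W, κ.word s ^ d ≤ W → ∃ t ≤ κ.time s ^ d, p.Eval W (a s) [] (f s) t

/-- A truth value as it is delivered by the tests and the coins of the machine. -/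
def Data.ofBool (b : Bool) : Data := .int (if b then 1 else 0)

theorem Data.ofList_eq_foldr {α : Type} (f : α → Data) (l : List α) :
    Data.ofList f l = l.foldr (fun x d => .pair (f x) d) (.int 0) := by
  induction l with
  | nil => rfl
  | cons a l ih => simp [Data.ofList, ih]

namespace Feas

variable {S S' : Type} {κ : Scale S} {a f g : S → Data}

/-- Feasibility from separate bounds for the time and for the size of the integers; the exponents of
the two are replaced by their maximum. -/
theorem intro (p : Prog) (tb wb : S → ℕ) (ht : PolyBdd κ.time tb) (hw : PolyBdd κ.word wb)
    (h : ∀ s W, wb s ≤ W → ∃ t ≤ tb s, p.Eval W (a s) [] (f s) t) : Feas κ a f := by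
  obtain ⟨k, hk⟩ := ht
  obtain ⟨l, hl⟩ := hw
  refine ⟨p, max k l, fun s W hW => ?_⟩
  have h1 : 1 ≤ κ.time s := one_le_two.trans (κ.two_le_time s)
  have h2 : 1 ≤ κ.word s := one_le_two.trans (κ.two_le_word s)
  obtain ⟨t, ht, e⟩ := h s W
    ((hl s).trans ((Nat.pow_le_pow_right h2 (le_max_right _ _)).trans hW))
  exact ⟨t, ht.trans ((hk s).trans (Nat.pow_le_pow_right h1 (le_max_left _ _))), e⟩

theorem elim (h : Feas κ a f) : ∃ (p : Prog) (tb wb : S → ℕ), PolyBdd κ.time tb ∧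
    PolyBdd κ.word wb ∧ ∀ s W, wb s ≤ W → ∃ t ≤ tb s, p.Eval W (a s) [] (f s) t := by
  obtain ⟨p, d, h⟩ := h
  exact ⟨p, fun s => κ.time s ^ d, fun s => κ.word s ^ d, ⟨d, fun _ => le_rfl⟩,
    ⟨d, fun _ => le_rfl⟩, h⟩

theorem congr (h : Feas κ a f) (e : ∀ s, f s = g s) : Feas κ a g := by
  have : f = g := funext e
  rwa [← this]

theorem pull (h : Feas κ a f) (π : S' → S) :
    Feas (κ.pull π) (fun s => a (π s)) fun s => f (π s) :=
  let ⟨p, d, h⟩ := h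
  ⟨p, d, fun s W hW => h (π s) W hW⟩

theorem of_step {p : Prog} (h : ∀ s W, p.Eval W (a s) [] (f s) 1) : Feas κ a f :=
  intro p (fun _ => 1) (fun _ => 0) (.const κ.two_le_time 1) (.const κ.two_le_word 0)
    fun s W _ => ⟨1, le_rfl, h s W⟩

theorem id : Feas κ a a := of_step fun _ _ => .id _

theorem comp (hf : Feas κ a f) (hg : Feas κ f g) : Feas κ a g := by
  obtain ⟨p, tp, wp, hp1, hp2, hp⟩ := hf.elim
  obtain ⟨q, tq, wq, hq1, hq2, hq⟩ := hg.elim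
  refine intro (.comp q p) (fun s => tp s + tq s + 1) (fun s => wp s + wq s)
    ((hp1.add κ.two_le_time hq1).add κ.two_le_time (.const κ.two_le_time 1))
    (hp2.add κ.two_le_word hq2) fun s W hW => ?_
  obtain ⟨t, ht, e⟩ := hp s W (by omega)
  obtain ⟨t', ht', e'⟩ := hq s W (by omega)
  exact ⟨t + t' + 1, by omega, .comp e e'⟩

theorem pair (hf : Feas κ a f) (hg : Feas κ a g) : Feas κ a fun s => .pair (f s) (g s) := by
  obtain ⟨p, tp, wp, hp1, hp2, hp⟩ := hf.elim
  obtain ⟨q, tq, wq, hq1, hq2, hq⟩ := hg.elim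
  refine intro (.pair p q) (fun s => tp s + tq s + 1) (fun s => wp s + wq s)
    ((hp1.add κ.two_le_time hq1).add κ.two_le_time (.const κ.two_le_time 1))
    (hp2.add κ.two_le_word hq2) fun s W hW => ?_
  obtain ⟨t, ht, e⟩ := hp s W (by omega)
  obtain ⟨t', ht', e'⟩ := hq s W (by omega)
  exact ⟨t + t' + 1, by omega, .pair e e'⟩

theorem var0 : Feas κ (fun s => .pair (f s) (a s)) f := of_step fun _ _ => .fst _ _

theorem tail : Feas κ (fun s => .pair (f s) (a s)) a := of_step fun _ _ => .snd _ _

theorem weaken (h : Feas κ a g) : Feas κ (fun s => .pair (f s) (a s)) g := tail.comp h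

theorem fst (h : Feas κ a fun s => .pair (f s) (g s)) : Feas κ a f := h.comp var0

theorem snd (h : Feas κ a fun s => .pair (f s) (g s)) : Feas κ a g := h.comp tail

theorem int (z : ℤ) : Feas κ a fun _ => .int z :=
  intro (.const z) (fun _ => 1) (fun _ => z.natAbs) (.const κ.two_le_time 1)
    (.const κ.two_le_word _) fun _ _ hW => ⟨1, le_rfl, .const _ _ hW⟩

theorem const (D : Data) : Feas κ a fun _ => D := by
  induction D with
  | int z => exact int z
  | pair x y ihx ihy => exact ihx.pair ihy

section Arithmetic

variable {x y : S → ℤ}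

theorem add (hx : Feas κ a fun s => .int (x s)) (hy : Feas κ a fun s => .int (y s))
    (h : PolyBdd κ.word fun s => (x s + y s).natAbs) : Feas κ a fun s => .int (x s + y s) :=
  (hx.pair hy).comp (intro .add (fun _ => 1) _ (.const κ.two_le_time 1) h
    fun _ _ hW => ⟨1, le_rfl, .add _ _ hW⟩)

theorem sub (hx : Feas κ a fun s => .int (x s)) (hy : Feas κ a fun s => .int (y s))
    (h : PolyBdd κ.word fun s => (x s - y s).natAbs) : Feas κ a fun s => .int (x s - y s) :=
  (hx.pair hy).comp (intro .sub (fun _ => 1) _ (.const κ.two_le_time 1) h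
    fun _ _ hW => ⟨1, le_rfl, .sub _ _ hW⟩)

theorem mul (hx : Feas κ a fun s => .int (x s)) (hy : Feas κ a fun s => .int (y s))
    (h : PolyBdd κ.word fun s => (x s * y s).natAbs) : Feas κ a fun s => .int (x s * y s) :=
  (hx.pair hy).comp (intro .mul (fun _ => 1) _ (.const κ.two_le_time 1) h
    fun _ _ hW => ⟨1, le_rfl, .mul _ _ hW⟩)

theorem le (hx : Feas κ a fun s => .int (x s)) (hy : Feas κ a fun s => .int (y s)) :
    Feas κ a fun s => .ofBool (decide (x s ≤ y s)) :=
  (hx.pair hy).comp (of_step (p := .le) fun s W => by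
    simpa [Data.ofBool] using Prog.Eval.le (W := W) (x s) (y s))

end Arithmetic

section Tests

variable {b c : S → Bool}

/-- Case distinction; each branch only has to be feasible where it is taken. -/
theorem ite (hb : Feas κ a fun s => .ofBool (b s))
    (hf : Feas (κ.pull (Subtype.val : {s // b s = true} → S)) (fun s => a s.1) fun s => f s.1)
    (hg : Feas (κ.pull (Subtype.val : {s // b s = false} → S)) (fun s => a s.1) fun s => g s.1) :
    Feas κ a fun s => if b s then f s else g s := by
  obtain ⟨r, dr, hr⟩ := hb
  obtain ⟨p, dp, hp⟩ := hf
  obtain ⟨q, dq, hq⟩ := hg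
  refine intro (.cond r p q) (fun s => κ.time s ^ dr + κ.time s ^ dp + κ.time s ^ dq + 1)
    (fun s => κ.word s ^ dr + κ.word s ^ dp + κ.word s ^ dq)
    ((((PolyBdd.base.pow _).add κ.two_le_time (PolyBdd.base.pow _)).add κ.two_le_time
      (PolyBdd.base.pow _)).add κ.two_le_time (.const κ.two_le_time 1))
    (((PolyBdd.base.pow _).add κ.two_le_word (PolyBdd.base.pow _)).add κ.two_le_word
      (PolyBdd.base.pow _)) fun s W hW => ?_
  obtain ⟨t, ht, e⟩ := hr s W (by omega)
  cases hbs : b s with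
  | true =>
    obtain ⟨t', ht', e'⟩ := hp ⟨s, hbs⟩ W (by change κ.word s ^ dp ≤ W; omega)
    change t' ≤ κ.time s ^ dp at ht'
    simp only [hbs] at e
    exact ⟨t + t' + 1, by omega, by simpa using Prog.Eval.cond_true e (by simp [Data.ofBool]) e'⟩
  | false =>
    obtain ⟨t', ht', e'⟩ := hq ⟨s, hbs⟩ W (by change κ.word s ^ dq ≤ W; omega)
    change t' ≤ κ.time s ^ dq at ht'
    simp only [hbs] at e
    exact ⟨t + t' + 1, by omega, by simpa using Prog.Eval.cond_false e e'⟩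

theorem ite' (hb : Feas κ a fun s => .ofBool (b s)) (hf : Feas κ a f) (hg : Feas κ a g) :
    Feas κ a fun s => if b s then f s else g s :=
  hb.ite (hf.pull _) (hg.pull _)

theorem bool (c : Bool) : Feas κ a fun _ => .ofBool c := const _

theorem not (hb : Feas κ a fun s => .ofBool (b s)) : Feas κ a fun s => .ofBool (!b s) :=
  (hb.ite' (bool false) (bool true)).congr fun s => by cases b s <;> rfl

theorem and (hb : Feas κ a fun s => .ofBool (b s)) (hc : Feas κ a fun s => .ofBool (c s)) :
    Feas κ a fun s => .ofBool (b s && c s) :=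
  (hb.ite' hc (bool false)).congr fun s => by cases b s <;> rfl

theorem or (hb : Feas κ a fun s => .ofBool (b s)) (hc : Feas κ a fun s => .ofBool (c s)) :
    Feas κ a fun s => .ofBool (b s || c s) :=
  (hb.ite' (bool true) hc).congr fun s => by cases b s <;> rfl

theorem eq {x y : S → ℤ} (hx : Feas κ a fun s => .int (x s)) (hy : Feas κ a fun s => .int (y s)) :
    Feas κ a fun s => .ofBool (decide (x s = y s)) :=
  ((hx.le hy).and (hy.le hx)).congr fun s => by
    rw [← Bool.decide_and]; congr 2; exact propext le_antisymm_iff.symm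

theorem lt {x y : S → ℤ} (hx : Feas κ a fun s => .int (x s)) (hy : Feas κ a fun s => .int (y s)) :
    Feas κ a fun s => .ofBool (decide (x s < y s)) :=
  (hy.le hx).not.congr fun s => by
    rw [← decide_not]; congr 2; exact propext not_le

end Tests

end Feas

/-! ### Loops over lists -/

/-- A moment of the evaluation of a `foldl`: the list `l s` is split at the entry `x`, and the
value reached before `x` is known only by the invariant. -/
structure Frame {S : Type} {α β : S → Type} (l : ∀ s, List (α s))
    (Inv : ∀ s, List (α s) → β s → Prop) where
  s : S
  pre : List (α s)
  x : α s
  post : List (α s)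
  eq : l s = pre ++ x :: post
  b : β s
  inv : Inv s pre b

theorem Frame.mem {S : Type} {α β : S → Type} {l : ∀ s, List (α s)}
    {Inv : ∀ s, List (α s) → β s → Prop} (q : Frame l Inv) : q.x ∈ l q.s := by
  rw [q.eq]; simp

namespace Feas

variable {S : Type} {κ : Scale S} {a : S → Data}

/-- A loop over a list of feasible length is feasible if its step is. The step has to be feasible
only at the moments that come up in the evaluation, as far as the invariant describes them: this is
how a bound for an accumulated value is made available to the step. The step sees the entry, the
accumulated value and the whole environment of the loop. -/
theorem foldl {α β : S → Type} {eα : ∀ s, α s → Data} {eβ : ∀ s, β s → Data}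
    {l : ∀ s, List (α s)} {init : ∀ s, β s} {step : ∀ s, β s → α s → β s}
    (Inv : ∀ s, List (α s) → β s → Prop)
    (hinv : ∀ s, Inv s [] (init s))
    (hinv' : ∀ q : Frame l Inv, Inv q.s (q.pre ++ [q.x]) (step q.s q.b q.x))
    (hlen : PolyBdd κ.time fun s => (l s).length)
    (hl : Feas κ a fun s => .ofList (eα s) (l s))
    (hinit : Feas κ a fun s => eβ s (init s))
    (hstep : Feas (κ.pull (Frame.s : Frame l Inv → S))
      (fun q => .pair (eα q.s q.x) (.pair (eβ q.s q.b) (a q.s)))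
      fun q => eβ q.s (step q.s q.b q.x)) :
    Feas κ a fun s => eβ s ((l s).foldl (step s) (init s)) := by
  obtain ⟨p, d, hp⟩ := hstep
  have hstart := hl.pair (hinit.pair id)
  refine hstart.comp ?_
  let test : Prog := .cond (.comp .isInt .fst) (.const 0) (.const 1)
  let body : Prog := .pair (.comp .snd .fst) (.pair (.comp p (.pair (.comp .fst .fst)
    (.pair (.comp .fst .snd) (.comp .snd .snd)))) (.comp .snd .snd))
  refine intro (.comp (.comp .fst .snd) (.loop test body))
    (fun s => ((l s).length + 1) * (κ.time s ^ d + 50) + 10) (fun s => κ.word s ^ d + 1)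
    (((hlen.add κ.two_le_time (.const κ.two_le_time 1)).mul
      ((PolyBdd.base.pow d).add κ.two_le_time (.const κ.two_le_time 50))).add κ.two_le_time
      (.const κ.two_le_time 10))
    ((PolyBdd.base.pow d).add κ.two_le_word (.const κ.two_le_word 1)) fun s W hW => ?_
  have loop : ∀ (post pre : List (α s)) (b : β s), l s = pre ++ post → Inv s pre b →
      ∃ t ≤ (post.length + 1) * (κ.time s ^ d + 50),
        Prog.Eval W (.loop test body) (.pair (.ofList (eα s) post) (.pair (eβ s b) (a s))) []
          (.pair (.int 0) (.pair (eβ s (post.foldl (step s) b)) (a s))) t := by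
    intro post
    induction post with
    | nil =>
      intro pre b _ _
      refine ⟨_, ?_, Prog.Eval.loop_stop (.cond_true (.comp (.fst _ _) (.isInt_int _)) (by simp)
        (.const 0 _ (by simp)))⟩
      simp
    | cons x post ih =>
      intro pre b e hb
      let q : Frame l Inv := ⟨s, pre, x, post, e, b, hb⟩
      obtain ⟨t, ht, ev⟩ := hp q W (by change κ.word s ^ d ≤ W; omega)
      change t ≤ κ.time s ^ d at ht
      obtain ⟨t', ht', ev'⟩ := ih (pre ++ [x]) (step s b x) (by simp [e]) (hinv' q)
      refine ⟨_, ?_, .loop_step (.cond_false (.comp (.fst _ _) (.isInt_pair _ _))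
        (.const 1 _ (by simp; omega))) (by simp)
        (.pair (.comp (.fst _ _) (.snd _ _)) (.pair (.comp (.pair (.comp (.fst _ _) (.fst _ _))
          (.pair (.comp (.snd _ _) (.fst _ _)) (.comp (.snd _ _) (.snd _ _)))) ev)
          (.comp (.snd _ _) (.snd _ _)))) ev'⟩
      rw [List.length_cons, add_mul (post.length + 1)]
      omega
  obtain ⟨t, ht, ev⟩ := loop (l s) [] (init s) rfl (hinv s)
  exact ⟨_, by omega, .comp ev (.comp (.snd _ _) (.fst _ _))⟩

/-- `foldl` without an invariant. -/
theorem foldl' {α β : S → Type} {eα : ∀ s, α s → Data} {eβ : ∀ s, β s → Data}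
    {l : ∀ s, List (α s)} {init : ∀ s, β s} {step : ∀ s, β s → α s → β s}
    (hlen : PolyBdd κ.time fun s => (l s).length)
    (hl : Feas κ a fun s => .ofList (eα s) (l s))
    (hinit : Feas κ a fun s => eβ s (init s))
    (hstep : Feas (κ.pull (Frame.s : Frame (β := β) l (fun _ _ _ => True) → S))
      (fun q => .pair (eα q.s q.x) (.pair (eβ q.s q.b) (a q.s)))
      fun q => eβ q.s (step q.s q.b q.x)) :
    Feas κ a fun s => eβ s ((l s).foldl (step s) (init s)) :=
  foldl (fun _ _ _ => True) (fun _ => trivial) (fun _ => trivial) hlen hl hinit hstep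

/-- An entry of the list `l s`, for a loop whose steps do not depend on each other. -/
structure Entry {S : Type} {α : S → Type} (l : ∀ s, List (α s)) where
  s : S
  x : α s
  mem : x ∈ l s

variable {α β : S → Type} {eα : ∀ s, α s → Data} {eβ : ∀ s, β s → Data} {l : ∀ s, List (α s)}

/-- A step that depends only on the current entry can be used in any loop over the same entries. -/
theorem inFrame {l' : ∀ s, List (α s)} {Inv : ∀ s, List (α s) → β s → Prop}
    {g : ∀ s, α s → Data} {e' : Frame l' Inv → Data}
    (hf : Feas (κ.pull (Entry.s : Entry l → S)) (fun q => .pair (eα q.s q.x) (a q.s))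
      fun q => g q.s q.x) (h : ∀ s, ∀ x ∈ l' s, x ∈ l s) :
    Feas (κ.pull (Frame.s : Frame l' Inv → S))
      (fun q => .pair (eα q.s q.x) (.pair (e' q) (a q.s))) fun q => g q.s q.x :=
  (var0.pair id.weaken.weaken).comp
    (hf.pull fun q : Frame l' Inv => (⟨q.s, q.x, h _ _ q.mem⟩ : Entry l))

theorem reverse (hlen : PolyBdd κ.time fun s => (l s).length)
    (hl : Feas κ a fun s => .ofList (eα s) (l s)) :
    Feas κ a fun s => .ofList (eα s) (l s).reverse := by
  refine (foldl' (β := fun s => List (α s)) (eβ := fun s => Data.ofList (eα s))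
    (init := fun _ => []) (step := fun s acc x => x :: acc) hlen hl (int 0)
    (var0.pair var0.weaken)).congr fun s => ?_
  rw [List.foldl_flip_cons_eq_append', List.append_nil]

theorem map {f : ∀ s, α s → β s} (hlen : PolyBdd κ.time fun s => (l s).length)
    (hl : Feas κ a fun s => .ofList (eα s) (l s))
    (hf : Feas (κ.pull (Entry.s : Entry l → S)) (fun q => .pair (eα q.s q.x) (a q.s))
      fun q => eβ q.s (f q.s q.x)) :
    Feas κ a fun s => .ofList (eβ s) ((l s).map (f s)) := by
  have h := foldl' (β := fun s => List (β s)) (eβ := fun s => Data.ofList (eβ s))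
    (init := fun _ => []) (step := fun s acc x => f s x :: acc) (hlen.mono (by simp))
    (reverse hlen hl) (int 0) ((inFrame (g := fun s x => eβ s (f s x)) hf (by simp)).pair
      var0.weaken)
  refine h.congr fun s => ?_
  rw [List.foldl_reverse]
  congr 1
  induction l s with
  | nil => rfl
  | cons x l ih => simp [ih]

theorem filter {p : ∀ s, α s → Bool} (hlen : PolyBdd κ.time fun s => (l s).length)
    (hl : Feas κ a fun s => .ofList (eα s) (l s))
    (hp : Feas (κ.pull (Entry.s : Entry l → S)) (fun q => .pair (eα q.s q.x) (a q.s))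
      fun q => .ofBool (p q.s q.x)) :
    Feas κ a fun s => .ofList (eα s) ((l s).filter (p s)) := by
  have h := foldl' (β := fun s => List (α s)) (eβ := fun s => Data.ofList (eα s))
    (init := fun _ => []) (step := fun s acc x => if p s x then x :: acc else acc)
    (hlen.mono (by simp)) (reverse hlen hl) (int 0)
    (((inFrame (g := fun s x => .ofBool (p s x)) hp (by simp)).ite'
      (var0.pair var0.weaken) var0.weaken).congr fun q => by
        cases p q.s q.x <;> rfl)
  refine h.congr fun s => ?_
  rw [List.foldl_reverse]
  congr 1
  induction l s with
  | nil => rfl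
  | cons x l ih => rw [List.foldr_cons, ih, List.filter_cons]

theorem any {p : ∀ s, α s → Bool} (hlen : PolyBdd κ.time fun s => (l s).length)
    (hl : Feas κ a fun s => .ofList (eα s) (l s))
    (hp : Feas (κ.pull (Entry.s : Entry l → S)) (fun q => .pair (eα q.s q.x) (a q.s))
      fun q => .ofBool (p q.s q.x)) :
    Feas κ a fun s => .ofBool ((l s).any (p s)) := by
  have h := foldl' (β := fun _ => Bool) (eβ := fun _ => Data.ofBool)
    (init := fun _ => false) (step := fun s acc x => acc || p s x)
    hlen hl (bool false) (var0.weaken.or (inFrame (g := fun s x => .ofBool (p s x)) hp (by simp)))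
  refine h.congr fun s => ?_
  congr 1
  have : ∀ (l : List (α s)) (b : Bool), l.foldl (fun acc x => acc || p s x) b = (b || l.any
      (p s)) := by
    intro l
    induction l with
    | nil => simp
    | cons x l ih => intro b; simp [ih, Bool.or_assoc]
  simp [this]

theorem all {p : ∀ s, α s → Bool} (hlen : PolyBdd κ.time fun s => (l s).length)
    (hl : Feas κ a fun s => .ofList (eα s) (l s))
    (hp : Feas (κ.pull (Entry.s : Entry l → S)) (fun q => .pair (eα q.s q.x) (a q.s))
      fun q => .ofBool (p q.s q.x)) :
    Feas κ a fun s => .ofBool ((l s).all (p s)) :=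
  (any hlen hl (p := fun s x => !p s x) hp.not).not.congr fun s => by
    rw [← List.not_all_eq_any_not, Bool.not_not]

theorem append {l' : ∀ s, List (α s)} (hlen : PolyBdd κ.time fun s => (l s).length)
    (hl : Feas κ a fun s => .ofList (eα s) (l s))
    (hl' : Feas κ a fun s => .ofList (eα s) (l' s)) :
    Feas κ a fun s => .ofList (eα s) (l s ++ l' s) := by
  refine (foldl' (β := fun s => List (α s)) (eβ := fun s => Data.ofList (eα s))
    (init := l') (step := fun s acc x => x :: acc) (hlen.mono (by simp)) (reverse hlen hl) hl'
    (var0.pair var0.weaken)).congr fun s => ?_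
  rw [List.foldl_flip_cons_eq_append', List.reverse_reverse]

theorem length (hlen : PolyBdd κ.time fun s => (l s).length)
    (hlen' : PolyBdd κ.word fun s => (l s).length)
    (hl : Feas κ a fun s => .ofList (eα s) (l s)) :
    Feas κ a fun s => .int ((l s).length : ℕ) := by
  have h := foldl (β := fun _ => ℕ) (eβ := fun _ n => Data.int (n : ℕ))
    (init := fun _ => 0) (step := fun _ c _ => c + 1) (fun s pre c => c = pre.length)
    (by simp) (fun q => by simp [q.inv]) hlen hl (int 0)
    (var0.weaken.add (int 1) ((hlen'.pull Frame.s).mono fun q => by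
      rw [q.inv, q.eq]; simp; omega))
  refine h.congr fun s => ?_
  congr 2
  simp

/-- The test whether a list is empty. -/
theorem isEmpty (hl : Feas κ a fun s => .ofList (eα s) (l s)) :
    Feas κ a fun s => .ofBool (l s).isEmpty :=
  hl.comp (intro .isInt (fun _ => 1) (fun _ => 0) (.const κ.two_le_time 1)
    (.const κ.two_le_word 0) fun s W _ => ⟨1, le_rfl, by
      cases l s with
      | nil => exact .isInt_int _
      | cons x l => exact .isInt_pair _ _⟩)

/-- The numbers below `n s`. -/
theorem finRange {n : S → ℕ} (hn : PolyBdd κ.time n) (hn' : PolyBdd κ.word n)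
    (h : Feas κ a fun s => .int (n s)) :
    Feas κ a fun s => .ofList Data.ofFin (List.finRange (n s)) := by
  let body : Prog := .pair (.comp .sub (.pair .fst (.const 1)))
    (.pair (.comp .sub (.pair .fst (.const 1))) .snd)
  let test : Prog := .comp .le (.pair (.const 1) .fst)
  refine (h.pair (int 0)).comp (intro (.comp .snd (.loop test body))
    (fun s => n s * 50 + 50) (fun s => n s + 1)
    ((hn.mul (.const κ.two_le_time 50)).add κ.two_le_time (.const κ.two_le_time 50))
    (hn'.add κ.two_le_word (.const κ.two_le_word 1)) fun s W hW => ?_)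
  have h1 : (1 : ℤ).natAbs ≤ W := by simp; omega
  have loop : ∀ (i : ℕ) (D : Data), i ≤ n s → ∃ t ≤ i * 50 + 40,
      Prog.Eval W (.loop test body) (.pair (.int i) D) []
        (.pair (.int 0) ((List.range i).foldr (fun k d => .pair (.int (k : ℕ)) d) D)) t := by
    intro i
    induction i with
    | zero =>
      intro D _
      refine ⟨_, ?_, Prog.Eval.loop_stop (.comp (.pair (.const 1 _ (by simp; omega)) (.fst _ _))
        (.le 1 _))⟩
      simp
    | succ i ih =>
      intro D hi
      obtain ⟨t, ht, ev⟩ := ih (.pair (.int i) D) (by omega)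
      have e : ((i + 1 : ℕ) : ℤ) - 1 = i := by push_cast; ring
      have hc : Prog.Eval W test (.pair (.int (i + 1 : ℕ)) D) [] (.int 1) 5 := by
        have := Prog.Eval.le (W := W) 1 (i + 1 : ℕ)
        rw [if_pos (by omega)] at this
        exact .comp (.pair (.const 1 _ h1) (.fst _ _)) this
      have hd : Prog.Eval W (.comp .sub (.pair .fst (.const 1))) (.pair (.int (i + 1 : ℕ)) D) []
          (.int i) 5 := by
        have := Prog.Eval.sub (W := W) (i + 1 : ℕ) 1 (by rw [e]; simp; omega)
        rw [e] at this
        exact .comp (.pair (.fst _ _) (.const 1 _ h1)) this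
      have hl := Prog.Eval.loop_step hc (by simp) (.pair hd (.pair hd (.snd _ _))) ev
      rw [List.range_succ, List.foldr_append]
      exact ⟨_, by omega, hl⟩
  obtain ⟨t, ht, ev⟩ := loop (n s) (.int 0) le_rfl
  have : (List.finRange (n s)).foldr (fun x d => Data.pair (Data.ofFin x) d) (.int 0) =
      ((List.finRange (n s)).map Fin.val).foldr (fun k d => .pair (.int (k : ℕ)) d) (.int 0) := by
    rw [List.foldr_map]; rfl
  rw [Data.ofList_eq_foldr, this, List.map_coe_finRange_eq_range]
  exact ⟨_, by omega, .comp ev (.snd _ _)⟩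

end Feas

/-! ### Vectors, finite look-up tables, coin tosses -/

/-- `f` is small enough for both a list length and an integer. -/
def Modest {S : Type} (κ : Scale S) (f : S → ℕ) : Prop := PolyBdd κ.time f ∧ PolyBdd κ.word f

namespace Modest

variable {S S' : Type} {κ : Scale S} {f g : S → ℕ}

theorem mono (hg : Modest κ g) (h : ∀ s, f s ≤ g s) : Modest κ f := ⟨hg.1.mono h, hg.2.mono h⟩

theorem const (c : ℕ) : Modest κ fun _ => c := ⟨.const κ.two_le_time c, .const κ.two_le_word c⟩

theorem add (hf : Modest κ f) (hg : Modest κ g) : Modest κ fun s => f s + g s :=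
  ⟨hf.1.add κ.two_le_time hg.1, hf.2.add κ.two_le_word hg.2⟩

theorem mul (hf : Modest κ f) (hg : Modest κ g) : Modest κ fun s => f s * g s :=
  ⟨hf.1.mul hg.1, hf.2.mul hg.2⟩

theorem pull (hf : Modest κ f) (π : S' → S) : Modest (κ.pull π) fun s => f (π s) :=
  ⟨hf.1.pull π, hf.2.pull π⟩

end Modest

/-- Reading the entry number `c` of a list by counting down. -/
theorem List.foldl_countdown {α : Type} (l : List α) (c : ℤ) (r : α) :
    (l.foldl (fun (p : ℤ × α) x => (p.1 - 1, if p.1 = 0 then x else p.2)) (c, r)).2 =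
      if 0 ≤ c then l.getD c.toNat r else r := by
  induction l generalizing c r with
  | nil => simp
  | cons x l ih =>
    rw [List.foldl_cons, ih]
    rcases lt_trichotomy c 0 with h | rfl | h
    · simp [h.not_ge, show ¬ (1 ≤ c) by omega, h.ne]
    · simp
    · obtain ⟨k, rfl⟩ : ∃ k : ℕ, c = k + 1 := ⟨(c - 1).toNat, by omega⟩
      simp [show (k : ℤ) + 1 ≠ 0 by omega, show (0 : ℤ) ≤ k + 1 by omega]

/-- An index below `n s`. -/
structure Idx {S : Type} (n : S → ℕ) where
  s : S
  i : Fin (n s)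

/-- An element of a finite type is encoded by its number. -/
noncomputable def Data.ofElt {C : Type} [Fintype C] (c : C) : Data :=
  Data.ofFin (Fintype.equivFin C c)

namespace Feas

variable {S : Type} {κ : Scale S} {a : S → Data} {α β : S → Type} {eα : ∀ s, α s → Data}
  {eβ : ∀ s, β s → Data} {l : ∀ s, List (α s)} {n : S → ℕ}

/-- The entry number `i s` of a list can be read. Out of range the value is the integer `0`, which
needs no inhabitant of the type of the entries. -/
theorem getD {i : S → ℕ} (hi : PolyBdd κ.word i) (hlen : Modest κ fun s => (l s).length)
    (hl : Feas κ a fun s => .ofList (eα s) (l s)) (h : Feas κ a fun s => .int (i s)) :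
    Feas κ a fun s => ((l s).map (eα s)).getD (i s) (.int 0) := by
  have hfold := foldl (β := fun _ => ℤ × Data) (eβ := fun _ p => .pair (.int p.1) p.2)
    (init := fun s => ((i s : ℤ), Data.int 0))
    (step := fun s p x => (p.1 - 1, if p.1 = 0 then eα s x else p.2))
    (fun s pre p => p.1 = i s - pre.length) (by simp)
    (fun q => by simp [q.inv]; ring) hlen.1 hl (h.pair (int 0))
    ((var0.weaken.fst.sub (int 1) (((hi.add κ.two_le_word hlen.2).pull Frame.s).mono fun q => by
      rw [q.inv, q.eq]; simp; omega)).pair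
      (((var0.weaken.fst.eq (int 0)).ite' var0 var0.weaken.snd).congr fun q => by
        change _ = if q.b.1 = 0 then eα q.s q.x else q.b.2
        simp))
  refine hfold.snd.congr fun s => ?_
  have := List.foldl_countdown ((l s).map (eα s)) (i s) (.int 0)
  rw [List.foldl_map] at this
  rw [this]
  simp

theorem get {x : ∀ s, Fin (n s) → β s} {i : ∀ s, Fin (n s)} (hn : Modest κ n)
    (hx : Feas κ a fun s => .ofVec (eβ s) (x s)) (h : Feas κ a fun s => .ofFin (i s)) :
    Feas κ a fun s => eβ s (x s (i s)) := by
  refine (getD (l := fun s => List.ofFn (x s)) (eα := eβ) (i := fun s => i s)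
    (hn.2.mono fun s => (i s).2.le) (hn.mono (by simp)) hx h).congr fun s => ?_
  simp [List.getD]

theorem ofFn {x : ∀ s, Fin (n s) → β s} (hn : Modest κ n) (h : Feas κ a fun s => .int (n s))
    (hx : Feas (κ.pull (Idx.s : Idx n → S)) (fun q => .pair (.ofFin q.i) (a q.s))
      fun q => eβ q.s (x q.s q.i)) :
    Feas κ a fun s => .ofVec (eβ s) (x s) := by
  refine (map (α := fun s => Fin (n s)) (l := fun s => List.finRange (n s))
    (eα := fun s => Data.ofFin) (eβ := eβ) (f := x) (hn.1.mono (by simp))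
    (finRange hn.1 hn.2 h) (hx.pull fun q : Entry (fun s => List.finRange (n s)) => (⟨q.s,
        q.x⟩ : Idx n))).congr fun s => ?_
  rw [Data.ofVec, List.ofFn_eq_map]

theorem allFin {p : ∀ s, Fin (n s) → Bool} (hn : Modest κ n) (h : Feas κ a fun s => .int (n s))
    (hp : Feas (κ.pull (Idx.s : Idx n → S)) (fun q => .pair (.ofFin q.i) (a q.s))
      fun q => .ofBool (p q.s q.i)) :
    Feas κ a fun s => .ofBool (decide (∀ i, p s i = true)) := by
  refine (all (α := fun s => Fin (n s)) (l := fun s => List.finRange (n s))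
    (eα := fun s => Data.ofFin) (p := p) (hn.1.mono (by simp))
    (finRange hn.1 hn.2 h) (hp.pull fun q : Entry (fun s => List.finRange (n s)) => (⟨q.s,
        q.x⟩ : Idx n))).congr fun s => ?_
  congr 1
  rw [Bool.eq_iff_iff]
  simp

theorem anyFin {p : ∀ s, Fin (n s) → Bool} (hn : Modest κ n) (h : Feas κ a fun s => .int (n s))
    (hp : Feas (κ.pull (Idx.s : Idx n → S)) (fun q => .pair (.ofFin q.i) (a q.s))
      fun q => .ofBool (p q.s q.i)) :
    Feas κ a fun s => .ofBool (decide (∃ i, p s i = true)) := by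
  refine (any (α := fun s => Fin (n s)) (l := fun s => List.finRange (n s))
    (eα := fun s => Data.ofFin) (p := p) (hn.1.mono (by simp))
    (finRange hn.1 hn.2 h) (hp.pull fun q : Entry (fun s => List.finRange (n s)) => (⟨q.s,
        q.x⟩ : Idx n))).congr fun s => ?_
  congr 1
  rw [Bool.eq_iff_iff]
  simp

/-- The first entry of a list, with a default value for the empty list. -/
theorem headD {d : ∀ s, α s} (hl : Feas κ a fun s => .ofList (eα s) (l s))
    (hd : Feas κ a fun s => eα s (d s)) : Feas κ a fun s => eα s ((l s).headD (d s)) := by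
  have hhead : Feas (κ.pull (Subtype.val : {s // (l s).isEmpty = false} → S))
      (fun s => a s.1) fun s => eα s.1 ((l s.1).headD (d s.1)) := by
    refine (hl.pull _).comp (of_step (p := .fst) ?_)
    rintro ⟨s, hs⟩ W
    change Prog.Eval W .fst (.ofList (eα s) (l s)) [] (eα s ((l s).headD (d s))) 1
    cases h : l s with
    | nil => simp [h] at hs
    | cons x l => exact .fst _ _
  refine (ite (f := fun s => eα s (d s)) (g := fun s => eα s ((l s).headD (d s))) (isEmpty hl)
      (hd.pull _) hhead).congr fun s => ?_
  cases h : l s <;> simp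

section Finite

variable {C D : Type} [Fintype C] [Fintype D] {x : S → C} {y : S → D}

/-- Every function on a finite type is feasible: it is a look-up table. -/
theorem lookup (f : C → Data) (hx : Feas κ a fun s => .ofElt (x s)) :
    Feas κ a fun s => f (x s) :=
  (get (n := fun _ => Fintype.card C) (x := fun _ i => f ((Fintype.equivFin C).symm i))
    (eβ := fun _ d => d) (i := fun s => Fintype.equivFin C (x s)) (.const _) (const _) hx).congr
    fun s => by simp

theorem lookup₂ (f : C → D → Data) (hx : Feas κ a fun s => .ofElt (x s))
    (hy : Feas κ a fun s => .ofElt (y s)) : Feas κ a fun s => f (x s) (y s) :=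
  (get (n := fun _ => Fintype.card D) (x := fun s i => f (x s) ((Fintype.equivFin D).symm i))
    (eβ := fun _ d => d) (i := fun s => Fintype.equivFin D (y s)) (.const _)
    (lookup (fun c => .ofVec (fun d => d) fun i => f c ((Fintype.equivFin D).symm i)) hx)
    hy).congr fun s => by simp

theorem eltOfBool {b : S → Bool} (hb : Feas κ a fun s => .ofBool (b s)) :
    Feas κ a fun s => .ofElt (b s) :=
  (hb.ite' (const (.ofElt true)) (const (.ofElt false))).congr fun s => by cases b s <;> rfl

/-- A vector of elements of a finite type, of constant length, as one element of a finite type. -/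
theorem funElt {k : ℕ} {b : S → Fin k → C} (h : ∀ i, Feas κ a fun s => .ofElt (b s i)) :
    Feas κ a fun s => .ofElt (b s) := by
  induction k with
  | zero =>
    exact (const (.ofElt (Fin.elim0 : Fin 0 → C))).congr fun s =>
      congrArg _ (Subsingleton.elim _ _)
  | succ k ih =>
    have h' := ih (b := fun s i => b s i.succ) fun i => h i.succ
    exact (lookup₂ (fun c (f : Fin k → C) => .ofElt (Fin.cons c f : Fin (k + 1) → C)) (h 0)
      h').congr fun s => by congr 1; exact Fin.cons_self_tail (b s)

end Finite

/-- The coin tosses are all made at the beginning: a program can put a list of `J s` coin tosses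
into the environment. -/
theorem exists_toss {J : S → ℕ} (hJ : Modest κ J) (h : Feas κ a fun s => .int (J s)) :
    ∃ (p : Prog) (d : ℕ), ∀ s W, κ.word s ^ d ≤ W → ∀ b : List Bool, b.length = J s →
      ∃ t ≤ κ.time s ^ d, p.Eval W (a s) b (.pair (.ofList Data.ofBool b.reverse) (a s)) t := by
  let body : Prog := .pair (.comp .sub (.pair .fst (.const 1))) (.pair .coin .snd)
  let test : Prog := .comp .le (.pair (.const 1) .fst)
  obtain ⟨p, tp, wp, ht, hw, hp⟩ := h.elim
  obtain ⟨k₁, hk₁⟩ := (ht.add κ.two_le_time (hJ.1.mul (.const κ.two_le_time 50))).add κ.two_le_time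
    (.const κ.two_le_time 50)
  obtain ⟨k₂, hk₂⟩ := (hw.add κ.two_le_word hJ.2).add κ.two_le_word (.const κ.two_le_word 1)
  refine ⟨.pair (.comp .snd (.comp (.loop test body) (.pair p (.const 0)))) .id, max k₁ k₂,
    fun s W hW b hb => ?_⟩
  have hW' : wp s + J s + 1 ≤ W := (hk₂ s).trans ((Nat.pow_le_pow_right (one_le_two.trans
      (κ.two_le_word s))
    (le_max_right k₁ k₂)).trans hW)
  have hT := fun t (h : t ≤ tp s + J s * 50 + 50) => (h.trans (hk₁ s)).trans (Nat.pow_le_pow_right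
    (one_le_two.trans (κ.two_le_time s)) (le_max_left k₁ k₂))
  have h1 : (1 : ℤ).natAbs ≤ W := by simp; omega
  have loop : ∀ (b acc : List Bool), b.length ≤ J s → ∃ t ≤ b.length * 50 + 30,
      Prog.Eval W (.loop test body) (.pair (.int b.length) (.ofList Data.ofBool acc)) b
        (.pair (.int 0) (.ofList Data.ofBool (b.reverse ++ acc))) t := by
    intro b
    induction b with
    | nil =>
      intro acc _
      refine ⟨_, ?_, Prog.Eval.loop_stop (.comp (.pair (.const 1 _ h1) (.fst _ _)) (.le 1 _))⟩
      simp
    | cons c b ih =>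
      intro acc hi
      rw [List.length_cons] at hi
      obtain ⟨t, ht, ev⟩ := ih (c :: acc) (by omega)
      have e : ((b.length + 1 : ℕ) : ℤ) - 1 = b.length := by push_cast; ring
      set D := Data.ofList Data.ofBool acc with hD
      have hc : Prog.Eval W test (.pair (.int (b.length + 1 : ℕ)) D) [] (.int 1) 5 := by
        have := Prog.Eval.le (W := W) 1 (b.length + 1 : ℕ)
        rw [if_pos (by omega)] at this
        exact .comp (.pair (.const 1 _ h1) (.fst _ _)) this
      have hd : Prog.Eval W (.comp .sub (.pair .fst (.const 1)))
          (.pair (.int (b.length + 1 : ℕ)) D) [] (.int b.length) 5 := by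
        have := Prog.Eval.sub (W := W) (b.length + 1 : ℕ) 1 (by rw [e]; simp; omega)
        rw [e] at this
        exact .comp (.pair (.fst _ _) (.const 1 _ h1)) this
      have hl := Prog.Eval.loop_step hc (by simp) (.pair hd (.pair (.coin _ c) (.snd _ _))) ev
      refine ⟨_, ?_, by simpa using hl⟩
      rw [List.length_cons]
      omega
  obtain ⟨t, ht, ev⟩ := loop b [] (by omega)
  obtain ⟨t', ht', ev'⟩ := hp s W (by omega)
  rw [hb] at ev
  have := Prog.Eval.pair (.comp (.comp (.pair ev' (.const 0 _ (by simp))) ev) (.snd _ _)) (.id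
      (a s))
  simp only [List.nil_append, List.append_nil] at this
  exact ⟨_, hT _ (by rw [hb] at ht; omega), this⟩

end Feas

/-! ### Tables modulo two and variable elimination -/

/-- A row of a table: a cell for every vertex, and a key of `r` numbers modulo `R + 1`. -/
abbrev Row (E : Type) (n r R : ℕ) : Type := (Fin n → E) × (Fin r → ZMod (R + 1))

/-- A row is encoded by the vector of its cells, as numbers of elements of `E`, and the vector of
its keys, as their least nonnegative representatives. -/
noncomputable def Row.encode {E : Type} [Fintype E] {n r R : ℕ} (x : Row E n r R) : Data :=
  .pair (.ofVec Data.ofElt x.1) (.ofVec (fun z => .int z.val) x.2)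

/-- A table is a list of rows; it stands for a set of rows and is kept free of repetitions. -/
noncomputable def Table.encode {E : Type} [Fintype E] {n r R : ℕ} (t : List (Row E n r R)) : Data :=
  .ofList Row.encode t

/-- Addition of a row to a set of rows, modulo two. -/
def toggle {X : Type} [DecidableEq X] (x : X) (t : List X) : List X :=
  if x ∈ t then t.filter (· ≠ x) else x :: t

/-- The product of two tables: all the sums of a row of `t` and a row of `u`, with multiplicities
modulo two. -/
def Table.mul {X : Type} [DecidableEq X] [Add X] (t u : List X) : List X :=
  t.foldl (fun acc x => u.foldl (fun acc y => toggle (x + y) acc) acc) []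

/-- The product of a list of tables; the empty product consists of the row `0`. -/
def Table.prod {X : Type} [DecidableEq X] [AddZeroClass X] (F : List (List X)) : List X :=
  F.foldl Table.mul [0]

namespace Table

variable {E : Type} [AddCommMonoid E] [DecidableEq E] {n r R : ℕ}

/-- The elimination of the vertex `v`: only the rows with an admissible cell at `v` are kept, and
this cell is cleared. -/
def elim (ok : E → Bool) (v : Fin n) (t : List (Row E n r R)) : List (Row E n r R) :=
  t.foldl (fun acc x => if ok (x.1 v) then toggle (Function.update x.1 v 0, x.2) acc else acc) []

/-- Some row of the table has a nonzero cell at `v`; `0` stands for no information about `v`. -/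
def involves (v : Fin n) (t : List (Row E n r R)) : Bool := t.any fun x => !decide (x.1 v = 0)

/-- The elimination of `v` from a product of tables: the tables that involve `v` are multiplied,
and `v` is eliminated from their product. -/
def elimStep (ok : Fin n → E → Bool) (F : List (List (Row E n r R))) (v : Fin n) :
    List (List (Row E n r R)) :=
  elim (ok v) v (prod (F.filter (involves v))) :: F.filter fun t => !involves v t

/-- The elimination of the vertices in the order `ord`. The product of the tables is never written
down: only the tables that involve the current vertex are multiplied. -/
def elimAll (ok : Fin n → E → Bool) (ord : List (Fin n)) (F : List (List (Row E n r R))) :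
    List (List (Row E n r R)) :=
  ord.foldl (elimStep ok) F

end Table

theorem length_toggle_le {X : Type} [DecidableEq X] (x : X) (t : List X) :
    (toggle x t).length ≤ t.length + 1 := by
  unfold toggle
  split
  · exact (List.length_filter_le _ _).trans (Nat.le_succ _)
  · simp

/-- The dimensions of the rows of a computation are available and small. -/
structure Dims {S : Type} (κ : Scale S) (a : S → Data) (n R : S → ℕ) : Prop where
  hn : Modest κ n
  hR : Modest κ R
  n : Feas κ a fun s => .int (n s)
  R : Feas κ a fun s => .int (R s)

namespace Dims

variable {S S' : Type} {κ : Scale S} {a f : S → Data} {n R : S → ℕ}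

theorem pull (h : Dims κ a n R) (π : S' → S) :
    Dims (κ.pull π) (fun s => a (π s)) (fun s => n (π s)) fun s => R (π s) :=
  ⟨h.hn.pull π, h.hR.pull π, h.n.pull π, h.R.pull π⟩

theorem weaken (h : Dims κ a n R) : Dims κ (fun s => .pair (f s) (a s)) n R :=
  ⟨h.hn, h.hR, h.n.weaken, h.R.weaken⟩

end Dims

namespace Feas

variable {S : Type} {κ : Scale S} {a : S → Data} {n R : S → ℕ} {r : ℕ} {E : Type} [Fintype E]

section Rows

variable {x y : ∀ s, Row E (n s) r (R s)}

theorem rowCell {v : ∀ s, Fin (n s)} (hD : Dims κ a n R) (hx : Feas κ a fun s => (x s).encode)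
    (hv : Feas κ a fun s => .ofFin (v s)) : Feas κ a fun s => .ofElt ((x s).1 (v s)) :=
  get (β := fun _ => E) (eβ := fun _ => Data.ofElt) (x := fun s => (x s).1) hD.hn hx.fst hv

theorem rowKey {j : S → Fin r} (hx : Feas κ a fun s => (x s).encode)
    (hv : Feas κ a fun s => .ofFin (j s)) : Feas κ a fun s => .int ((x s).2 (j s)).val :=
  get (β := fun s => ZMod (R s + 1)) (eβ := fun _ z => .int z.val) (x := fun s => (x s).2)
    (.const r) hx.snd hv

/-- A row can be assembled from its cells, which are computed one by one, and its keys. -/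
theorem rowOfCells {c : ∀ s, Fin (n s) → E} {k : ∀ s, Fin r → ZMod (R s + 1)}
    (hD : Dims κ a n R)
    (hc : Feas (κ.pull (Idx.s : Idx n → S)) (fun q => .pair (.ofFin q.i) (a q.s))
      fun q => .ofElt (c q.s q.i))
    (hk : Feas κ a fun s => .ofVec (fun z => .int z.val) (k s)) :
    Feas κ a fun s => Row.encode ((c s, k s) : Row E (n s) r (R s)) :=
  (ofFn (β := fun _ => E) (eβ := fun _ => Data.ofElt) hD.hn hD.n hc).pair hk

/-- Addition modulo `R + 1` is one addition, one comparison and one subtraction. -/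
theorem zmodAdd {z w : ∀ s, ZMod (R s + 1)} (hR : Modest κ R) (hR' : Feas κ a fun s => .int (R s))
    (hz : Feas κ a fun s => .int (z s).val) (hw : Feas κ a fun s => .int (w s).val) :
    Feas κ a fun s => .int (z s + w s).val := by
  have hbd : PolyBdd κ.word fun s => 2 * R s := (PolyBdd.const κ.two_le_word 2).mul hR.2
  have h1 : Feas κ a fun s => .int ((z s).val + (w s).val : ℤ) := hz.add hw (hbd.mono fun s => by
    have h1 := ZMod.val_lt (z s)
    have h2 := ZMod.val_lt (w s)
    omega)
  have h2 : Feas κ a fun s => .int (((z s).val + (w s).val : ℤ) - (R s + 1 : ℤ)) :=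
    h1.sub (hR'.add (int 1) ((hR.2.add κ.two_le_word (.const κ.two_le_word 1)).mono
      fun s => by omega)) (hbd.add κ.two_le_word (.const κ.two_le_word 1) |>.mono fun s => by
    have h1 := ZMod.val_lt (z s)
    have h2 := ZMod.val_lt (w s)
    omega)
  refine ((h1.le hR').ite' h1 h2).congr fun s => ?_
  have h1 := ZMod.val_lt (z s)
  have h2 := ZMod.val_lt (w s)
  rw [ZMod.val_add]
  by_cases h : ((z s).val + (w s).val : ℤ) ≤ R s
  · rw [if_pos (by simpa using h), Nat.mod_eq_of_lt (by omega)]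
    push_cast; rfl
  · rw [if_neg (by simpa using h), Nat.mod_eq_sub_mod (by omega), Nat.mod_eq_of_lt (by omega),
      Nat.cast_sub (by omega)]
    push_cast; rfl

theorem rowAdd [AddCommMonoid E] (hD : Dims κ a n R) (hx : Feas κ a fun s => (x s).encode)
    (hy : Feas κ a fun s => (y s).encode) : Feas κ a fun s => (x s + y s).encode := by
  refine rowOfCells (c := fun s => (x s + y s).1) (k := fun s => (x s + y s).2) hD ?_ ?_
  · exact lookup₂ (fun c d : E => .ofElt (c + d))
      (rowCell (hD.pull _).weaken (hx.pull _).weaken var0)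
      (rowCell (hD.pull _).weaken (hy.pull _).weaken var0)
  · refine ofFn (β := fun s => ZMod (R s + 1)) (eβ := fun _ z => .int z.val) (n := fun _ => r)
      (.const r) (int r) ?_
    exact zmodAdd (hD.pull _).hR (hD.pull _).weaken.R
      (rowKey (hx.pull _).weaken var0) (rowKey (hy.pull _).weaken var0)

theorem rowEq [DecidableEq E] (hD : Dims κ a n R) (hx : Feas κ a fun s => (x s).encode)
    (hy : Feas κ a fun s => (y s).encode) : Feas κ a fun s => .ofBool (decide (x s = y s)) := by
  have h1 : Feas κ a fun s => .ofBool (decide (∀ i, decide ((x s).1 i = (y s).1 i) = true)) :=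
    allFin hD.hn hD.n (lookup₂ (fun c d : E => .ofBool (decide (c = d)))
      (rowCell (hD.pull _).weaken (hx.pull _).weaken var0)
      (rowCell (hD.pull _).weaken (hy.pull _).weaken var0))
  have h2 : Feas κ a fun s => .ofBool (decide (∀ j,
      decide ((((x s).2 j).val : ℤ) = ((y s).2 j).val) = true)) :=
    allFin (n := fun _ => r) (.const r) (int r)
      ((rowKey (hx.pull _).weaken var0).eq (rowKey (hy.pull _).weaken var0))
  refine (h1.and h2).congr fun s => ?_
  congr 1
  rw [Bool.eq_iff_iff]
  simp only [decide_eq_true_eq, Bool.and_eq_true, Prod.ext_iff, funext_iff, Nat.cast_inj]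
  exact and_congr_right fun _ => forall_congr' fun j => (ZMod.val_injective _).eq_iff

end Rows

section Tables

variable [AddCommMonoid E] [DecidableEq E] {t u : ∀ s, List (Row E (n s) r (R s))}

theorem toggle {x : ∀ s, Row E (n s) r (R s)} (hD : Dims κ a n R)
    (hlen : PolyBdd κ.time fun s => (t s).length)
    (hx : Feas κ a fun s => (x s).encode) (ht : Feas κ a fun s => Table.encode (t s)) :
    Feas κ a fun s => Table.encode (_root_.toggle (x s) (t s)) := by
  have heq : Feas (κ.pull (Entry.s : Entry t → S)) (fun q => .pair q.x.encode (a q.s))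
      fun q => .ofBool (decide (q.x = x q.s)) :=
    rowEq (hD.pull _).weaken var0 (hx.pull _).weaken
  have hmem : Feas κ a fun s => .ofBool ((t s).any fun y => decide (y = x s)) :=
    any (eα := fun _ => Row.encode) (p := fun s y => decide (y = x s)) hlen ht heq
  have hfilter : Feas κ a fun s => Table.encode ((t s).filter fun y => !decide (y = x s)) :=
    filter (eα := fun _ => Row.encode) (p := fun s y => !decide (y = x s)) hlen ht heq.not
  refine (hmem.ite' hfilter (hx.pair ht)).congr fun s => ?_
  unfold _root_.toggle
  by_cases h : x s ∈ t s
  · rw [if_pos (by simpa using h), if_pos h]; simp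
  · rw [if_neg (by simpa using h), if_neg h]; rfl

/-- Two tables can be multiplied in time polynomial in their lengths: no intermediate table is
longer than the number of pairs of rows considered so far. -/
theorem tableMul (hD : Dims κ a n R) (htlen : PolyBdd κ.time fun s => (t s).length)
    (hulen : PolyBdd κ.time fun s => (u s).length) (ht : Feas κ a fun s => Table.encode (t s))
    (hu : Feas κ a fun s => Table.encode (u s)) :
    Feas κ a fun s => Table.encode (Table.mul (t s) (u s)) := by
  have hinner : ∀ {s : S} (l : List (Row E (n s) r (R s))) (x : Row E (n s) r (R s))
      (acc : List (Row E (n s) r (R s))),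
      (l.foldl (fun acc y => _root_.toggle (x + y) acc) acc).length ≤ acc.length + l.length := by
    intro s l x
    induction l with
    | nil => simp
    | cons y l ih =>
      intro acc
      refine (ih _).trans ?_
      have := length_toggle_le (x + y) acc
      simp; omega
  refine foldl (α := fun s => Row E (n s) r (R s)) (eα := fun _ => Row.encode)
    (β := fun s => List (Row E (n s) r (R s))) (eβ := fun _ => Table.encode) (l := t)
    (init := fun _ => [])
    (step := fun s acc x => (u s).foldl (fun acc y => _root_.toggle (x + y) acc) acc)
    (fun s pre acc => acc.length ≤ pre.length * (u s).length) (by simp) ?_ htlen ht (int 0) ?_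
  · intro q
    refine (hinner _ _ _).trans ?_
    have := q.inv
    rw [List.length_append, List.length_singleton, add_mul]
    omega
  · set Inv : ∀ s, List (Row E (n s) r (R s)) → List (Row E (n s) r (R s)) → Prop :=
      fun s pre acc => acc.length ≤ pre.length * (u s).length
    have hb : PolyBdd (κ.pull (Frame.s : Frame t Inv → S)).time fun q => q.b.length :=
      ((htlen.mul hulen).pull (Frame.s : Frame t Inv → S)).mono fun q => q.inv.trans
        (Nat.mul_le_mul_right _ (by rw [q.eq]; simp))
    refine foldl (S := Frame t Inv) (α := fun q => Row E (n q.s) r (R q.s))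
      (eα := fun _ => Row.encode)
      (β := fun q => List (Row E (n q.s) r (R q.s))) (eβ := fun _ => Table.encode)
      (l := fun q => u q.s) (init := fun q => q.b)
      (step := fun q acc y => _root_.toggle (q.x + y) acc)
      (fun q pre acc => acc.length ≤ q.b.length + pre.length) (by simp) ?_ (hulen.pull _)
      (hu.pull Frame.s).weaken.weaken var0.weaken ?_
    · intro q
      refine (length_toggle_le _ _).trans ?_
      have := q.inv
      simp; omega
    · refine toggle ((hD.pull Frame.s).pull Frame.s).weaken.weaken.weaken.weaken ?_
        (rowAdd ((hD.pull Frame.s).pull Frame.s).weaken.weaken.weaken.weaken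
          var0.weaken.weaken var0) var0.weaken
      refine ((hb.add (κ.pull (Frame.s : Frame t Inv → S)).two_le_time
        (hulen.pull (Frame.s : Frame t Inv → S))).pull Frame.s).mono fun q => ?_
      refine q.inv.trans (Nat.add_le_add_left ?_ _)
      have := congrArg List.length q.eq
      simp at this; omega

/-- Tables can be multiplied one after the other if `L` bounds the lengths of the factors and of all
the partial products. -/
theorem tableProd {F : ∀ s, List (List (Row E (n s) r (R s)))} {L : S → ℕ} (hD : Dims κ a n R)
    (hlen : PolyBdd κ.time fun s => (F s).length) (hL : PolyBdd κ.time L)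
    (hF : ∀ s, ∀ t ∈ F s, t.length ≤ L s)
    (hF' : ∀ s, ∀ G, G <+: F s → (Table.prod G).length ≤ L s)
    (h : Feas κ a fun s => .ofList Table.encode (F s)) :
    Feas κ a fun s => Table.encode (Table.prod (F s)) := by
  have hone : Feas κ a fun s => Table.encode [(0 : Row E (n s) r (R s))] := by
    refine (rowOfCells (c := fun s _ => 0) (k := fun s _ => 0) hD (const (.ofElt (0 : E)))
      ?_).pair (int 0)
    exact ofFn (β := fun s => ZMod (R s + 1)) (eβ := fun _ z => .int z.val) (n := fun _ => r)
      (x := fun _ _ => 0) (.const r) (int r) ((int 0).congr fun q => by simp)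
  refine foldl (α := fun s => List (Row E (n s) r (R s))) (eα := fun _ => Table.encode)
    (β := fun s => List (Row E (n s) r (R s))) (eβ := fun _ => Table.encode) (l := F)
    (init := fun _ => [0]) (step := fun _ => Table.mul)
    (fun s pre acc => acc = Table.prod pre) (by simp [Table.prod]) ?_ hlen h hone ?_
  · intro q
    rw [q.inv, Table.prod, Table.prod, List.foldl_append]; rfl
  · refine tableMul (hD.pull Frame.s).weaken.weaken ?_ ?_ var0.weaken var0
    · refine (hL.pull Frame.s).mono fun q => ?_
      rw [q.inv]
      exact hF' q.s q.pre ⟨_, q.eq.symm⟩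
    · exact (hL.pull Frame.s).mono fun q => hF q.s q.x q.mem

/-- The test of a cell depends on the vertex through a class `cls` from a finite type. -/
theorem tableElim {C : Type} [Fintype C] {cls : ∀ s, Fin (n s) → C} {ok : C → E → Bool}
    {v : ∀ s, Fin (n s)} (hD : Dims κ a n R) (htlen : PolyBdd κ.time fun s => (t s).length)
    (hcls : Feas κ a fun s => .ofVec Data.ofElt (cls s)) (ht : Feas κ a fun s => Table.encode (t s))
    (hv : Feas κ a fun s => .ofFin (v s)) :
    Feas κ a fun s => Table.encode (Table.elim (ok (cls s (v s))) (v s) (t s)) := by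
  refine foldl (α := fun s => Row E (n s) r (R s)) (eα := fun _ => Row.encode)
    (β := fun s => List (Row E (n s) r (R s))) (eβ := fun _ => Table.encode) (l := t)
    (init := fun _ => [])
    (step := fun s acc x => if ok (cls s (v s)) (x.1 (v s)) then
      _root_.toggle (Function.update x.1 (v s) 0, x.2) acc else acc)
    (fun s pre acc => acc.length ≤ pre.length) (by simp) ?_ htlen ht (int 0) ?_
  · intro q
    have := q.inv
    have := length_toggle_le ((Function.update q.x.1 (v q.s) 0, q.x.2) : Row E (n q.s) r
        (R q.s)) q.b
    split <;> simp <;> omega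
  · set Inv : ∀ s, List (Row E (n s) r (R s)) → List (Row E (n s) r (R s)) → Prop :=
      fun s pre acc => acc.length ≤ pre.length
    have hD' := (hD.pull (Frame.s : Frame t Inv → S))
    have hv' : Feas (κ.pull (Frame.s : Frame t Inv → S)) (fun q => a q.s) fun q => .ofFin (v q.s) :=
      hv.pull _
    have hcls' := get (β := fun _ => C) (eβ := fun _ => Data.ofElt) hD'.hn
      (hcls.pull (Frame.s : Frame t Inv → S)) hv'
    have htest := lookup₂ (fun c e => .ofBool (ok c e)) hcls'.weaken.weaken
      (rowCell (a := fun q : Frame t Inv => .pair q.x.encode (.pair (Table.encode q.b) (a q.s)))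
        hD'.weaken.weaken (var0 (f := fun q : Frame t Inv => q.x.encode)) hv'.weaken.weaken)
    have hDi := (hD'.weaken (f := fun q => Table.encode q.b) |>.weaken
      (f := fun q => Row.encode q.x)).pull (Idx.s : Idx (fun q : Frame t Inv => n q.s) → _)
    have hcell := rowCell (S := Idx (fun q : Frame t Inv => n q.s))
      (a := fun q => .pair (.ofFin q.i) (.pair q.s.x.encode (.pair (Table.encode q.s.b) (a q.s.s))))
      (x := fun q => q.s.x) (v := fun q => q.i) hDi.weaken var0.weaken var0
    have hi := ((hv'.weaken (f := fun q => Table.encode q.b) |>.weaken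
      (f := fun q => Row.encode q.x)).pull (Idx.s : Idx (fun q : Frame t Inv => n q.s) → _)).weaken
      (f := fun q => .ofFin q.i)
    have hsame := (var0 (κ := (κ.pull Frame.s).pull Idx.s)
      (f := fun q : Idx (fun q : Frame t Inv => n q.s) => .ofFin q.i)).eq
      (x := fun q : Idx (fun q : Frame t Inv => n q.s) => (q.i : ℕ))
      (y := fun q : Idx (fun q : Frame t Inv => n q.s) => (v q.s.s : ℕ)) hi
    refine (htest.ite' (toggle (x := fun q : Frame t Inv =>
        ((Function.update q.x.1 (v q.s) 0, q.x.2) : Row E (n q.s) r (R q.s)))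
      hD'.weaken.weaken ?_ (rowOfCells hD'.weaken.weaken ?_ var0.snd) var0.weaken)
      var0.weaken).congr fun q => ?_
    · refine (htlen.pull Frame.s).mono fun q => ?_
      refine q.inv.trans ?_
      rw [q.eq]; simp
    · refine ((hsame.ite' (const (.ofElt (0 : E))) hcell).congr
        fun q => ?_)
      simp only [Nat.cast_inj, Function.update_apply, Fin.ext_iff]
      by_cases h : (q.i : ℕ) = v q.s.s <;> simp [h]
    · cases ok (cls q.s (v q.s)) (q.x.1 (v q.s)) <;> rfl

/-- All the vertices can be eliminated if `L` bounds the lengths of all the tables, and of all the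
partial products, that come up on the way. -/
theorem tableElimAll {C : Type} [Fintype C] {cls : ∀ s, Fin (n s) → C} {ok : C → E → Bool}
    {F : ∀ s, List (List (Row E (n s) r (R s)))} {ord : ∀ s, List (Fin (n s))} {L : S → ℕ}
    (hD : Dims κ a n R) (hlen : PolyBdd κ.time fun s => (F s).length)
    (hord : PolyBdd κ.time fun s => (ord s).length) (hL : PolyBdd κ.time L)
    (hF : ∀ s, ∀ pre, pre <+: ord s →
      ∀ t ∈ Table.elimAll (fun v => ok (cls s v)) pre (F s), t.length ≤ L s)
    (hF' : ∀ s, ∀ pre v, pre ++ [v] <+: ord s →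
      ∀ G, G <+: (Table.elimAll (fun v => ok (cls s v)) pre (F s)).filter (Table.involves v) →
        (Table.prod G).length ≤ L s)
    (hcls : Feas κ a fun s => .ofVec Data.ofElt (cls s))
    (h : Feas κ a fun s => .ofList Table.encode (F s))
    (hord' : Feas κ a fun s => .ofList Data.ofFin (ord s)) :
    Feas κ a fun s => .ofList Table.encode
      (Table.elimAll (fun v => ok (cls s v)) (ord s) (F s)) := by
  refine foldl (α := fun s => Fin (n s)) (eα := fun _ => Data.ofFin)
    (β := fun s => List (List (Row E (n s) r (R s)))) (eβ := fun _ => Data.ofList Table.encode)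
    (l := ord) (init := F) (step := fun s => Table.elimStep fun v => ok (cls s v))
    (fun s pre G => G = Table.elimAll (fun v => ok (cls s v)) pre (F s) ∧
      G.length ≤ (F s).length + pre.length) (by simp [Table.elimAll]) ?_ hord hord' h ?_
  · intro q
    refine ⟨?_, ?_⟩
    · rw [q.inv.1, Table.elimAll, Table.elimAll, List.foldl_append]; rfl
    · have := q.inv.2
      have := List.length_filter_le (fun t => !Table.involves q.x t) q.b
      simp only [Table.elimStep, List.length_cons, List.length_append, List.length_nil]
      omega
  · set Inv : ∀ s, List (Fin (n s)) → List (List (Row E (n s) r (R s))) → Prop :=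
      fun s pre G => G = Table.elimAll (fun v => ok (cls s v)) pre (F s) ∧
        G.length ≤ (F s).length + pre.length
    have hpre : ∀ q : Frame ord Inv, q.pre ++ [q.x] <+: ord q.s :=
      fun q => ⟨q.post, by rw [q.eq]; simp⟩
    have hpre' : ∀ q : Frame ord Inv, q.pre <+: ord q.s := fun q => ⟨_, q.eq.symm⟩
    have hD' := (hD.pull (Frame.s : Frame ord Inv → S)).weaken (f := fun q =>
      .ofList Table.encode q.b) |>.weaken (f := fun q => Data.ofFin q.x)
    have hb : PolyBdd (κ.pull (Frame.s : Frame ord Inv → S)).time fun q => q.b.length :=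
      ((hlen.add κ.two_le_time hord).pull (Frame.s : Frame ord Inv → S)).mono fun q =>
        q.inv.2.trans (Nat.add_le_add_left (by rw [q.eq]; simp) _)
    have hmem : ∀ q : Frame ord Inv, ∀ t ∈ q.b, t.length ≤ L q.s := fun q t ht =>
      hF q.s q.pre (hpre' q) t (by rw [← q.inv.1]; exact ht)
    have hinv : Feas ((κ.pull (Frame.s : Frame ord Inv → S)).pull
        (Entry.s : Entry (fun q : Frame ord Inv => q.b) → _))
        (fun e => .pair (Table.encode e.x) (.pair (Data.ofFin e.s.x)
          (.pair (.ofList Table.encode e.s.b) (a e.s.s))))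
        fun e => .ofBool (Table.involves e.s.x e.x) := by
      refine any (S := Entry (fun q : Frame ord Inv => q.b))
        (α := fun e => Row E (n e.s.s) r (R e.s.s)) (eα := fun _ => Row.encode)
        (l := fun e => e.x) (p := fun e x => !decide (x.1 e.s.x = 0))
        ((hL.pull _).mono fun e => hmem e.s e.x e.mem) var0 ?_
      have hD'' := ((hD'.pull (Entry.s : Entry (fun q : Frame ord Inv => q.b) → _)).weaken
        (f := fun e => Table.encode e.x)).pull (Entry.s : Entry (S := Entry
            (fun q : Frame ord Inv =>
          q.b)) (α := fun e => Row E (n e.s.s) r (R e.s.s)) (fun e => e.x) → _) |>.weaken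
        (f := fun e => Row.encode e.x)
      exact (lookup (fun c : E => .ofBool (decide (c = 0))) (rowCell (x := fun e => e.x)
        (v := fun e => e.s.s.x) hD'' var0 var0.weaken.weaken)).not
    have hin := filter (a := fun q => .pair (Data.ofFin q.x) (.pair (.ofList Table.encode q.b)
        (a q.s))) (α := fun q : Frame ord Inv => List (Row E (n q.s) r (R q.s)))
      (eα := fun _ => Table.encode) (l := fun q => q.b)
      (p := fun q t => Table.involves q.x t) hb var0.weaken hinv
    have hout := filter (a := fun q => .pair (Data.ofFin q.x) (.pair (.ofList Table.encode q.b)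
        (a q.s))) (α := fun q : Frame ord Inv => List (Row E (n q.s) r (R q.s)))
      (eα := fun _ => Table.encode) (l := fun q => q.b)
      (p := fun q t => !Table.involves q.x t) hb var0.weaken hinv.not
    have hprod := tableProd (F := fun q : Frame ord Inv => q.b.filter (Table.involves q.x))
      (L := fun q => L q.s) hD' (hb.mono fun q => List.length_filter_le _ _) (hL.pull Frame.s)
      (fun q t ht => hmem q t (List.mem_of_mem_filter ht))
      (fun q G hG => hF' q.s q.pre q.x (hpre q) G (by rw [← q.inv.1]; exact hG)) hin
    refine (tableElim (cls := fun q : Frame ord Inv => cls q.s) (ok := ok) (v := fun q => q.x)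
      hD' ((hL.pull Frame.s).mono fun q => hF' q.s q.pre q.x (hpre q) _ ?_)
      (hcls.pull Frame.s).weaken.weaken hprod var0).pair hout
    rw [← q.inv.1]

end Tables

end Feas

/-! ### Tables as elements of a monoid algebra over the field with two elements -/

section Rep

variable {X : Type} [AddCommMonoid X] [DecidableEq X]

/-- The formal sum of the rows of a table. -/
noncomputable def Table.rep {X : Type} (t : List X) : AddMonoidAlgebra (ZMod 2) X :=
  (t.map fun x => AddMonoidAlgebra.single x 1).sum

namespace Table

open AddMonoidAlgebra

theorem rep_cons (x : X) (t : List X) : rep (x :: t) = single x 1 + rep t := by simp [rep]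

theorem single_add_self (x : X) : (single x 1 + single x 1 : AddMonoidAlgebra (ZMod 2) X) = 0 := by
  rw [← single_add, show (1 + 1 : ZMod 2) = 0 from rfl, single_zero]

theorem nodup_toggle (x : X) {t : List X} (ht : t.Nodup) : (toggle x t).Nodup := by
  unfold toggle
  split
  · exact ht.filter _
  · exact List.nodup_cons.2 ⟨‹_›, ht⟩

theorem rep_toggle (x : X) {t : List X} (ht : t.Nodup) :
    rep (toggle x t) = single x 1 + rep t := by
  unfold toggle
  split
  case isFalse => exact rep_cons x t
  case isTrue h =>
    induction t with
    | nil => simp at h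
    | cons y t ih =>
      obtain ⟨hy, ht⟩ := List.nodup_cons.1 ht
      by_cases hxy : y = x
      · subst hxy
        rw [List.filter_cons_of_neg (by simp), List.filter_eq_self.2, rep_cons, ← add_assoc,
          single_add_self, zero_add]
        intro z hz
        have : z ≠ y := by rintro rfl; exact hy hz
        simpa using this
      · rw [List.filter_cons_of_pos (by simpa using hxy), rep_cons, rep_cons,
          ih ht (by rcases List.mem_cons.1 h with rfl | h; exacts [absurd rfl hxy, h])]
        abel

/-- A table without repetitions can be recovered from the element of the monoid algebra. -/
theorem coeff_rep {t : List X} (ht : t.Nodup) (x : X) :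
    (rep t).coeff x = if x ∈ t then 1 else 0 := by
  induction t with
  | nil => simp [rep]
  | cons y t ih =>
    obtain ⟨hy, ht⟩ := List.nodup_cons.1 ht
    rw [rep_cons, coeff_add, Finsupp.add_apply, ih ht, coeff_single, Finsupp.single_apply]
    by_cases h : y = x
    · subst h; simp [hy]
    · simp [h, Ne.symm h]

theorem foldl_toggle (f : X → X) (u : List X) {acc : List X} (h : acc.Nodup) :
    (u.foldl (fun acc y => toggle (f y) acc) acc).Nodup ∧
      rep (u.foldl (fun acc y => toggle (f y) acc) acc) = rep (u.map f) + rep acc := by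
  induction u generalizing acc with
  | nil => simp [rep, h]
  | cons y u ih =>
    obtain ⟨h1, h2⟩ := ih (nodup_toggle (f y) h)
    refine ⟨h1, ?_⟩
    rw [List.foldl_cons, h2, rep_toggle _ h, List.map_cons, rep_cons]
    abel

theorem rep_map_add (x : X) (u : List X) : rep (u.map (x + ·)) = single x 1 * rep u := by
  induction u with
  | nil => simp [rep]
  | cons y u ih =>
    rw [List.map_cons, rep_cons, rep_cons, ih, mul_add, single_mul_single, one_mul]

/-- Multiplication of tables modulo two is multiplication in the monoid algebra. -/
theorem nodup_rep_mul (t u : List X) : (mul t u).Nodup ∧ rep (mul t u) = rep t * rep u := by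
  have : ∀ acc : List X, acc.Nodup →
      (t.foldl (fun acc x => u.foldl (fun acc y => toggle (x + y) acc) acc) acc).Nodup ∧
      rep (t.foldl (fun acc x => u.foldl (fun acc y => toggle (x + y) acc) acc) acc) =
        rep t * rep u + rep acc := by
    induction t with
    | nil => intro acc h; simp [rep, h]
    | cons x t ih =>
      intro acc h
      obtain ⟨h1, h2⟩ := foldl_toggle (x + ·) u h
      obtain ⟨h3, h4⟩ := ih _ h1
      refine ⟨h3, ?_⟩
      rw [List.foldl_cons, h4, h2, rep_cons, add_mul, rep_map_add]
      abel
  simpa [rep, mul] using this [] List.nodup_nil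

theorem nodup_rep_prod (F : List (List X)) :
    (prod F).Nodup ∧ rep (prod F) = (F.map rep).prod := by
  have : ∀ t : List X, t.Nodup → (F.foldl mul t).Nodup ∧
      rep (F.foldl mul t) = rep t * (F.map rep).prod := by
    induction F with
    | nil => intro t ht; simp [ht]
    | cons u F ih =>
      intro t ht
      obtain ⟨h1, h2⟩ := nodup_rep_mul t u
      obtain ⟨h3, h4⟩ := ih _ h1
      refine ⟨h3, ?_⟩
      rw [List.foldl_cons, h4, h2, List.map_cons, List.prod_cons, mul_assoc]
  obtain ⟨h1, h2⟩ := this [0] (by simp)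
  refine ⟨h1, h2.trans ?_⟩
  simp [rep, ← one_def]

end Table

end Rep

namespace Table

open AddMonoidAlgebra

variable {E : Type} [AddCommMonoid E] [DecidableEq E] {n r R : ℕ}

/-- The additive extension of a map defined on the rows. -/
noncomputable def extend {X : Type} (f : X → AddMonoidAlgebra (ZMod 2) X) :
    AddMonoidAlgebra (ZMod 2) X →+ AddMonoidAlgebra (ZMod 2) X :=
  (Finsupp.linearCombination (ZMod 2) f).toAddMonoidHom.comp coeffAddEquiv.toAddMonoidHom

theorem extend_single {X : Type} (f : X → AddMonoidAlgebra (ZMod 2) X) (x : X) :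
    extend f (single x 1) = f x := by
  change Finsupp.linearCombination (ZMod 2) f (Finsupp.single x 1) = f x
  simp

/-- The elimination of the vertex `v`, as an additive map. -/
noncomputable def elimHom (ok : E → Bool) (v : Fin n) :
    AddMonoidAlgebra (ZMod 2) (Row E n r R) →+ AddMonoidAlgebra (ZMod 2) (Row E n r R) :=
  extend fun x => if ok (x.1 v) then single (Function.update x.1 v 0, x.2) 1 else 0

theorem elimHom_single (ok : E → Bool) (v : Fin n) (x : Row E n r R) :
    elimHom ok v (single x 1) =
      if ok (x.1 v) then single (Function.update x.1 v 0, x.2) 1 else 0 :=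
  extend_single _ _

theorem nodup_rep_elim (ok : E → Bool) (v : Fin n) (t : List (Row E n r R)) :
    (elim ok v t).Nodup ∧ rep (elim ok v t) = elimHom ok v (rep t) := by
  have : ∀ acc : List (Row E n r R), acc.Nodup →
      (t.foldl (fun acc x => if ok (x.1 v) then toggle (Function.update x.1 v 0, x.2) acc else acc)
        acc).Nodup ∧
      rep (t.foldl (fun acc x => if ok (x.1 v) then toggle (Function.update x.1 v 0, x.2) acc
        else acc) acc) = elimHom ok v (rep t) + rep acc := by
    induction t with
    | nil => intro acc h; simp [rep, h]
    | cons x t ih =>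
      intro acc h
      rw [List.foldl_cons, rep_cons, map_add, elimHom_single]
      split
      · obtain ⟨h1, h2⟩ := ih _ (nodup_toggle (Function.update x.1 v 0, x.2) h)
        refine ⟨h1, ?_⟩
        rw [h2, rep_toggle _ h]
        abel
      · simpa using ih _ h
  simpa [rep, elim] using this [] List.nodup_nil

/-- The elimination of `v` is linear over the tables that do not involve `v`. This is why the
elimination can be confined to the other tables. -/
theorem elimHom_mul {ok : E → Bool} {v : Fin n} {t : List (Row E n r R)}
    (ht : ∀ x ∈ t, x.1 v = 0) (q : AddMonoidAlgebra (ZMod 2) (Row E n r R)) :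
    elimHom ok v (rep t * q) = rep t * elimHom ok v q := by
  induction t with
  | nil => simp [rep]
  | cons x t ih =>
    rw [rep_cons, add_mul, add_mul, map_add, ih fun y hy => ht y (List.mem_cons_of_mem _ hy)]
    refine congrArg (· + _) ?_
    have hx : x.1 v = 0 := ht x List.mem_cons_self
    clear ih
    induction q using AddMonoidAlgebra.induction_linear with
    | zero => simp
    | add p q hp hq => rw [mul_add, map_add, hp, hq, map_add, mul_add]
    | single y c =>
      have hc : c = 0 ∨ c = 1 := by revert c; decide
      rcases hc with rfl | rfl
      · simp
      · rw [single_mul_single, one_mul, elimHom_single, elimHom_single, Prod.fst_add,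
          Pi.add_apply, hx, zero_add]
        split
        · rw [single_mul_single, one_mul]
          congr 1
          refine Prod.ext ?_ rfl
          funext w
          by_cases h : w = v
          · subst h; simp [hx]
          · simp [h]
        · simp

/-- An elimination step on the list of tables is the elimination of `v` from their product. -/
theorem rep_elimStep (ok : Fin n → E → Bool) (F : List (List (Row E n r R))) (v : Fin n) :
    ((elimStep ok F v).map rep).prod = elimHom (ok v) v (F.map rep).prod := by
  have hfree : ∀ (G : List (List (Row E n r R))) (q : AddMonoidAlgebra (ZMod 2) (Row E n r R)),
      (∀ t ∈ G, involves v t = false) →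
      elimHom (ok v) v ((G.map rep).prod * q) = (G.map rep).prod * elimHom (ok v) v q := by
    intro G q
    induction G with
    | nil => simp
    | cons t G ih =>
      intro h
      rw [List.map_cons, List.prod_cons, mul_assoc, elimHom_mul, ih fun t ht =>
        h t (List.mem_cons_of_mem _ ht), mul_assoc]
      intro x hx
      have := h t List.mem_cons_self
      simp only [involves, List.any_eq_false] at this
      simpa using this x hx
  have hsplit : (F.map rep).prod = ((F.filter fun t => !involves v t).map rep).prod *
      ((F.filter (involves v)).map rep).prod := by
    induction F with
    | nil => simp
    | cons t F ih =>
      rw [List.map_cons, List.prod_cons, ih]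
      cases h : involves v t
      · rw [List.filter_cons_of_pos (by simp [h]), List.filter_cons_of_neg (by simp [h])]
        simp [mul_assoc]
      · rw [List.filter_cons_of_neg (by simp [h]), List.filter_cons_of_pos (by simp [h])]
        simp [mul_left_comm]
  rw [elimStep, List.map_cons, List.prod_cons, (nodup_rep_elim _ _ _).2, (nodup_rep_prod _).2,
    hsplit, hfree _ _ (by simp), mul_comm]

theorem rep_prod_elimAll (ok : Fin n → E → Bool) (ord : List (Fin n))
    (F : List (List (Row E n r R))) :
    rep (prod (elimAll ok ord F)) =
      ord.foldl (fun p v => elimHom (ok v) v p) (F.map rep).prod := by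
  rw [(nodup_rep_prod _).2, elimAll]
  induction ord generalizing F with
  | nil => rfl
  | cons v ord ih => rw [List.foldl_cons, ih, rep_elimStep, List.foldl_cons]

theorem foldl_elimHom_sum (ok : Fin n → E → Bool) (ord : List (Fin n)) {ι : Type} (s : Finset ι)
    (p : ι → AddMonoidAlgebra (ZMod 2) (Row E n r R)) :
    ord.foldl (fun p v => elimHom (ok v) v p) (∑ i ∈ s, p i) =
      ∑ i ∈ s, ord.foldl (fun p v => elimHom (ok v) v p) (p i) := by
  induction ord generalizing p with
  | nil => rfl
  | cons v ord ih => rw [List.foldl_cons, map_sum, ih]; rfl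

/-- The elimination of all the vertices keeps a single row if and only if all its cells are
admissible, and clears its cells. -/
theorem foldl_elimHom_single (ok : Fin n → E → Bool) {ord : List (Fin n)} (hord : ord.Nodup)
    (x : Row E n r R) :
    ord.foldl (fun p v => elimHom (ok v) v p) (single x 1) =
      if ∀ v ∈ ord, ok v (x.1 v) = true then
        single ((fun v => if v ∈ ord then 0 else x.1 v), x.2) 1 else 0 := by
  induction ord generalizing x with
  | nil => simp
  | cons v ord ih =>
    obtain ⟨hv, hord⟩ := List.nodup_cons.1 hord
    rw [List.foldl_cons, elimHom_single]
    have hu : ∀ w ∈ ord, Function.update x.1 v 0 w = x.1 w := fun w hw =>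
      Function.update_of_ne (by rintro rfl; exact hv hw) _ _
    split
    case isTrue h =>
      rw [ih hord]
      have : (∀ w ∈ ord, ok w (Function.update x.1 v 0 w) = true) ↔
          ∀ w ∈ v :: ord, ok w (x.1 w) = true := by
        rw [List.forall_mem_cons, and_iff_right h]
        exact forall₂_congr fun w hw => by rw [hu w hw]
      simp only [this]
      congr 3
      funext w
      by_cases hw : w = v
      · subst hw; simp
      · simp [hw]
    case isFalse h =>
      rw [if_neg fun h' => h (h' v List.mem_cons_self)]
      have : ∀ l : List (Fin n), l.foldl (fun (p : AddMonoidAlgebra (ZMod 2) (Row E n r R)) v =>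
          elimHom (ok v) v p) 0 = 0 := by
        intro l
        induction l with
        | nil => rfl
        | cons w l ih => rw [List.foldl_cons, map_zero, ih]
      exact this ord

end Table

/-! ### Local counting problems -/

/-- What a partial solution knows about a vertex: nothing, its label and the sum of the
contributions of the edges seen so far, or that it was given two different labels. -/
inductive Cell (A M : Type) : Type
  | none
  | val (a : A) (m : M)
  | bad
  deriving DecidableEq

namespace Cell

variable {A M : Type} [DecidableEq A] [AddCommMonoid M]

instance [Fintype A] [Fintype M] : Fintype (Cell A M) :=
  Fintype.ofEquiv (Option (Option (A × M)))
    { toFun := fun x => match x with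
        | .none => .none
        | some .none => .bad
        | some (some (a, m)) => .val a m
      invFun := fun x => match x with
        | .none => .none
        | .bad => some .none
        | .val a m => some (some (a, m))
      left_inv := by rintro (_ | _ | ⟨a, m⟩) <;> rfl
      right_inv := by rintro (_ | ⟨a, m⟩ | _) <;> rfl }

instance : Zero (Cell A M) := ⟨.none⟩

instance : Add (Cell A M) where
  add
    | .none, y => y
    | x, .none => x
    | .val a m, .val a' m' => if a = a' then .val a (m + m') else .bad
    | _, _ => .bad

theorem val_add_val (a a' : A) (m m' : M) :
    (val a m + val a' m' : Cell A M) = if a = a' then .val a (m + m') else .bad := rfl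

theorem add_bad (x : Cell A M) : x + bad = bad := by cases x <;> rfl

theorem bad_add (x : Cell A M) : bad + x = bad := by cases x <;> rfl

theorem add_none (x : Cell A M) : x + none = x := by cases x <;> rfl

theorem none_add (x : Cell A M) : none + x = x := by cases x <;> rfl

instance : AddCommMonoid (Cell A M) where
  zero_add := none_add
  add_zero := add_none
  add_comm x y := by
    rcases x with _ | ⟨a, m⟩ | _ <;> rcases y with _ | ⟨a', m'⟩ | _ <;> try rfl
    rw [val_add_val, val_add_val, add_comm m]
    by_cases h : a = a'
    · simp [h]
    · simp [h, Ne.symm h]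
  add_assoc x y z := by
    rcases x with _ | ⟨a, m⟩ | _ <;> rcases y with _ | ⟨a', m'⟩ | _ <;>
      rcases z with _ | ⟨a'', m''⟩ | _ <;>
      simp only [none_add, add_none, bad_add, add_bad, val_add_val]
    · split
      · rename_i h
        subst h
        split
        · rename_i h
          subst h
          rw [val_add_val, val_add_val, if_pos rfl, if_pos rfl, add_assoc]
        · rename_i h
          rw [val_add_val, if_neg h, add_bad]
      · rename_i h
        rw [bad_add]
        split
        · rw [val_add_val, if_neg h]
        · rw [add_bad]
  nsmul := nsmulRec

open Classical in
/-- The label of a vertex and contributions to it: they have to agree on the label. -/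
theorem val_add_sum {ι : Type} (s : Finset ι) (a : A) (b : ι → A) (m : M) (g : ι → M)
    (p : ι → Prop) :
    (val a m + ∑ i ∈ s, if p i then val (b i) (g i) else 0 : Cell A M) =
      if ∀ i ∈ s, p i → b i = a then val a (m + ∑ i ∈ s, if p i then g i else 0) else bad := by
  induction s using Finset.induction_on with
  | empty => simp
  | insert i s hi ih =>
    rw [Finset.sum_insert hi, add_left_comm, ih, Finset.sum_insert hi]
    by_cases hs : ∀ i ∈ s, p i → b i = a
    · rw [if_pos hs]
      by_cases hp : p i
      · by_cases hb : b i = a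
        · rw [if_pos hp, if_pos hp, val_add_val, if_pos hb, if_pos, hb, add_left_comm]
          intro j hj
          rcases Finset.mem_insert.1 hj with rfl | hj
          exacts [fun _ => hb, hs j hj]
        · rw [if_pos hp, val_add_val, if_neg hb, if_neg]
          exact fun h => hb (h i (Finset.mem_insert_self _ _) hp)
      · rw [if_neg hp, if_neg hp, zero_add, zero_add, if_pos]
        intro j hj
        rcases Finset.mem_insert.1 hj with rfl | hj
        exacts [fun h => absurd h hp, hs j hj]
    · rw [if_neg hs, add_bad, if_neg]
      exact fun h => hs fun j hj => h j (Finset.mem_insert_of_mem hj)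

end Cell

/-- A counting problem on the labellings of the vertices by `A` and of the edges by `B`.  An edge
`e = (u, u')` with label `b` whose ends have the labels `a` and `a'` contributes the two components
of `con a a' b` to its ends `u` and `u'`; the label `a` of a vertex `v` and the sum `m` of the
contributions to `v` have to satisfy `okV v a m`. -/
structure LocalProblem (A B M : Type) (n m r R : ℕ) where
  ends : Fin m → Fin n × Fin n
  con : A → A → B → M × M
  okV : Fin n → A → M → Bool
  okE : Fin m → B → Bool
  keyV : Fin n → A → Fin r → ZMod (R + 1)
  keyE : Fin m → B → Fin r → ZMod (R + 1)

namespace LocalProblem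

variable {A B M : Type} [Fintype A] [Fintype B] [DecidableEq A] [DecidableEq M]
  [AddCommMonoid M] {n m r R : ℕ} (P : LocalProblem A B M n m r R)

/-- The contribution of the edge `e` to the vertex `v`. -/
def inc (σ : Fin n → A) (τ : Fin m → B) (v : Fin n) (e : Fin m) : M :=
  if v = (P.ends e).1 then (P.con (σ (P.ends e).1) (σ (P.ends e).2) (τ e)).1
  else if v = (P.ends e).2 then (P.con (σ (P.ends e).1) (σ (P.ends e).2) (τ e)).2 else 0

/-- The labels of the edges are admissible, and at every vertex the label and the sum of the
contributions fit together. -/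
def IsSol (p : (Fin n → A) × (Fin m → B)) : Prop :=
  (∀ e, P.okE e (p.2 e) = true) ∧ ∀ v, P.okV v (p.1 v) (∑ e, P.inc p.1 p.2 v e) = true

/-- The key of a labelling is the sum of the keys of the labels. -/
def key (p : (Fin n → A) × (Fin m → B)) : Fin r → ZMod (R + 1) :=
  ∑ v, P.keyV v (p.1 v) + ∑ e, P.keyE e (p.2 e)

/-- The row that gives the label `a` to the vertex `v`. -/
def vrow (v : Fin n) (a : A) : Row (Cell A M) n r R :=
  (fun w => if w = v then .val a 0 else 0, P.keyV v a)

/-- The row that gives the label `c.2.2` to the edge `e` and guesses the labels `c.1` and `c.2.1`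
of its ends. -/
def erow (e : Fin m) (c : A × A × B) : Row (Cell A M) n r R :=
  (fun w => if w = (P.ends e).1 then .val c.1 (P.con c.1 c.2.1 c.2.2).1
    else if w = (P.ends e).2 then .val c.2.1 (P.con c.1 c.2.1 c.2.2).2 else 0, P.keyE e c.2.2)

/-- The rows for the labels of the vertex `v`. -/
noncomputable def vtable (v : Fin n) : List (Row (Cell A M) n r R) :=
  (Finset.univ (α := A)).toList.map (P.vrow v)

/-- The rows for the admissible labels of the edge `e` and all the guesses at its ends. -/
noncomputable def etable (e : Fin m) : List (Row (Cell A M) n r R) :=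
  ((Finset.univ (α := A × A × B)).toList.filter fun c => P.okE e c.2.2).map (P.erow e)

/-- The factors of the product that counts the solutions: a table for every vertex and for every
edge. -/
noncomputable def tables : List (List (Row (Cell A M) n r R)) :=
  (List.finRange n).map P.vtable ++ (List.finRange m).map P.etable

/-- A vertex can be eliminated with a cell that holds a label and an admissible sum; the cell `bad`
of contradictory guesses is rejected. -/
def okCell (v : Fin n) : Cell A M → Bool
  | .val a m => P.okV v a m
  | _ => false

/-- The outcome of the elimination of the vertices in the order `ord`. -/
noncomputable def result (ord : List (Fin n)) : List (Row (Cell A M) n r R) :=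
  Table.prod (Table.elimAll P.okCell ord P.tables)

open AddMonoidAlgebra

theorem rep_vtable (v : Fin n) :
    Table.rep (P.vtable v) = ∑ a : A, single (P.vrow v a) 1 := by
  rw [Table.rep, vtable, List.map_map, ← Finset.sum_map_toList]
  rfl

theorem rep_etable (e : Fin m) :
    Table.rep (P.etable e) = ∑ c : A × A × B, if P.okE e c.2.2 then single (P.erow e c) 1 else 0 :=
        by
  rw [Table.rep, etable, List.map_map, ← Finset.sum_map_toList]
  generalize (Finset.univ (α := A × A × B)).toList = l
  induction l with
  | nil => rfl
  | cons c l ih =>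
    rw [List.filter_cons]
    split <;> simp_all

/-- The choices of labels by all the tables, where the ends of the edges are guessed. -/
abbrev Choice (A B : Type) (n m : ℕ) : Type := (Fin n → A) × (Fin m → A × A × B)

/-- The row of the product of all the tables that comes from a choice in every table. -/
def choiceRow (c : Choice A B n m) : Row (Cell A M) n r R :=
  ∑ v, P.vrow v (c.1 v) + ∑ e, P.erow e (c.2 e)

theorem prod_rep_tables : (P.tables.map Table.rep).prod =
    ∑ c : Choice A B n m, if ∀ e, P.okE e (c.2 e).2.2 = true then single (P.choiceRow c) 1 else 0 :=
        by
  classical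
  rw [tables, List.map_append, List.prod_append, List.map_map, List.map_map, ← Fin.prod_univ_def,
    ← Fin.prod_univ_def]
  simp only [Function.comp_apply, rep_vtable, rep_etable]
  rw [Finset.prod_univ_sum, Finset.prod_univ_sum, Fintype.piFinset_univ, Fintype.piFinset_univ,
    Finset.sum_mul_sum, ← Finset.univ_product_univ, Finset.sum_product]
  refine Finset.sum_congr rfl fun σ _ => Finset.sum_congr rfl fun ρ _ => ?_
  rw [Finset.prod_ite_zero, prod_single, prod_single]
  simp only [Finset.mem_univ, true_implies, Finset.prod_const_one]
  split
  · rw [single_mul_single, one_mul]; rfl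
  · rw [mul_zero]

theorem choiceRow_fst (c : Choice A B n m) (v : Fin n) :
    (P.choiceRow c).1 v = .val (c.1 v) 0 + ∑ e, (P.erow e (c.2 e)).1 v := by
  rw [choiceRow, Prod.fst_add, Pi.add_apply, Prod.fst_sum, Prod.fst_sum, Finset.sum_apply,
    Finset.sum_apply]
  congr 1
  simp [vrow]

theorem choiceRow_snd (c : Choice A B n m) :
    (P.choiceRow c).2 = P.key (c.1, fun e => (c.2 e).2.2) := by
  rw [choiceRow, Prod.snd_add, Prod.snd_sum, Prod.snd_sum]
  rfl

/-- A choice passes all the tests if and only if its guesses are right and it is a solution. -/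
theorem okCell_choiceRow (hloop : ∀ e, (P.ends e).1 ≠ (P.ends e).2) (c : Choice A B n m) :
    ((∀ e, P.okE e (c.2 e).2.2 = true) ∧ ∀ v, P.okCell v ((P.choiceRow c).1 v) = true) ↔
      P.IsSol (c.1, fun e => (c.2 e).2.2) ∧
        ∀ e, c.2 e = (c.1 (P.ends e).1, c.1 (P.ends e).2, (c.2 e).2.2) := by
  classical
  have hcell : ∀ v, (P.choiceRow c).1 v =
      if ∀ e, (v = (P.ends e).1 ∨ v = (P.ends e).2) →
        (if v = (P.ends e).1 then (c.2 e).1 else (c.2 e).2.1) = c.1 v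
      then .val (c.1 v) (∑ e, if v = (P.ends e).1 ∨ v = (P.ends e).2 then
        if v = (P.ends e).1 then (P.con (c.2 e).1 (c.2 e).2.1 (c.2 e).2.2).1
          else (P.con (c.2 e).1 (c.2 e).2.1 (c.2 e).2.2).2 else 0)
      else .bad := by
    intro v
    rw [choiceRow_fst]
    have := Cell.val_add_sum (M := M) Finset.univ (c.1 v)
      (fun e => if v = (P.ends e).1 then (c.2 e).1 else (c.2 e).2.1) 0
      (fun e => if v = (P.ends e).1 then (P.con (c.2 e).1 (c.2 e).2.1 (c.2 e).2.2).1
          else (P.con (c.2 e).1 (c.2 e).2.1 (c.2 e).2.2).2)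
      (fun e => v = (P.ends e).1 ∨ v = (P.ends e).2)
    simp only [Finset.mem_univ, true_implies, zero_add] at this
    refine Eq.trans ?_ (this.trans (by congr!))
    congr 1
    refine Finset.sum_congr rfl fun e _ => ?_
    unfold erow
    dsimp only
    by_cases h1 : v = (P.ends e).1
    · rw [if_pos h1, if_pos (Or.inl h1), if_pos h1, if_pos h1]
    · by_cases h2 : v = (P.ends e).2
      · rw [if_neg h1, if_pos h2, if_pos (Or.inr h2), if_neg h1, if_neg h1]
      · rw [if_neg h1, if_neg h2, if_neg (by tauto)]
  have hguess : (∀ v e, (v = (P.ends e).1 ∨ v = (P.ends e).2) →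
        (if v = (P.ends e).1 then (c.2 e).1 else (c.2 e).2.1) = c.1 v) ↔
      ∀ e, c.2 e = (c.1 (P.ends e).1, c.1 (P.ends e).2, (c.2 e).2.2) := by
    constructor
    · intro h e
      have h1 := h _ e (Or.inl rfl)
      have h2 := h _ e (Or.inr rfl)
      rw [if_pos rfl] at h1
      rw [if_neg (hloop e).symm] at h2
      rw [← h1, ← h2]
    · rintro h v e (rfl | rfl)
      · rw [if_pos rfl, h e]
      · rw [if_neg (hloop e).symm, h e]
  have hsum : (∀ e, c.2 e = (c.1 (P.ends e).1, c.1 (P.ends e).2, (c.2 e).2.2)) → ∀ v,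
      (∑ e, if v = (P.ends e).1 ∨ v = (P.ends e).2 then
        if v = (P.ends e).1 then (P.con (c.2 e).1 (c.2 e).2.1 (c.2 e).2.2).1
          else (P.con (c.2 e).1 (c.2 e).2.1 (c.2 e).2.2).2 else 0) =
        ∑ e, P.inc c.1 (fun e => (c.2 e).2.2) v e := by
    intro h v
    refine Finset.sum_congr rfl fun e _ => ?_
    have h1 : (c.2 e).1 = c.1 (P.ends e).1 := by rw [h e]
    have h2 : (c.2 e).2.1 = c.1 (P.ends e).2 := by rw [h e]
    rw [inc, h1, h2]
    split_ifs <;> tauto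
  constructor
  · rintro ⟨hE, hV⟩
    have hg : ∀ v e, (v = (P.ends e).1 ∨ v = (P.ends e).2) →
        (if v = (P.ends e).1 then (c.2 e).1 else (c.2 e).2.1) = c.1 v := by
      intro v
      have := hV v
      rw [hcell] at this
      by_contra hc
      rw [if_neg hc] at this
      simp [okCell] at this
    refine ⟨⟨hE, fun v => ?_⟩, hguess.1 hg⟩
    have := hV v
    rw [hcell, if_pos (hg v), hsum (hguess.1 hg)] at this
    exact this
  · rintro ⟨⟨hE, hV⟩, hg⟩
    refine ⟨hE, fun v => ?_⟩
    rw [hcell, if_pos (hguess.2 hg v), hsum hg]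
    exact hV v

open Classical in
/-- Variable elimination counts the solutions with every given key, modulo two. -/
theorem mem_result_iff (hloop : ∀ e, (P.ends e).1 ≠ (P.ends e).2) {ord : List (Fin n)}
    (hord : ord.Nodup) (hord' : ∀ v, v ∈ ord) (x : Row (Cell A M) n r R) :
    x ∈ P.result ord ↔ x.1 = 0 ∧ Odd (Finset.univ.filter fun p => P.IsSol p ∧ P.key p = x.2).card :=
        by
  have hcoeff := Table.coeff_rep
    (Table.nodup_rep_prod (Table.elimAll P.okCell ord P.tables)).1 x
  rw [Table.rep_prod_elimAll, prod_rep_tables, Table.foldl_elimHom_sum] at hcoeff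
  have hterm : ∀ c : Choice A B n m, ord.foldl (fun p v => Table.elimHom (P.okCell v) v p)
      (if ∀ e, P.okE e (c.2 e).2.2 = true then single (P.choiceRow c) 1 else 0) =
      if P.IsSol (c.1, fun e => (c.2 e).2.2) ∧
        ∀ e, c.2 e = (c.1 (P.ends e).1, c.1 (P.ends e).2, (c.2 e).2.2) then
        single ((0, P.key (c.1, fun e => (c.2 e).2.2)) : Row (Cell A M) n r R) 1 else 0 := by
    intro c
    rw [← if_congr (P.okCell_choiceRow hloop c) rfl rfl]
    by_cases h : ∀ e, P.okE e (c.2 e).2.2 = true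
    · rw [if_pos h, Table.foldl_elimHom_single _ hord, choiceRow_snd]
      simp only [hord', true_implies, if_true, h, true_and, implies_true]
      rfl
    · rw [if_neg h, if_neg fun h' => h h'.1]
      have := Table.foldl_elimHom_sum (r := r) (R := R) P.okCell ord (∅ : Finset Unit) fun _ => 0
      simpa using this
  simp only [hterm] at hcoeff
  rw [coeff_sum, Finsupp.finsetSum_apply] at hcoeff
  have hterm' : ∀ c : Choice A B n m, (if P.IsSol (c.1, fun e => (c.2 e).2.2) ∧
        ∀ e, c.2 e = (c.1 (P.ends e).1, c.1 (P.ends e).2, (c.2 e).2.2) then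
        single ((0, P.key (c.1, fun e => (c.2 e).2.2)) : Row (Cell A M) n r R) (1 : ZMod 2)
        else 0).coeff x =
      if (P.IsSol (c.1, fun e => (c.2 e).2.2) ∧
        ∀ e, c.2 e = (c.1 (P.ends e).1, c.1 (P.ends e).2, (c.2 e).2.2)) ∧
        x.1 = 0 ∧ P.key (c.1, fun e => (c.2 e).2.2) = x.2 then 1 else 0 := by
    intro c
    by_cases hs : P.IsSol (c.1, fun e => (c.2 e).2.2) ∧
        ∀ e, c.2 e = (c.1 (P.ends e).1, c.1 (P.ends e).2, (c.2 e).2.2)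
    · rw [if_pos hs, coeff_single, Finsupp.single_apply]
      refine if_congr ?_ rfl rfl
      rw [Prod.ext_iff, and_iff_right hs]
      exact and_congr_left' eq_comm
    · rw [if_neg hs, if_neg fun h => hs h.1]
      rfl
  simp only [hterm'] at hcoeff
  rw [Finset.sum_boole] at hcoeff
  have hmem : x ∈ P.result ord ↔ Odd (Finset.univ.filter fun c : Choice A B n m =>
      (P.IsSol (c.1, fun e => (c.2 e).2.2) ∧
        ∀ e, c.2 e = (c.1 (P.ends e).1, c.1 (P.ends e).2, (c.2 e).2.2)) ∧
        x.1 = 0 ∧ P.key (c.1, fun e => (c.2 e).2.2) = x.2).card := by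
    rw [← ZMod.natCast_ne_zero_iff_odd, hcoeff]
    unfold result
    by_cases h : x ∈ Table.prod (Table.elimAll P.okCell ord P.tables)
    · rw [if_pos h]
      exact iff_of_true h one_ne_zero
    · rw [if_neg h]
      exact iff_of_false h fun h => h rfl
  rw [hmem]
  by_cases hx : x.1 = 0
  · simp only [hx, true_and]
    refine iff_of_eq (congrArg Odd (Finset.card_bij (fun c _ => (c.1, fun e => (c.2 e).2.2))
      ?_ ?_ ?_))
    · intro c hc
      simp only [Finset.mem_filter, Finset.mem_univ, true_and] at hc ⊢
      exact ⟨hc.1.1, hc.2⟩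
    · intro c hc c' hc' e
      simp only [Finset.mem_filter, Finset.mem_univ, true_and, Prod.mk.injEq] at hc hc' e
      refine Prod.ext e.1 (funext fun i => ?_)
      rw [hc.1.2 i, hc'.1.2 i, e.1, congrFun e.2 i]
    · intro p hp
      simp only [Finset.mem_filter, Finset.mem_univ, true_and] at hp
      exact ⟨(p.1, fun e => (p.1 (P.ends e).1, p.1 (P.ends e).2, p.2 e)), by simpa using hp, rfl⟩
  · simp [hx]

end LocalProblem

/-! ### Sizes of the tables -/

namespace Table

variable {E : Type} [AddCommMonoid E] [DecidableEq E] {n r R : ℕ}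

theorem mem_toggle {X : Type} [DecidableEq X] {x y : X} {t : List X} (h : y ∈ toggle x t) :
    y = x ∨ y ∈ t := by
  unfold toggle at h
  split at h
  · exact Or.inr (List.mem_of_mem_filter h)
  · exact List.mem_cons.1 h

/-- A row of a product is the sum of rows of the factors; cancellation can only remove rows. -/
theorem mem_mul {X : Type} [DecidableEq X] [Add X] {t u : List X} {z : X} (h : z ∈ mul t u) :
    ∃ x ∈ t, ∃ y ∈ u, z = x + y := by
  unfold mul at h
  have h1 : ∀ (P : X → Prop) (x : X) (u acc : List X), (∀ y ∈ u, P (x + y)) → (∀ z ∈ acc, P z) →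
      ∀ z ∈ u.foldl (fun acc y => toggle (x + y) acc) acc, P z := by
    intro P x u
    induction u with
    | nil => intro acc _ h; simpa using h
    | cons y u ih =>
      intro acc hu hacc
      refine ih _ (fun y hy => hu y (List.mem_cons_of_mem _ hy)) fun z hz => ?_
      rcases mem_toggle hz with rfl | hz
      exacts [hu y List.mem_cons_self, hacc z hz]
  have h2 : ∀ (P : X → Prop) (t acc : List X), (∀ x ∈ t, ∀ y ∈ u, P (x + y)) → (∀ z ∈ acc, P z) →
      ∀ z ∈ t.foldl (fun acc x => u.foldl (fun acc y => toggle (x + y) acc) acc) acc, P z := by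
    intro P t
    induction t with
    | nil => intro acc _ h; simpa using h
    | cons x t ih =>
      intro acc ht hacc
      exact ih _ (fun x hx => ht x (List.mem_cons_of_mem _ hx))
        (h1 P x u acc (ht x List.mem_cons_self) hacc)
  exact h2 (fun z => ∃ x ∈ t, ∃ y ∈ u, z = x + y) t []
    (fun x hx y hy => ⟨x, hx, y, hy, rfl⟩) (by simp) z h

/-- The rows of `t` have no entries outside of `U`. -/
def SuppIn (U : Finset (Fin n)) (t : List (Row E n r R)) : Prop :=
  ∀ x ∈ t, ∀ u, x.1 u ≠ 0 → u ∈ U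

theorem SuppIn.mul {U : Finset (Fin n)} {t u : List (Row E n r R)} (ht : SuppIn U t)
    (hu : SuppIn U u) : SuppIn U (mul t u) := by
  intro z hz w hw
  obtain ⟨x, hx, y, hy, rfl⟩ := mem_mul hz
  by_contra hU
  have h1 : x.1 w = 0 := not_not.1 fun h => hU (ht x hx w h)
  have h2 : y.1 w = 0 := not_not.1 fun h => hU (hu y hy w h)
  exact hw (by rw [Prod.fst_add, Pi.add_apply, h1, h2, add_zero])

theorem SuppIn.prod {U : Finset (Fin n)} {F : List (List (Row E n r R))}
    (h : ∀ t ∈ F, SuppIn U t) : SuppIn U (prod F) := by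
  have : ∀ t, SuppIn U t → SuppIn U (F.foldl Table.mul t) := by
    induction F with
    | nil => intro t ht; exact ht
    | cons u F ih =>
      intro t ht
      exact ih (fun t ht => h t (List.mem_cons_of_mem _ ht)) _ (ht.mul (h u List.mem_cons_self))
  refine this [0] ?_
  intro x hx u hu
  rw [List.mem_singleton.1 hx] at hu
  exact absurd rfl hu

theorem SuppIn.elim {U : Finset (Fin n)} {ok : E → Bool} {v : Fin n} {t : List (Row E n r R)}
    (ht : SuppIn U t) : SuppIn (U.erase v) (elim ok v t) := by
  have : ∀ acc : List (Row E n r R), SuppIn (U.erase v) acc → SuppIn (U.erase v)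
      (t.foldl (fun acc x => if ok (x.1 v) then toggle (Function.update x.1 v 0, x.2) acc else acc)
        acc) := by
    induction t with
    | nil => intro acc h; exact h
    | cons x t ih =>
      intro acc h
      refine ih (fun y hy => ht y (List.mem_cons_of_mem _ hy)) _ ?_
      dsimp only
      split
      · intro y hy u hu
        rcases mem_toggle hy with rfl | hy
        · by_cases huv : u = v
          · subst huv; simp at hu
          · exact Finset.mem_erase.2 ⟨huv, ht x List.mem_cons_self u (by simpa [huv] using hu)⟩
        · exact h y hy u hu
      · exact h
  exact this [] (by intro x hx; simp at hx)

/-- A table without repetitions that lives on `U` has at most one row for every assignment of cells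
to `U` and every key. -/
theorem SuppIn.length_le [Fintype E] {U : Finset (Fin n)} {t : List (Row E n r R)}
    (h : SuppIn U t) (hnd : t.Nodup) :
    t.length ≤ Fintype.card E ^ U.card * (R + 1) ^ r := by
  classical
  rw [← List.toFinset_card_of_nodup hnd]
  have hinj : Set.InjOn (fun x : Row E n r R => ((fun u : U => x.1 u, x.2) :
      (U → E) × (Fin r → ZMod (R + 1)))) t.toFinset := by
    intro x hx y hy e
    have hx := h x (List.mem_toFinset.1 hx)
    have hy := h y (List.mem_toFinset.1 hy)
    simp only [Prod.mk.injEq] at e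
    refine Prod.ext (funext fun u => ?_) e.2
    by_cases hu : u ∈ U
    · exact congrFun e.1 ⟨u, hu⟩
    · rw [not_not.1 fun h => hu (hx u h), not_not.1 fun h => hu (hy u h)]
  calc t.toFinset.card = (t.toFinset.image _).card := (Finset.card_image_of_injOn hinj).symm
    _ ≤ Fintype.card ((U → E) × (Fin r → ZMod (R + 1))) := Finset.card_le_univ _
    _ = _ := by simp [Fintype.card_prod, ZMod.card]

/-- If all the neighbours of `v` that are not yet eliminated are together with `v` in the bag of
`x`, then the product of the tables that involve `v` lives on this bag. -/
theorem SuppIn.prod_involves {N : ℕ} {bag : Fin N → Finset (Fin n)}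
    {F : List (List (Row E n r R))} {pre : List (Fin n)} {v : Fin n} {x : Fin N}
    (hF : ∀ t ∈ F, ∃ x, SuppIn (bag x \ pre.toFinset) t)
    (hx : ∀ y, v ∈ bag y → ∀ u ∈ bag y, u ∉ pre → u ∈ bag x)
    {G : List (List (Row E n r R))} (hG : G <+: F.filter (involves v)) :
    SuppIn (bag x \ pre.toFinset) (Table.prod G) := by
  refine SuppIn.prod fun t htG => ?_
  obtain ⟨htF, hinv⟩ := List.mem_filter.1 (hG.subset htG)
  obtain ⟨y, hy⟩ := hF t htF
  simp only [involves, List.any_eq_true] at hinv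
  obtain ⟨g, hg, hgv⟩ := hinv
  have hvy := (Finset.mem_sdiff.1 (hy g hg v (by simpa using hgv))).1
  intro g hg u hu
  have := Finset.mem_sdiff.1 (hy g hg u hu)
  exact Finset.mem_sdiff.2 ⟨hx y hvy u this.1 (by simpa using this.2), this.2⟩

/-- If every eliminated vertex is contained together with its neighbours at that time in a bag,
then all the tables that come up are small. -/
theorem length_elimAll_le [Fintype E] {N L : ℕ} {bag : Fin N → Finset (Fin n)}
    (ok : Fin n → E → Bool) {F : List (List (Row E n r R))} {ord : List (Fin n)}
    (hL : ∀ x, Fintype.card E ^ (bag x).card * (R + 1) ^ r ≤ L)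
    (hF : ∀ t ∈ F, t.length ≤ L ∧ ∃ x, SuppIn (bag x) t)
    (hord : ∀ pre v, pre ++ [v] <+: ord → ∃ x, ∀ y, v ∈ bag y → ∀ u ∈ bag y, u ∉ pre → u ∈ bag x)
    (pre : List (Fin n)) (hpre : pre <+: ord) :
    (∀ t ∈ elimAll ok pre F, t.length ≤ L ∧ ∃ x, SuppIn (bag x \ pre.toFinset) t) ∧
      ∀ v, pre ++ [v] <+: ord → ∀ G, G <+: (elimAll ok pre F).filter (involves v) →
        (prod G).length ≤ L := by
  have hle : ∀ {x} {pre : List (Fin n)} {t : List (Row E n r R)}, t.Nodup →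
      SuppIn (bag x \ pre.toFinset) t → t.length ≤ L := fun hnd hs =>
    (hs.length_le hnd).trans ((Nat.mul_le_mul_right _ (Nat.pow_le_pow_right
      (Fintype.card_pos_iff.2 ⟨0⟩) (Finset.card_le_card Finset.sdiff_subset))).trans (hL _))
  have hall : ∀ t ∈ elimAll ok pre F, t.length ≤ L ∧ ∃ x, SuppIn (bag x \ pre.toFinset) t := by
    induction pre using List.reverseRecOn with
    | nil => simpa [elimAll] using hF
    | append_singleton pre v ih =>
      have ih := ih ((List.prefix_append _ _).trans hpre)
      obtain ⟨x, hx⟩ := hord pre v hpre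
      have herase : ∀ y, bag y \ (pre ++ [v]).toFinset = (bag y \ pre.toFinset).erase v := by
        intro y; ext u; simp only [Finset.mem_sdiff, Finset.mem_erase, List.mem_toFinset,
          List.mem_append, List.mem_singleton]; tauto
      intro t ht
      rw [elimAll, List.foldl_append] at ht
      rcases List.mem_cons.1 ht with rfl | ht
      · have hs : SuppIn (bag x \ (pre ++ [v]).toFinset) (elim (ok v) v
            (prod ((elimAll ok pre F).filter (involves v)))) := by
          rw [herase]
          exact (SuppIn.prod_involves (fun t ht => (ih t ht).2) hx (List.prefix_refl _)).elim
        exact ⟨hle (nodup_rep_elim _ _ _).1 hs, x, hs⟩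
      · obtain ⟨ht, hv⟩ := List.mem_filter.1 ht
        obtain ⟨hlen, y, hy⟩ := ih t ht
        refine ⟨hlen, y, fun g hg u hu => ?_⟩
        rw [herase]
        refine Finset.mem_erase.2 ⟨?_, hy g hg u hu⟩
        rintro rfl
        simp only [involves, List.any_eq, Bool.not_eq_true', decide_eq_false_iff_not] at hv
        exact hv ⟨g, hg, by simpa using hu⟩
  refine ⟨hall, fun v hv G hG => ?_⟩
  obtain ⟨x, hx⟩ := hord pre v hv
  exact hle (nodup_rep_prod G).1 (SuppIn.prod_involves (fun t ht => (hall t ht).2) hx hG)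

end Table

/-! ### Elimination orders from tree decompositions -/

section Order

variable {n N : ℕ}

/-- All the vertices that share a bag with `v` and are not yet eliminated lie in a common bag. -/
def Simplicial (bag : Fin N → Finset (Fin n)) (done : List (Fin n)) (v : Fin n) : Prop :=
  v ∉ done ∧ ∃ x, ∀ y, v ∈ bag y → ∀ u, u ∈ bag y → u ∉ done → u ∈ bag x

open Classical in
/-- The vertices in the reverse of an order of elimination: at every step the first simplicial
vertex is eliminated. -/
noncomputable def elimOrderAux (bag : Fin N → Finset (Fin n)) (l : List (Fin n)) : List (Fin n) :=
  l.foldl (fun done i =>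
    ((List.finRange n).filter fun v => decide (Simplicial bag done v)).headD i :: done) []

/-- An order of elimination in which every vertex is simplicial when it is eliminated, provided that
simplicial vertices exist. -/
noncomputable def elimOrder (bag : Fin N → Finset (Fin n)) : List (Fin n) :=
  (elimOrderAux bag (List.finRange n)).reverse

/-- If there is always a simplicial vertex, then the greedy choice never falls back on the default
value of `headD`. -/
theorem elimOrderAux_spec {bag : Fin N → Finset (Fin n)}
    (h : ∀ done : List (Fin n), (∃ v, v ∉ done) → ∃ v, Simplicial bag done v) (l : List (Fin n))
    (hl : l.length ≤ n) :
    (elimOrderAux bag l).length = l.length ∧ (elimOrderAux bag l).Nodup ∧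
      ∀ pre v post, elimOrderAux bag l = post ++ v :: pre → Simplicial bag pre v := by
  classical
  induction l using List.reverseRecOn with
  | nil => simp [elimOrderAux]
  | append_singleton l i ih =>
    rw [List.length_append, List.length_singleton] at hl
    obtain ⟨h1, h2, h3⟩ := ih (by omega)
    have hex : ∃ v, v ∉ elimOrderAux bag l := by
      by_contra hc
      push Not at hc
      have := List.Nodup.length_le_card h2
      have h4 : Fintype.card (Fin n) ≤ (elimOrderAux bag l).length := by
        rw [← List.toFinset_card_of_nodup h2, ← Finset.card_univ]
        exact Finset.card_le_card fun v _ => List.mem_toFinset.2 (hc v)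
      rw [Fintype.card_fin] at h4
      omega
    have hstep : elimOrderAux bag (l ++ [i]) = ((List.finRange n).filter fun v =>
        decide (Simplicial bag (elimOrderAux bag l) v)).headD i :: elimOrderAux bag l := by
      rw [elimOrderAux, List.foldl_append]; rfl
    obtain ⟨v, hv⟩ := h _ hex
    have hsimp : Simplicial bag (elimOrderAux bag l) (((List.finRange n).filter fun v =>
        decide (Simplicial bag (elimOrderAux bag l) v)).headD i) := by
      cases hf : (List.finRange n).filter fun v =>
          decide (Simplicial bag (elimOrderAux bag l) v) with
      | nil =>
        have := List.filter_eq_nil_iff.1 hf v (List.mem_finRange v)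
        simp [hv] at this
      | cons w t =>
        have : w ∈ (List.finRange n).filter fun v =>
          decide (Simplicial bag (elimOrderAux bag l) v) := by rw [hf]; simp
        simpa using (List.mem_filter.1 this).2
    rw [hstep]
    refine ⟨by simp [h1], List.nodup_cons.2 ⟨hsimp.1, h2⟩, ?_⟩
    rintro pre w (_ | ⟨w', post⟩) e
    · rw [List.nil_append, List.cons.injEq] at e
      rw [← e.1, ← e.2]; exact hsimp
    · rw [List.cons_append, List.cons.injEq] at e
      exact h3 pre w post e.2

theorem elimOrder_spec {bag : Fin N → Finset (Fin n)}
    (h : ∀ done : List (Fin n), (∃ v, v ∉ done) → ∃ v, Simplicial bag done v) :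
    (elimOrder bag).Nodup ∧ (∀ v, v ∈ elimOrder bag) ∧
      ∀ pre v, pre ++ [v] <+: elimOrder bag →
        ∃ x, ∀ y, v ∈ bag y → ∀ u ∈ bag y, u ∉ pre → u ∈ bag x := by
  obtain ⟨h1, h2, h3⟩ := elimOrderAux_spec h (List.finRange n) (by simp)
  refine ⟨List.nodup_reverse.2 h2, fun v => List.mem_reverse.2 ?_, ?_⟩
  · have : (elimOrderAux bag (List.finRange n)).toFinset = Finset.univ := by
      rw [← Finset.card_eq_iff_eq_univ, List.toFinset_card_of_nodup h2, h1]; simp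
    exact List.mem_toFinset.1 (this ▸ Finset.mem_univ v)
  · rintro pre v ⟨post, e⟩
    have e' := congrArg List.reverse e
    rw [elimOrder, List.reverse_reverse] at e'
    obtain ⟨x, hx⟩ := (h3 pre.reverse v post.reverse (by rw [← e']; simp)).2
    exact ⟨x, fun y hy u hu hu' => hx y hy u hu (by simpa using hu')⟩

end Order

/-- The node of the bags of `v` that is the closest one to the root `r` lies on the shortest walk
from any bag of `v` to the root. -/
theorem SimpleGraph.IsTree.exists_top {V : Type} {H : SimpleGraph V} (hH : H.IsTree) [Finite V]
    (r : V) {B : Set V} (hB : B.Nonempty)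
    (hconn : ∀ x y z, ∀ p : H.Walk x y, p.IsPath → z ∈ p.support → x ∈ B → y ∈ B → z ∈ B) :
    ∃ z ∈ B, ∀ y ∈ B, ∀ p : H.Walk y r, p.IsPath → z ∈ p.support := by
  classical
  obtain ⟨z, hz, hmin⟩ := Set.exists_min_image B (fun z => H.dist z r) B.toFinite hB
  refine ⟨z, hz, fun y hy p hp => ?_⟩
  obtain ⟨p₁, hp₁⟩ := hH.1.exists_isPath y z
  obtain ⟨p₂, hp₂⟩ := hH.1.exists_walk_length_eq_dist z r
  have hp₂' := p₂.isPath_of_length_eq_dist hp₂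
  have hout : ∀ w ∈ p₂.support.tail, w ∉ B := by
    intro w hw hwB
    have hw' : w ∈ p₂.support := List.mem_of_mem_tail hw
    have hwz : w ≠ z := by
      rintro rfl
      have := hp₂'.support_nodup
      rw [← SimpleGraph.Walk.cons_tail_support] at this
      exact (List.nodup_cons.1 this).1 hw
    have h1 := hmin w hwB
    have h2 := SimpleGraph.dist_le (p₂.dropUntil w hw')
    have h3 := congrArg SimpleGraph.Walk.length (p₂.take_spec hw')
    rw [SimpleGraph.Walk.length_append] at h3
    have h4 : (p₂.takeUntil w hw').length ≠ 0 := fun h =>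
      hwz (SimpleGraph.Walk.eq_of_length_eq_zero h).symm
    omega
  have hpath : (p₁.append p₂).IsPath := by
    rw [SimpleGraph.Walk.isPath_def, SimpleGraph.Walk.support_append, List.nodup_append]
    refine ⟨hp₁.support_nodup, hp₂'.support_nodup.tail, ?_⟩
    rintro a ha b hb rfl
    exact hout a hb (hconn y z a p₁ hp₁ ha hy hz)
  have := (hH.isAcyclic.subsingleton_path _ _).elim (⟨p, hp⟩ : H.Path y r) ⟨_, hpath⟩
  rw [Subtype.mk.injEq] at this
  rw [this, SimpleGraph.Walk.mem_support_append_iff]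
  exact Or.inl p₁.end_mem_support

/-- As long as vertices are left, a vertex is simplicial whose topmost bag is the farthest from the
root. -/
theorem TreeDecomp.exists_simplicial {dir : Bool} {G : FinGraph dir} (T : TreeDecomp G)
    (done : List (Fin G.n)) (h : ∃ v, v ∉ done) : ∃ v, Simplicial T.bag done v := by
  classical
  obtain ⟨r⟩ := T.isTree.1.nonempty
  have htop : ∀ v, ∃ z, v ∈ T.bag z ∧
      ∀ y, v ∈ T.bag y → ∀ p : T.tree.toSimpleGraph.Walk y r, p.IsPath → z ∈ p.support := fun v =>
    T.isTree.exists_top r (B := {z | v ∈ T.bag z}) (T.vertex_cover v)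
      fun x y z p hp hz hx hy => T.path_closed v x y z p hp hz hx hy
  choose top htop1 htop2 using htop
  obtain ⟨v₀, hv₀⟩ := h
  obtain ⟨v, hv, hmax⟩ := (Finset.univ.filter fun v => v ∉ done).exists_max_image
    (fun v => T.tree.toSimpleGraph.dist (top v) r) ⟨v₀, by simpa using hv₀⟩
  simp only [Finset.mem_filter, Finset.mem_univ, true_and] at hv hmax
  refine ⟨v, hv, top v, fun y hvy u huy hu => ?_⟩
  obtain ⟨p, hp⟩ := T.isTree.1.exists_walk_length_eq_dist y r
  have hp' := p.isPath_of_length_eq_dist hp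
  have hv' := htop2 v y hvy p hp'
  have hu' := htop2 u y huy p hp'
  have hspec := p.take_spec hu'
  have hmem : top v ∈ (p.takeUntil _ hu').support ∨ top v ∈ (p.dropUntil _ hu').support := by
    rw [← SimpleGraph.Walk.mem_support_append_iff, hspec]; exact hv'
  by_cases huv : top u = top v
  · exact huv ▸ htop1 u
  rcases hmem with hmem | hmem
  · exact T.path_closed u y (top u) (top v) _ (hp'.takeUntil hu') hmem huy (htop1 u)
  · exfalso
    have h1 := hmax u hu
    have h2 := SimpleGraph.dist_le ((p.dropUntil _ hu').dropUntil _ hmem)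
    have h3 := congrArg SimpleGraph.Walk.length ((p.dropUntil _ hu').take_spec hmem)
    have h4 := congrArg SimpleGraph.Walk.length hspec
    rw [SimpleGraph.Walk.length_append] at h3 h4
    have h5 : ((p.dropUntil _ hu').takeUntil _ hmem).length ≠ 0 := fun h =>
      huv (SimpleGraph.Walk.eq_of_length_eq_zero h)
    have h6 : T.tree.toSimpleGraph.dist y r ≤ (p.takeUntil _ hu').length + T.tree.toSimpleGraph.dist
        (top u) r := by
      obtain ⟨q, hq⟩ := T.isTree.1.exists_walk_length_eq_dist (top u) r
      have := SimpleGraph.dist_le ((p.takeUntil _ hu').append q)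
      rw [SimpleGraph.Walk.length_append] at this
      omega
    omega

/-! ### Modal formulas as local conditions -/

/-- A finitely recognizable set is recognized by a commutative monoid: the image of `ℕ` in the given
monoid is generated by one element. It is replaced by the quotient of `ℕ` by the kernel. -/
theorem FinitelyRecognizable.exists_addCommMonoid {S : Set ℕ} (hS : FinitelyRecognizable S) :
    ∃ (M : Type) (_ : AddCommMonoid M) (_ : Finite M) (F : Set M) (α : ℕ →+ M), S = α ⁻¹' F := by
  obtain ⟨M, _, _, F, α, rfl⟩ := hS
  have hfin : Finite (AddCon.ker α).Quotient :=
    Finite.of_injective _ (AddCon.kerLift_injective α)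
  refine ⟨(AddCon.ker α).Quotient, inferInstance, hfin, AddCon.kerLift α ⁻¹' F,
    (AddCon.ker α).mk', ?_⟩
  ext n
  rfl

/-- The positive numbers are recognized by the multiplicative monoid of `ZMod 2`, with `1` mapped to
its zero. -/
theorem finitelyRecognizable_one_le : FinitelyRecognizable {n | 1 ≤ n} := by
  refine ⟨Additive (ZMod 2), inferInstance, inferInstance, {Additive.ofMul 0},
    multiplesHom _ (Additive.ofMul 0), ?_⟩
  ext n
  have : multiplesHom _ (Additive.ofMul (0 : ZMod 2)) n = Additive.ofMul ((0 : ZMod 2) ^ n) := by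
    rw [multiplesHom_apply, ofMul_pow]
  rw [Set.mem_preimage, this]
  rcases Nat.eq_zero_or_pos n with rfl | hn
  · have : (Additive.ofMul ((0 : ZMod 2) ^ 0)) ≠ Additive.ofMul 0 := by decide
    simpa using this
  · simp [zero_pow hn.ne', Nat.succ_le_iff, hn]

namespace FinGraph

variable {dir : Bool} (G : FinGraph dir) {M : Type} [AddCommMonoid M]

/-- The sum of the values `f w e d` over the edges `e` by which a neighbour `w` of `v` is
accessed; `d` tells whether `e` is directed from `v` to `w`. -/
def nbSum (f : Fin G.n → Fin G.m → Bool → M) (v : Fin G.n) : M :=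
  ∑ e, if v = (G.ends e).1 then f (G.ends e).2 e true
    else if v = (G.ends e).2 then f (G.ends e).1 e false else 0

theorem nbSum_prod {M' : Type} [AddCommMonoid M'] (f : Fin G.n → Fin G.m → Bool → M)
    (g : Fin G.n → Fin G.m → Bool → M') (v : Fin G.n) :
    G.nbSum (fun w e d => (f w e d, g w e d)) v = (G.nbSum f v, G.nbSum g v) := by
  refine Prod.ext ?_ ?_
  · rw [nbSum, Prod.fst_sum]
    refine Finset.sum_congr rfl fun e _ => ?_
    split_ifs <;> rfl
  · rw [nbSum, Prod.snd_sum]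
    refine Finset.sum_congr rfl fun e _ => ?_
    split_ifs <;> rfl

open Classical in
/-- Because `α` is additive, `α` of a number of edges is the sum of `α 1` over these edges. -/
theorem nbSum_indicator (α : ℕ →+ M) (p : Fin G.n → Fin G.m → Bool → Prop) (v : Fin G.n) :
    G.nbSum (fun w e d => if p w e d then α 1 else 0) v =
      α (Set.ncard {e | ∃ w, G.Joins e v w ∧ p w e (decide ((G.ends e).2 = w))}) := by
  have : Set.ncard {e | ∃ w, G.Joins e v w ∧ p w e (decide ((G.ends e).2 = w))} =
      ∑ e, if ∃ w, G.Joins e v w ∧ p w e (decide ((G.ends e).2 = w)) then 1 else 0 := by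
    rw [Set.ncard_eq_toFinset_card', Finset.sum_boole]
    simp
  rw [this, map_sum, nbSum]
  refine Finset.sum_congr rfl fun e _ => ?_
  have hl := G.loopless e
  by_cases h1 : v = (G.ends e).1
  · rw [if_pos h1]
    have : (∃ w, G.Joins e v w ∧ p w e (decide ((G.ends e).2 = w))) ↔ p (G.ends e).2 e true := by
      constructor
      · rintro ⟨w, h | h, hp⟩
        · simpa [h] using hp
        · rw [h] at h1 hl; exact absurd h1.symm hl
      · exact fun h => ⟨(G.ends e).2, Or.inl (by rw [h1]), by simpa using h⟩
    simp only [this]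
    split <;> simp
  · rw [if_neg h1]
    by_cases h2 : v = (G.ends e).2
    · rw [if_pos h2]
      have : (∃ w, G.Joins e v w ∧ p w e (decide ((G.ends e).2 = w))) ↔ p (G.ends e).1 e false := by
        constructor
        · rintro ⟨w, h | h, hp⟩
          · rw [h] at h1; exact absurd rfl h1
          · rw [h] at h1
            simpa [h, Ne.symm h1, h1] using hp
        · exact fun h => ⟨(G.ends e).1, Or.inr (by rw [h2]), by simpa [hl.symm] using h⟩
      simp only [this]
      split <;> simp
    · rw [if_neg h2, if_neg, map_zero]
      rintro ⟨w, h | h, -⟩ <;> rw [h] at h1 h2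
      · exact h1 rfl
      · exact h2 rfl

end FinGraph

/-- The vertex sets that contain `v`, and the edge sets that contain `e`. -/
def memLabel {k : ℕ} {ι : Type} (X : ι → Finset (Fin k)) (v : Fin k) : ι → Bool :=
  fun i => decide (v ∈ X i)

/-- The property `P` of a vertex and of the edge by which it is accessed is locally definable: there
is a system of states, where a state is guessed for every vertex and the right guess is determined
by a condition `ok` on every vertex, its state and the sum of the contributions of its
neighbours, such that `P` can be read off the state. -/
def LocallyDefinable (dir : Bool) (ιX ιY : Type)
    (P : ∀ (G : FinGraph dir), (ιX → Finset (Fin G.n)) → (ιY → Finset (Fin G.m)) → Fin G.n →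
      Option (Fin G.m) → Prop) : Prop :=
  ∃ (Q : Type) (_ : Finite Q) (M : Type) (_ : AddCommMonoid M) (_ : Finite M)
    (con : (ιX → Bool) → Q → (ιY → Bool) → Bool → M) (ok : (ιX → Bool) → Q → M → Prop)
    (val : (ιX → Bool) → Q → Option ((ιY → Bool) × Bool) → Prop),
    ∀ (G : FinGraph dir) (X : ιX → Finset (Fin G.n)) (Y : ιY → Finset (Fin G.m)),
      ∃ q₀ : Fin G.n → Q,
        (∀ q : Fin G.n → Q, (∀ v, ok (memLabel X v) (q v) (G.nbSum (fun w e d =>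
          con (memLabel X w) (q w) (memLabel Y e) d) v)) ↔ q = q₀) ∧
        ∀ v a, (∀ e, a = some e → v = (G.ends e).1 ∨ v = (G.ends e).2) →
          (P G X Y v a ↔ val (memLabel X v) (q₀ v)
            (a.map fun e => (memLabel Y e, decide ((G.ends e).2 = v))))

namespace LocallyDefinable

variable {dir : Bool} {ιX ιY : Type}
  {P P' : ∀ (G : FinGraph dir), (ιX → Finset (Fin G.n)) → (ιY → Finset (Fin G.m)) → Fin G.n →
      Option (Fin G.m) → Prop}

theorem congr (h : LocallyDefinable dir ιX ιY P) (e : ∀ G X Y v a, P' G X Y v a ↔ P G X Y v a) :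
    LocallyDefinable dir ιX ιY P' := by
  obtain ⟨Q, _, M, _, _, con, ok, val, h⟩ := h
  refine ⟨Q, ‹_›, M, ‹_›, ‹_›, con, ok, val, fun G X Y => ?_⟩
  obtain ⟨q₀, h1, h2⟩ := h G X Y
  exact ⟨q₀, h1, fun v a ha => (e G X Y v a).trans (h2 v a ha)⟩

/-- Properties that depend only on the vertex and its access edge. -/
theorem base (val : (ιX → Bool) → Option ((ιY → Bool) × Bool) → Prop) :
    LocallyDefinable dir ιX ιY fun G X Y v a => val (memLabel X v)
      (a.map fun e => (memLabel Y e, decide ((G.ends e).2 = v))) :=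
  ⟨Unit, inferInstance, PUnit, inferInstance, inferInstance, fun _ _ _ _ => 0, fun _ _ _ => True,
    fun x _ a => val x a, fun G X Y => ⟨fun _ => (), fun q => by simp, fun v a _ => Iff.rfl⟩⟩

/-- Boolean combinations: the two systems of states run in parallel. -/
theorem binary (f : Prop → Prop → Prop) (h : LocallyDefinable dir ιX ιY P)
    (h' : LocallyDefinable dir ιX ιY P') :
    LocallyDefinable dir ιX ιY fun G X Y v a => f (P G X Y v a) (P' G X Y v a) := by
  obtain ⟨Q, _, M, _, _, con, ok, val, h⟩ := h
  obtain ⟨Q', _, M', _, _, con', ok', val', h'⟩ := h'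
  refine ⟨Q × Q', inferInstance, M × M', inferInstance, inferInstance,
    fun x q y d => (con x q.1 y d, con' x q.2 y d), fun x q m => ok x q.1 m.1 ∧ ok' x q.2 m.2,
    fun x q a => f (val x q.1 a) (val' x q.2 a), fun G X Y => ?_⟩
  obtain ⟨q₀, h1, h2⟩ := h G X Y
  obtain ⟨q₀', h1', h2'⟩ := h' G X Y
  refine ⟨fun v => (q₀ v, q₀' v), fun q => ?_, fun v a ha => ?_⟩
  · have h1 := h1 fun v => (q v).1
    have h1' := h1' fun v => (q v).2
    simp only [FinGraph.nbSum_prod, forall_and]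
    rw [h1, h1']
    simp only [funext_iff, Prod.ext_iff, forall_and]
  · dsimp only
    rw [h2 v a ha, h2' v a ha]

/-- A counting quantifier: whether it holds is guessed in a new bit of the state, and the guess is
checked against the image of the number of neighbours in a monoid that recognizes `S`. -/
theorem dia {S : Set ℕ} (hS : FinitelyRecognizable S) (h : LocallyDefinable dir ιX ιY P) :
    LocallyDefinable dir ιX ιY fun G X Y v _ =>
      Set.ncard {e : Fin G.m | ∃ w, G.Joins e v w ∧ P G X Y w (some e)} ∈ S := by
  classical
  obtain ⟨Q, _, M, _, _, con, ok, val, h⟩ := h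
  obtain ⟨M', _, _, F, α, rfl⟩ := hS.exists_addCommMonoid
  refine ⟨Q × Bool, inferInstance, M × M', inferInstance, inferInstance,
    fun x q y d => (con x q.1 y d, if val x q.1 (some (y, d)) then α 1 else 0),
    fun x q m => ok x q.1 m.1 ∧ (q.2 = true ↔ m.2 ∈ F), fun x q a => q.2 = true, fun G X Y => ?_⟩
  obtain ⟨q₀, h1, h2⟩ := h G X Y
  have hcount : ∀ v, G.nbSum (fun w e d =>
      if val (memLabel X w) (q₀ w) (some (memLabel Y e, d)) then α 1 else 0) v =
      α (Set.ncard {e : Fin G.m | ∃ w, G.Joins e v w ∧ P G X Y w (some e)}) := by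
    intro v
    rw [G.nbSum_indicator α fun w e d => val (memLabel X w) (q₀ w) (some (memLabel Y e, d))]
    congr 2
    ext e
    refine exists_congr fun w => and_congr_right fun hw => ?_
    refine (h2 w (some e) ?_).symm
    intro e' he
    obtain rfl := Option.some.inj he
    rcases hw with hw | hw <;> simp [hw]
  refine ⟨fun v => (q₀ v, decide (α (Set.ncard {e : Fin G.m |
    ∃ w, G.Joins e v w ∧ P G X Y w (some e)}) ∈ F)), fun q => ?_, fun v a _ => by simp⟩
  have h1 := h1 fun v => (q v).1
  simp only [FinGraph.nbSum_prod, forall_and]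
  rw [h1]
  constructor
  · rintro ⟨hq, hF⟩
    funext v
    have := hF v
    simp only [congrFun hq, hcount] at this
    refine Prod.ext (congrFun hq v) ?_
    rw [Bool.eq_iff_iff, this]
    simp
  · rintro rfl
    refine ⟨rfl, fun v => ?_⟩
    simp [hcount]

end LocallyDefinable

/-- Every modal formula is locally definable. -/
theorem CML.locallyDefinable {dir : Bool} {ιX ιY : Type} {b : Bool} (ψ : CML dir ιX ιY b) :
    LocallyDefinable dir ιX ιY fun G X Y v a => ψ.Sat G X Y v a := by
  induction ψ with
  | neg ψ ih => exact (ih.binary (fun p _ => ¬ p) ih).congr fun _ _ _ _ _ => by simp only [CML.Sat]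
  | and ψ χ ih ih' => exact (ih.binary And ih').congr fun _ _ _ _ _ => by simp only [CML.Sat]
  | or ψ χ ih ih' => exact (ih.binary Or ih').congr fun _ _ _ _ _ => by simp only [CML.Sat]
  | imp ψ χ ih ih' =>
    exact (ih.binary (fun p q => p → q) ih').congr fun _ _ _ _ _ => by simp only [CML.Sat]
  | iff ψ χ ih ih' => exact (ih.binary Iff ih').congr fun _ _ _ _ _ => by simp only [CML.Sat]
  | inX i =>
    exact (LocallyDefinable.base fun x _ => x i = true).congr fun _ _ _ _ _ => by
      simp [CML.Sat, memLabel]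
  | inY j =>
    exact (LocallyDefinable.base fun _ a => ∃ y, a = some y ∧ y.1 j = true).congr
      fun G X Y v a => by cases a <;> simp [CML.Sat, memLabel]
  | down h =>
    exact (LocallyDefinable.base fun _ a => ∃ y, a = some y ∧ y.2 = true).congr
      fun G X Y v a => by cases a <;> simp [CML.Sat]
  | up h =>
    refine ⟨Unit, inferInstance, PUnit, inferInstance, inferInstance, fun _ _ _ _ => 0,
      fun _ _ _ => True, fun _ _ a => ∃ y, a = some y ∧ y.2 = false,
      fun G X Y => ⟨fun _ => (), fun q => by simp, fun v a ha => ?_⟩⟩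
    cases a with
    | none => simp [CML.Sat]
    | some e =>
      have hl := G.loopless e
      rcases ha e rfl with rfl | rfl
      · simp [CML.Sat, hl.symm]
      · simp [CML.Sat, hl]
  | dia S hS ψ ih => exact (ih.dia hS).congr fun _ _ _ _ _ => by simp only [CML.Sat]
  | box S hS ψ ih =>
    have := (ih.binary (fun p _ => ¬ p) ih).dia hS
    exact (this.binary (fun p _ => ¬ p) this).congr fun _ _ _ _ _ => by simp only [CML.Sat]

/-! ### Cuts and marked components -/

/-- `s` is a union of connected components of the graph induced by `A` that avoids the marked
vertices. -/
def ValidCut {V : Type} (H : SimpleGraph V) (A : Set V) (mark s : Finset V) : Prop :=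
  ∀ v ∈ s, v ∈ A ∧ v ∉ mark ∧ ∀ w ∈ A, H.Adj v w → w ∈ s

/-- Every connected component of the graph induced by `A` contains a marked vertex. -/
def AllMarked {V : Type} (H : SimpleGraph V) (A : Set V) (mark : Finset V) : Prop :=
  ∀ c : (H.induce A).ConnectedComponent, ∃ v : A, v.1 ∈ mark ∧
      (H.induce A).connectedComponentMk v = c

section

variable {V : Type} {H : SimpleGraph V} {A : Set V} {mark s : Finset V}

theorem ValidCut.mem_of_reachable (hs : ValidCut H A mark s) {v w : A} (h :
    (H.induce A).Reachable v w)
    (hv : v.1 ∈ s) : w.1 ∈ s := by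
  obtain ⟨p⟩ := h
  induction p with
  | nil => exact hv
  | @cons u v w huv _ ih => exact ih ((hs _ hv).2.2 _ v.2 (by simpa using huv))

theorem ValidCut.eq_empty (hs : ValidCut H A mark s) (h : AllMarked H A mark) : s = ∅ := by
  by_contra hne
  obtain ⟨v, hv⟩ := Finset.nonempty_iff_ne_empty.2 hne
  obtain ⟨w, hw, hc⟩ := h ((H.induce A).connectedComponentMk ⟨v, (hs v hv).1⟩)
  have := hs.mem_of_reachable (SimpleGraph.ConnectedComponent.exact hc).symm hv
  exact (hs _ this).2.1 hw

open Classical in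
/-- The symmetric difference of a valid cut and an unmarked component is a valid cut. -/
theorem ValidCut.symmDiff [Fintype V] (hs : ValidCut H A mark s)
    {c : (H.induce A).ConnectedComponent}
    (hc : ∀ v : A, v.1 ∈ mark → (H.induce A).connectedComponentMk v ≠ c) :
    ValidCut H A mark
      (symmDiff s (Finset.univ.filter fun v => ∃ h : v ∈ A,
        (H.induce A).connectedComponentMk ⟨v, h⟩ = c)) := by
  have hadj : ∀ v w (hv : v ∈ A) (hw : w ∈ A), H.Adj v w →
      (H.induce A).connectedComponentMk ⟨v, hv⟩ = (H.induce A).connectedComponentMk ⟨w, hw⟩ :=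
    fun v w hv hw h => SimpleGraph.ConnectedComponent.sound (SimpleGraph.Adj.reachable
        (by simpa using h))
  intro v hv
  simp only [Finset.mem_symmDiff, Finset.mem_filter, Finset.mem_univ, true_and] at hv ⊢
  rcases hv with ⟨hv, hvc⟩ | ⟨⟨hA, hvc⟩, hv⟩
  · obtain ⟨hA, hm, hcl⟩ := hs v hv
    refine ⟨hA, hm, fun w hw h => Or.inl ⟨hcl w hw h, ?_⟩⟩
    rintro ⟨_, hwc⟩
    exact hvc ⟨hA, (hadj v w hA hw h).trans hwc⟩
  · refine ⟨hA, fun hm => hc ⟨v, hA⟩ hm hvc, fun w hw h => Or.inr ⟨⟨hw, ?_⟩, fun hws => hv ?_⟩⟩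
    · rw [← hvc, hadj v w hA hw h]
    · exact (hs w hws).2.2 v hA h.symm

open Classical in
/-- The number of valid cuts is odd if and only if all the components are marked: adding or
removing an unmarked component pairs the cuts up. -/
theorem odd_card_validCut [Fintype V] (H : SimpleGraph V) (A : Set V) (mark : Finset V) :
    Odd (Finset.univ.filter fun s => ValidCut H A mark s).card ↔ AllMarked H A mark := by
  by_cases h : AllMarked H A mark
  · have : (Finset.univ.filter fun s => ValidCut H A mark s) = {∅} := by
      ext s
      simp only [Finset.mem_filter, Finset.mem_univ, true_and, Finset.mem_singleton]
      refine ⟨fun hs => hs.eq_empty h, ?_⟩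
      rintro rfl
      exact fun v hv => absurd hv (Finset.notMem_empty v)
    rw [this]
    exact iff_of_true (by simp) h
  · refine iff_of_false ?_ h
    unfold AllMarked at h
    push Not at h
    obtain ⟨c, hc⟩ := h
    rw [Nat.not_odd_iff_even]
    set C : Finset V := Finset.univ.filter fun v => ∃ h : v ∈ A,
      (H.induce A).connectedComponentMk ⟨v, h⟩ = c with hC
    have hne : C.Nonempty := by
      induction c using SimpleGraph.ConnectedComponent.ind with
      | h v => exact ⟨v, by simp [hC]⟩
    rw [← ZMod.natCast_eq_zero_iff_even, Finset.cast_card]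
    refine Finset.sum_involution (fun s _ => symmDiff s C) (fun s _ => by decide) (fun s _ _ e =>
        ?_)
      (fun s hs => ?_) (fun s _ => symmDiff_symmDiff_cancel_right C s)
    · exact hne.ne_empty (by simpa using e)
    · simp only [Finset.mem_filter, Finset.mem_univ, true_and] at hs ⊢
      exact hs.symmDiff hc

/-- Marks that reach all the components are at least as many as the components. -/
theorem card_components_le [Fintype V] (h : AllMarked H A mark) :
    Nat.card (H.induce A).ConnectedComponent ≤ mark.card := by
  choose f hf hf' using h
  have hinj : Function.Injective fun c => (⟨(f c).1, hf c⟩ : mark) := by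
    intro c c' e
    have : f c = f c' := Subtype.ext (congrArg (fun x : mark => x.1) e)
    rw [← hf' c, this, hf' c']
  have := Nat.card_le_card_of_injective _ hinj
  simpa using this

/-- One mark for every component. -/
theorem exists_allMarked [Fintype V] (H : SimpleGraph V) (A : Set V) :
    ∃ mark : Finset V, AllMarked H A mark ∧
      mark.card = Nat.card (H.induce A).ConnectedComponent := by
  classical
  have := Fintype.ofFinite (H.induce A).ConnectedComponent
  refine ⟨Finset.univ.image fun c : (H.induce A).ConnectedComponent => (c.nonempty_supp.some).1,
    fun c => ⟨c.nonempty_supp.some, Finset.mem_image_of_mem _ (Finset.mem_univ _),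
      c.nonempty_supp.some_mem⟩, ?_⟩
  rw [Finset.card_image_of_injective, Finset.card_univ, Nat.card_eq_fintype_card]
  intro c c' e
  have h := c.nonempty_supp.some_mem
  have h' := c'.nonempty_supp.some_mem
  rw [SimpleGraph.ConnectedComponent.mem_supp_iff] at h h'
  rw [← h, ← h', Subtype.ext e]

end

/-! ### Formulas with cuts as local counting problems -/

namespace LocallyDefinable

variable {dir : Bool} {ιX ιY ιX' ιY' : Type}

/-- Renaming of the set symbols. -/
theorem comap {P : ∀ (G : FinGraph dir), (ιX → Finset (Fin G.n)) → (ιY → Finset (Fin G.m)) →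
      Fin G.n → Option (Fin G.m) → Prop} (f : ιX → ιX') (g : ιY → ιY')
    (h : LocallyDefinable dir ιX ιY P) :
    LocallyDefinable dir ιX' ιY' fun G X Y v a => P G (X ∘ f) (Y ∘ g) v a := by
  obtain ⟨Q, _, M, _, _, con, ok, val, h⟩ := h
  exact ⟨Q, ‹_›, M, ‹_›, ‹_›, fun x q y d => con (x ∘ f) q (y ∘ g) d, fun x q m => ok (x ∘ f) q m,
    fun x q a => val (x ∘ f) q (a.map fun y => (y.1 ∘ g, y.2)), fun G X Y => by
      obtain ⟨q₀, h1, h2⟩ := h G (X ∘ f) (Y ∘ g)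
      refine ⟨q₀, h1, fun v a ha => ?_⟩
      dsimp only
      rw [h2 v a ha, Option.map_map]
      rfl⟩

theorem all {k : ℕ} {P : Fin k → ∀ (G : FinGraph dir), (ιX → Finset (Fin G.n)) →
      (ιY → Finset (Fin G.m)) → Fin G.n → Option (Fin G.m) → Prop}
    (h : ∀ i, LocallyDefinable dir ιX ιY (P i)) :
    LocallyDefinable dir ιX ιY fun G X Y v a => ∀ i, P i G X Y v a := by
  induction k with
  | zero =>
    exact (base fun _ _ => True).congr fun _ _ _ _ _ => by simp
  | succ k ih =>
    exact ((h 0).binary And (ih fun i => h i.succ)).congr fun _ _ _ _ _ => Fin.forall_fin_succ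

/-- Whether a neighbour with a given property exists. -/
theorem dia_one {P : ∀ (G : FinGraph dir), (ιX → Finset (Fin G.n)) → (ιY → Finset (Fin G.m)) →
      Fin G.n → Option (Fin G.m) → Prop} (h : LocallyDefinable dir ιX ιY P) :
    LocallyDefinable dir ιX ιY fun G X Y v _ => ∃ e w, G.Joins e v w ∧ P G X Y w (some e) :=
  (h.dia finitelyRecognizable_one_le).congr fun G X Y v a => by
    rw [Set.mem_ofPred_eq, Nat.one_le_iff_ne_zero, Ne, Set.ncard_eq_zero,
      ← Ne, ← Set.nonempty_iff_ne_empty]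
    rfl

end LocallyDefinable

section

variable {p₁ q₁ : ℕ}

namespace FinGraph

variable {dir : Bool} (G : FinGraph dir)

/-- The graph whose components are counted for a set of vertices or of edges. -/
def compGraph (Y : Fin q₁ → Finset (Fin G.m)) : Fin p₁ ⊕ Fin q₁ → SimpleGraph (Fin G.n)
  | .inl _ => G.toSimpleGraph
  | .inr j => G.edgeGraph (Y j : Set (Fin G.m))

/-- The set of vertices on which the components are counted. -/
def compSet (X : Fin p₁ → Finset (Fin G.n)) (Y : Fin q₁ → Finset (Fin G.m)) :
    Fin p₁ ⊕ Fin q₁ → Set (Fin G.n)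
  | .inl i => (X i : Set (Fin G.n))
  | .inr j => G.endpoints (Y j : Set (Fin G.m))

theorem edgeGraph_adj {Y : Set (Fin G.m)} {v w : Fin G.n} :
    (G.edgeGraph Y).Adj v w ↔ ∃ e ∈ Y, G.Joins e v w := by
  rw [edgeGraph, SimpleGraph.fromEdgeSet_adj]
  constructor
  · rintro ⟨⟨e, he, h⟩, -⟩
    refine ⟨e, he, ?_⟩
    rcases Sym2.eq_iff.1 h with ⟨h1, h2⟩ | ⟨h1, h2⟩
    exacts [Or.inl (Prod.ext h1 h2), Or.inr (Prod.ext h1 h2)]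
  · rintro ⟨e, he, h | h⟩
    · exact ⟨⟨e, he, by simp [h]⟩, fun hvw => G.loopless e (by simp [h, hvw])⟩
    · exact ⟨⟨e, he, by simp [h, Sym2.eq_swap]⟩, fun hvw => G.loopless e (by simp [h, hvw])⟩

theorem mem_endpoints {Y : Set (Fin G.m)} {v : Fin G.n} :
    v ∈ G.endpoints Y ↔ ∃ e w, G.Joins e v w ∧ e ∈ Y := by
  constructor
  · rintro ⟨e, he, rfl | rfl⟩
    exacts [⟨e, _, Or.inl rfl, he⟩, ⟨e, _, Or.inr rfl, he⟩]
  · rintro ⟨e, w, h | h, he⟩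
    exacts [⟨e, he, Or.inl (by rw [h])⟩, ⟨e, he, Or.inr (by rw [h])⟩]

end FinGraph

/-- The quantified sets of vertices, and the sets of marked vertices for the quantified sets whose
components are counted. -/
abbrev VSym (p₁ q₁ : ℕ) : Type := Fin p₁ ⊕ (Fin p₁ ⊕ Fin q₁)

/-- The symbols for vertex sets in the presence of cuts. -/
abbrev XSym (p₀ p₁ q₁ : ℕ) : Type := Fin p₀ ⊕ (VSym p₁ q₁ ⊕ (Fin p₁ ⊕ Fin q₁))

/-- Valid cuts are locally definable. -/
theorem locallyDefinable_validCut {dir : Bool} {p₀ q₀ : ℕ} (c : Fin p₁ ⊕ Fin q₁) :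
    LocallyDefinable dir (XSym p₀ p₁ q₁) (Fin q₀ ⊕ Fin q₁) fun G X Y v _ =>
      v ∈ X (.inr (.inr c)) →
        v ∈ G.compSet (fun i => X (.inr (.inl (.inl i)))) (fun j => Y (.inr j)) c ∧
        v ∉ X (.inr (.inl (.inr c))) ∧
        ∀ w ∈ G.compSet (fun i => X (.inr (.inl (.inl i)))) (fun j => Y (.inr j)) c,
          (G.compGraph (fun j => Y (.inr j)) c).Adj v w → w ∈ X (.inr (.inr c)) := by
  rcases c with i | j
  · have h1 := LocallyDefinable.base (dir := dir) (ιX := XSym p₀ p₁ q₁) (ιY := Fin q₀ ⊕ Fin q₁)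
      fun x _ => x (.inr (.inl (.inl i))) = true ∧ x (.inr (.inr (.inl i))) = false
    have h2 := LocallyDefinable.base (dir := dir) (ιX := XSym p₀ p₁ q₁) (ιY := Fin q₀ ⊕ Fin q₁)
      fun x _ => x (.inr (.inl (.inl i))) = true ∧ x (.inr (.inl (.inr (.inl i)))) = false
    have h3 := LocallyDefinable.base (dir := dir) (ιX := XSym p₀ p₁ q₁) (ιY := Fin q₀ ⊕ Fin q₁)
      fun x _ => x (.inr (.inr (.inl i))) = true
    refine (h3.binary (fun p q => p → q) (h2.binary (fun p q => p ∧ ¬ q) h1.dia_one)).congr ?_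
    intro G X Y v a
    simp only [memLabel, decide_eq_true_eq, decide_eq_false_iff_not, FinGraph.compSet,
      FinGraph.compGraph, FinGraph.toSimpleGraph, FinGraph.edgeGraph_adj, Set.mem_univ, true_and,
      Finset.mem_coe, not_exists, not_and, and_assoc, not_not]
    refine imp_congr_right fun _ => and_congr_right fun _ => and_congr_right fun _ => ?_
    exact ⟨fun h e w hw hX => h w hX ⟨e, hw⟩, fun h w hX ⟨e, hw⟩ => h e w hw hX⟩
  · have h1 := LocallyDefinable.base (dir := dir) (ιX := XSym p₀ p₁ q₁) (ιY := Fin q₀ ⊕ Fin q₁)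
      fun x a => (∃ y, a = some y ∧ y.1 (.inr j) = true) ∧ x (.inr (.inr (.inr j))) = false
    have h2 := LocallyDefinable.base (dir := dir) (ιX := XSym p₀ p₁ q₁) (ιY := Fin q₀ ⊕ Fin q₁)
      fun _ a => ∃ y, a = some y ∧ y.1 (.inr j) = true
    have h2' := LocallyDefinable.base (dir := dir) (ιX := XSym p₀ p₁ q₁) (ιY := Fin q₀ ⊕ Fin q₁)
      fun x _ => x (.inr (.inl (.inr (.inr j)))) = false
    have h3 := LocallyDefinable.base (dir := dir) (ιX := XSym p₀ p₁ q₁) (ιY := Fin q₀ ⊕ Fin q₁)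
      fun x _ => x (.inr (.inr (.inr j))) = true
    refine (h3.binary (fun p q => p → q) (h2.dia_one.binary And
      (h2'.binary (fun p q => p ∧ ¬ q) h1.dia_one))).congr ?_
    intro G X Y v a
    simp only [memLabel, decide_eq_true_eq, decide_eq_false_iff_not, FinGraph.compSet,
      FinGraph.compGraph, FinGraph.edgeGraph_adj, FinGraph.mem_endpoints, Option.map_some,
      Option.some.injEq, exists_eq_left', Finset.mem_coe, not_exists, not_and, not_not]
    refine imp_congr_right fun _ => and_congr_right fun _ => and_congr_right fun _ => ?_
    constructor
    · exact fun h e w hw he => h w ⟨e, v, hw.symm, he⟩ ⟨e, he, hw⟩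
    · exact fun h w _ ⟨e, he, hw⟩ => h e w hw he

/-- A system of states as in `LocallyDefinable`, ready for computation. -/
structure LocalSystem (ιX ιY : Type) where
  Q : Type
  M : Type
  [fintypeQ : Fintype Q]
  [decEqQ : DecidableEq Q]
  [fintypeM : Fintype M]
  [decEqM : DecidableEq M]
  [addM : AddCommMonoid M]
  con : (ιX → Bool) → Q → (ιY → Bool) → Bool → M
  ok : (ιX → Bool) → Q → M → Bool

attribute [instance] LocalSystem.fintypeQ LocalSystem.decEqQ LocalSystem.fintypeM
  LocalSystem.decEqM LocalSystem.addM

/-- The condition that `P` holds in every vertex becomes part of the local conditions: if it holds,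
then there is exactly one assignment of states that satisfies them, and otherwise there is none. -/
theorem LocallyDefinable.exists_localSystem {dir : Bool} {ιX ιY : Type}
    {P : ∀ (G : FinGraph dir), (ιX → Finset (Fin G.n)) → (ιY → Finset (Fin G.m)) → Fin G.n →
      Option (Fin G.m) → Prop} (h : LocallyDefinable dir ιX ιY P) :
    ∃ L : LocalSystem ιX ιY, ∀ (G : FinGraph dir) (X : ιX → Finset (Fin G.n))
      (Y : ιY → Finset (Fin G.m)), ∃ q₀ : Fin G.n → L.Q, ∀ q : Fin G.n → L.Q,
        (∀ v, L.ok (memLabel X v) (q v) (G.nbSum (fun w e d =>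
          L.con (memLabel X w) (q w) (memLabel Y e) d) v) = true) ↔
            q = q₀ ∧ ∀ v, P G X Y v none := by
  classical
  obtain ⟨Q, _, M, _, _, con, ok, val, h⟩ := h
  have := Fintype.ofFinite Q
  have := Fintype.ofFinite M
  refine ⟨{ Q := Q, M := M, con := con, ok := fun x q m => decide (ok x q m ∧ val x q none) },
    fun G X Y => ?_⟩
  obtain ⟨q₀, h1, h2⟩ := h G X Y
  refine ⟨q₀, fun q => ?_⟩
  simp only [decide_eq_true_eq, forall_and]
  rw [h1]
  refine and_congr_right ?_
  rintro rfl
  refine forall_congr' fun v => ?_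
  rw [h2 v none (by simp)]
  rfl

/-- The choices of all the visible sets: the quantified sets and the marked vertices. -/
abbrev Visible (p₁ q₁ n m : ℕ) : Type :=
  (VSym p₁ q₁ → Finset (Fin n)) × (Fin q₁ → Finset (Fin m))

/-- The sets satisfy the modal part of the formula, and every component is marked. -/
def ECMLC.Marked {dir : Bool} {p₀ q₀ r : ℕ} (φ : ECMLC dir p₀ q₀ r) (I : Inst dir p₀ q₀ r)
    (z : Visible φ.p₁ φ.q₁ I.G.n I.G.m) : Prop :=
  (∀ v, φ.modal.Sat I.G (Sum.elim I.FX fun i => z.1 (.inl i)) (Sum.elim I.FY z.2) v none) ∧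
    ∀ c, AllMarked (I.G.compGraph z.2 c) (I.G.compSet (fun i => z.1 (.inl i)) z.2 c)
      (z.1 (.inr c))

/-- The keys of a choice of the visible sets: its weight and the cardinalities of the sets. -/
abbrev KeySym (p₁ q₁ : ℕ) : Type := Option (VSym p₁ q₁ ⊕ Fin q₁)

section Keys

variable {n m : ℕ} (wV : Fin n → VSym p₁ q₁ → ℕ) (wE : Fin m → Fin q₁ → ℕ)

/-- The contribution of a vertex with the label `x` to the keys. -/
def vertexKey (v : Fin n) (x : VSym p₁ q₁ → Bool) : KeySym p₁ q₁ → ℕ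
  | none => ∑ i, if x i then wV v i else 0
  | some (.inl i) => if x i then 1 else 0
  | some (.inr _) => 0

/-- The contribution of an edge with the label `y` to the keys. -/
def edgeKey (e : Fin m) (y : Fin q₁ → Bool) : KeySym p₁ q₁ → ℕ
  | none => ∑ j, if y j then wE e j else 0
  | some (.inl _) => 0
  | some (.inr j) => if y j then 1 else 0

/-- The value of a key on a choice of the visible sets, as the sum of the contributions of all the
vertices and edges. The key `none` is the weight, the others are cardinalities. -/
def visibleKey (z : Visible p₁ q₁ n m) (k : KeySym p₁ q₁) : ℕ :=
  ∑ v, vertexKey wV v (memLabel z.1 v) k + ∑ e, edgeKey wE e (memLabel z.2 e) k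

theorem visibleKey_inl (z : Visible p₁ q₁ n m) (i : VSym p₁ q₁) :
    visibleKey wV wE z (some (.inl i)) = (z.1 i).card := by
  simp [visibleKey, vertexKey, edgeKey, memLabel]

theorem visibleKey_inr (z : Visible p₁ q₁ n m) (j : Fin q₁) :
    visibleKey wV wE z (some (.inr j)) = (z.2 j).card := by
  simp [visibleKey, vertexKey, edgeKey, memLabel]

end Keys

/-- The number of keys. -/
abbrev numKeys (p₁ q₁ : ℕ) : ℕ := Fintype.card (KeySym p₁ q₁)

/-- The positions of the keys in the rows of the tables. -/
noncomputable def keyIdx (p₁ q₁ : ℕ) : KeySym p₁ q₁ ≃ Fin (numKeys p₁ q₁) := Fintype.equivFin _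

/-- The labels of the vertices in the local counting problem. -/
def LocalSystem.VLabel {p₀ q₀ : ℕ} (L : LocalSystem (XSym p₀ p₁ q₁) (Fin q₀ ⊕ Fin q₁)) : Type :=
  (XSym p₀ p₁ q₁ → Bool) × L.Q

instance {p₀ q₀ : ℕ} (L : LocalSystem (XSym p₀ p₁ q₁) (Fin q₀ ⊕ Fin q₁)) : Fintype L.VLabel :=
  inferInstanceAs (Fintype ((XSym p₀ p₁ q₁ → Bool) × L.Q))

instance {p₀ q₀ : ℕ} (L : LocalSystem (XSym p₀ p₁ q₁) (Fin q₀ ⊕ Fin q₁)) : DecidableEq L.VLabel :=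
  inferInstanceAs (DecidableEq ((XSym p₀ p₁ q₁ → Bool) × L.Q))

/-- The local counting problem of an instance. -/
noncomputable def LocalSystem.problem {dir : Bool} {p₀ q₀ r : ℕ}
    (L : LocalSystem (XSym p₀ p₁ q₁) (Fin q₀ ⊕ Fin q₁)) (I : Inst dir p₀ q₀ r)
    (wV : Fin I.G.n → VSym p₁ q₁ → ℕ) (wE : Fin I.G.m → Fin q₁ → ℕ) (R : ℕ) :
    LocalProblem L.VLabel (Fin q₀ ⊕ Fin q₁ → Bool) L.M I.G.n I.G.m (numKeys p₁ q₁) R where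
  ends := I.G.ends
  con a a' b := (L.con a'.1 a'.2 b true, L.con a.1 a.2 b false)
  okV v a m := decide ((fun i => a.1 (.inl i)) = memLabel I.FX v) && L.ok a.1 a.2 m
  okE e b := decide ((fun j => b (.inl j)) = memLabel I.FY e)
  keyV v a k := (vertexKey wV v (fun i => a.1 (.inr (.inl i))) ((keyIdx p₁ q₁).symm k) : ℕ)
  keyE e b k := (edgeKey wE e (fun j => b (.inr j)) ((keyIdx p₁ q₁).symm k) : ℕ)

/-- All the sets of vertices. -/
def allX {p₀ n m : ℕ} (FX : Fin p₀ → Finset (Fin n)) (z : Visible p₁ q₁ n m)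
    (cut : Fin p₁ ⊕ Fin q₁ → Finset (Fin n)) : XSym p₀ p₁ q₁ → Finset (Fin n) :=
  Sum.elim FX (Sum.elim z.1 cut)

/-- A product of natural numbers is odd if and only if all the factors are: this combines the cuts
of several sets. -/
theorem odd_prod_card {ι : Type} [Fintype ι] (f : ι → ℕ) : Odd (∏ i, f i) ↔ ∀ i, Odd (f i) := by
  simp [← Nat.not_even_iff_odd, Nat.even_iff, ← Nat.dvd_iff_mod_eq_zero,
    Prime.dvd_finsetProd_iff Nat.prime_two.prime]

theorem memLabel_eq_iff {k : ℕ} {ι : Type} {X X' : ι → Finset (Fin k)} :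
    (∀ v, memLabel X v = memLabel X' v) ↔ X = X' := by
  refine ⟨fun h => funext fun i => Finset.ext fun v => ?_, fun h _ => by rw [h]⟩
  simpa [memLabel] using congrFun (h v) i

open Classical in
/-- The number of solutions of the local counting problem is congruent modulo two to the number of
choices of the visible sets that satisfy the modal formula and mark every component: all the
other choices are counted an even number of times because of the cuts. -/
theorem ECMLC.exists_localSystem {dir : Bool} {p₀ q₀ r : ℕ} (φ : ECMLC dir p₀ q₀ r) :
    ∃ L : LocalSystem (XSym p₀ φ.p₁ φ.q₁) (Fin q₀ ⊕ Fin φ.q₁), ∀ (I : Inst dir p₀ q₀ r)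
      (wV : Fin I.G.n → VSym φ.p₁ φ.q₁ → ℕ) (wE : Fin I.G.m → Fin φ.q₁ → ℕ) (R : ℕ)
      (x : Fin (numKeys φ.p₁ φ.q₁) → ZMod (R + 1)),
      Odd (Finset.univ.filter fun p => (L.problem I wV wE R).IsSol p ∧
          (L.problem I wV wE R).key p = x).card ↔
        Odd (Finset.univ.filter fun z => φ.Marked I z ∧
          (fun k => (visibleKey wV wE z ((keyIdx φ.p₁ φ.q₁).symm k) : ZMod (R + 1))) = x).card := by
  have hdef := (φ.modal.locallyDefinable.comap
    (Sum.map id fun i => .inl (.inl i) : Fin p₀ ⊕ Fin φ.p₁ → XSym p₀ φ.p₁ φ.q₁)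
    (id : Fin q₀ ⊕ Fin φ.q₁ → Fin q₀ ⊕ Fin φ.q₁)).binary And
    ((LocallyDefinable.all fun i => locallyDefinable_validCut (.inl i)).binary And
      (LocallyDefinable.all fun j => locallyDefinable_validCut (.inr j)))
  obtain ⟨L, hL⟩ := hdef.exists_localSystem
  refine ⟨L, fun I wV wE R x => ?_⟩
  set P := L.problem I wV wE R with hP
  -- the state that belongs to a choice of all the sets
  choose q₀' hq₀ using hL I.G
  have hq : ∀ (z : Visible φ.p₁ φ.q₁ I.G.n I.G.m) (cut : Fin φ.p₁ ⊕ Fin φ.q₁ → Finset (Fin I.G.n))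
      (q : Fin I.G.n → L.Q),
      (∀ v, L.ok (memLabel (allX I.FX z cut) v) (q v) (I.G.nbSum (fun w e d =>
          L.con (memLabel (allX I.FX z cut) w) (q w) (memLabel
              (Sum.elim I.FY z.2) e) d) v) = true) ↔
        q = q₀' (allX I.FX z cut) (Sum.elim I.FY z.2) ∧
        (∀ v, φ.modal.Sat I.G (Sum.elim I.FX fun i => z.1 (.inl i)) (Sum.elim I.FY z.2) v none) ∧
        ∀ c, ValidCut (I.G.compGraph z.2 c) (I.G.compSet (fun i => z.1 (.inl i)) z.2 c)
          (z.1 (.inr c)) (cut c) := by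
    intro z cut q
    rw [hq₀]
    refine and_congr_right fun _ => ?_
    have hX : (allX I.FX z cut ∘
        (Sum.map id fun i => .inl (.inl i) : Fin p₀ ⊕ Fin φ.p₁ → XSym p₀ φ.p₁ φ.q₁)) =
        Sum.elim I.FX fun i => z.1 (.inl i) := by
      funext i; rcases i with i | i <;> rfl
    rw [Function.comp_id, hX, forall_and, forall_and, Sum.forall]
    refine and_congr_right fun _ => and_congr ?_ ?_
    · exact forall_comm
    · exact forall_comm
  have hsol : ∀ p, P.IsSol p ↔ (∀ e, (fun j => p.2 e (.inl j)) = memLabel I.FY e) ∧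
      (∀ v, (fun i => (p.1 v).1 (.inl i)) = memLabel I.FX v) ∧
      ∀ v, L.ok (p.1 v).1 (p.1 v).2 (I.G.nbSum (fun w e d =>
        L.con (p.1 w).1 (p.1 w).2 (p.2 e) d) v) = true := by
    intro p
    rw [LocalProblem.IsSol, ← forall_and]
    refine and_congr (forall_congr' fun e => decide_eq_true_iff) (forall_congr' fun v => ?_)
    rw [← decide_eq_true_iff (p := (fun i => (p.1 v).1 (.inl i)) = memLabel I.FX v),
      ← Bool.and_eq_true]
    rfl
  have hkey : ∀ p (z : Visible φ.p₁ φ.q₁ I.G.n I.G.m),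
      (∀ v, (fun i => (p.1 v).1 (.inr (.inl i))) = memLabel z.1 v) →
      (∀ e, (fun j => p.2 e (.inr j)) = memLabel z.2 e) →
      P.key p = fun k => (visibleKey wV wE z ((keyIdx φ.p₁ φ.q₁).symm k) : ZMod (R + 1)) := by
    intro p z h1 h2
    funext k
    rw [LocalProblem.key, visibleKey, Nat.cast_add, Nat.cast_sum, Nat.cast_sum, Pi.add_apply,
      Finset.sum_apply, Finset.sum_apply]
    congr 1
    · exact Finset.sum_congr rfl fun v _ => by rw [← h1]; rfl
    · exact Finset.sum_congr rfl fun e _ => by rw [← h2]; rfl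
  have hcard : (Finset.univ.filter fun p => P.IsSol p ∧ P.key p = x).card =
      ((Finset.univ.filter fun z : Visible φ.p₁ φ.q₁ I.G.n I.G.m =>
        (∀ v, φ.modal.Sat I.G (Sum.elim I.FX fun i => z.1 (.inl i)) (Sum.elim I.FY z.2) v none) ∧
        (fun k => (visibleKey wV wE z ((keyIdx φ.p₁ φ.q₁).symm k) : ZMod
            (R + 1))) = x).sigma fun z =>
        Fintype.piFinset fun c => Finset.univ.filter fun s =>
          ValidCut (I.G.compGraph z.2 c) (I.G.compSet (fun i => z.1 (.inl i)) z.2 c)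
            (z.1 (.inr c)) s).card := by
    symm
    refine Finset.card_bij (fun y _ => (fun v => (memLabel (allX I.FX y.1 y.2) v,
      q₀' (allX I.FX y.1 y.2) (Sum.elim I.FY y.1.2) v), fun e => memLabel (Sum.elim I.FY y.1.2) e))
      ?_ ?_ ?_
    · rintro ⟨z, cut⟩ hy
      simp only [Finset.mem_sigma, Finset.mem_filter, Finset.mem_univ, true_and,
        Fintype.mem_piFinset] at hy ⊢
      refine ⟨(hsol _).2 ⟨fun e => rfl, fun v => rfl, (hq z cut _).2 ⟨rfl, hy.1.1, hy.2⟩⟩, ?_⟩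
      rw [← hy.1.2]
      exact hkey _ z (fun _ => rfl) fun _ => rfl
    · rintro ⟨z, cut⟩ _ ⟨z', cut'⟩ _ e
      have e1 := memLabel_eq_iff.1 fun v =>
        congrArg Prod.fst (congrFun (congrArg Prod.fst e) v)
      have e2 := memLabel_eq_iff.1 (congrFun (congrArg Prod.snd e))
      have hz : z = z' := Prod.ext (funext fun i => congrFun e1 (.inr (.inl i)))
        (funext fun j => congrFun e2 (.inr j))
      have hcut : cut = cut' := funext fun i => congrFun e1 (.inr (.inr i))
      rw [hz, hcut]
    · rintro ⟨σ, τ⟩ hp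
      simp only [Finset.mem_filter, Finset.mem_univ, true_and] at hp
      obtain ⟨hp, hk⟩ := hp
      obtain ⟨hE, hV, hok⟩ := (hsol _).1 hp
      set z : Visible φ.p₁ φ.q₁ I.G.n I.G.m :=
        (fun i => Finset.univ.filter fun v => (σ v).1 (.inr (.inl i)) = true,
          fun j => Finset.univ.filter fun e => τ e (.inr j) = true) with hz
      set cut : Fin φ.p₁ ⊕ Fin φ.q₁ → Finset (Fin I.G.n) :=
        fun c => Finset.univ.filter fun v => (σ v).1 (.inr (.inr c)) = true with hcut
      have h1 : ∀ v, memLabel (allX I.FX z cut) v = (σ v).1 := by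
        intro v
        funext i
        rcases i with i | i | i
        · exact (congrFun (hV v) i).symm
        · simp [memLabel, allX, hz]
        · simp [memLabel, allX, hcut]
      have h2 : ∀ e, memLabel (Sum.elim I.FY z.2) e = τ e := by
        intro e
        funext j
        rcases j with j | j
        · exact (congrFun (hE e) j).symm
        · simp [memLabel, hz]
      have := (hq z cut fun v => (σ v).2).1 (by simpa only [h1, h2] using hok)
      refine ⟨⟨z, cut⟩, ?_, ?_⟩
      · simp only [Finset.mem_sigma, Finset.mem_filter, Finset.mem_univ, true_and,
          Fintype.mem_piFinset]
        refine ⟨⟨this.2.1, ?_⟩, this.2.2⟩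
        rw [← hk]
        refine (hkey _ z (fun v => ?_) fun e => ?_).symm
        · funext i; simp [memLabel, hz]
        · funext j; simp [memLabel, hz]
      · refine Prod.ext (funext fun v => Prod.ext (h1 v) ?_) (funext h2)
        exact (congrFun this.1 v).symm
  rw [hcard, Finset.card_sigma, Finset.odd_sum_iff_odd_card_odd, Finset.filter_filter]
  refine iff_of_eq (congrArg Odd (congrArg Finset.card (Finset.filter_congr fun z _ => ?_)))
  rw [Fintype.card_piFinset, odd_prod_card, ECMLC.Marked, and_assoc, and_assoc, and_comm (a :=
      _ = x)]
  simp only [odd_card_validCut]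

end

/-! ### The isolation lemma -/

section

variable {U σ : Type} [Fintype U] [DecidableEq U]

/-- The weight of a set, given by its membership test. -/
def setWeight (w : U → ℕ) (s : U → Bool) : ℕ := ∑ u, if s u then w u else 0

theorem setWeight_congr {w w' : U → ℕ} {s : U → Bool} {u : U} (hs : s u = false)
    (h : ∀ v, v ≠ u → w v = w' v) : setWeight w s = setWeight w' s := by
  refine Finset.sum_congr rfl fun v _ => ?_
  rcases eq_or_ne v u with rfl | hv
  · simp [hs]
  · rw [h v hv]

theorem setWeight_lt {w w' : U → ℕ} {s : U → Bool} {u : U} (hs : s u = true) (hu : w u < w' u)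
    (h : ∀ v, v ≠ u → w v = w' v) : setWeight w s < setWeight w' s := by
  refine Finset.sum_lt_sum (fun v _ => ?_) ⟨u, Finset.mem_univ _, by simpa [hs] using hu⟩
  rcases eq_or_ne v u with rfl | hv
  · split <;> omega
  · rw [h v hv]

/-- Some member of the family is determined by its weight. -/
def Isolated (F : Finset σ) (mem : σ → U → Bool) (w : U → ℕ) : Prop :=
  ∃ z ∈ F, ∀ z' ∈ F, setWeight w (mem z') = setWeight w (mem z) → z' = z

/-- Two members of minimum weight of the family differ in `u`. -/
def Ambiguous (F : Finset σ) (mem : σ → U → Bool) (u : U) (w : U → ℕ) : Prop :=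
  ∃ z ∈ F, ∃ z' ∈ F, mem z u = true ∧ mem z' u = false ∧
    setWeight w (mem z) = setWeight w (mem z') ∧ ∀ y ∈ F, setWeight w (mem z) ≤ setWeight w (mem y)

variable {F : Finset σ} {mem : σ → U → Bool}

/-- If the minimum of the weight is attained twice, then two members of minimum weight differ in
some element. -/
theorem exists_ambiguous (hF : F.Nonempty) (hmem : Function.Injective mem) {w : U → ℕ}
    (h : ¬ Isolated F mem w) : ∃ u, Ambiguous F mem u w := by
  obtain ⟨z, hz, hmin⟩ := F.exists_min_image (fun z => setWeight w (mem z)) hF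
  unfold Isolated at h
  push Not at h
  obtain ⟨z', hz', he, hne⟩ := h z hz
  obtain ⟨u, hu⟩ := Function.ne_iff.1 fun e => hne (hmem e)
  refine ⟨u, ?_⟩
  cases h : mem z u with
  | true => exact ⟨z, hz, z', hz', h, by simpa [h] using hu, he.symm, hmin⟩
  | false => exact ⟨z', hz', z, hz, by simpa [h] using hu, h, he, fun y hy => he ▸ hmin y hy⟩

/-- The other weights leave at most one value of `w u` for which `u` is ambiguous. -/
theorem Ambiguous.not_lt {u : U} {w w' : U → ℕ} (h : Ambiguous F mem u w)
    (h' : Ambiguous F mem u w')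
    (he : ∀ v, v ≠ u → w v = w' v) : ¬ w u < w' u := by
  intro hlt
  obtain ⟨z, _, z', hz', _, hu', hzz', hmin⟩ := h
  obtain ⟨y, hy, y', _, hv, _, _, hmin'⟩ := h'
  have h1 := hmin' z' hz'
  have h2 := setWeight_congr hu' he
  have h3 := hmin y hy
  have h4 := setWeight_lt hv hlt he
  omega

open Classical in
/-- For every `u`, random weights below `K` make `u` ambiguous with probability at most `1 / K`. -/
theorem card_ambiguous_mul_le (K : ℕ) (u : U) :
    (Finset.univ.filter fun w : U → Fin K => Ambiguous F mem u fun v => w v).card * K ≤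
      K ^ Fintype.card U := by
  have : ((Finset.univ.filter fun w : U → Fin K => Ambiguous F mem u fun v => w v) ×ˢ
      (Finset.univ : Finset (Fin K))).card ≤ (Finset.univ : Finset (U → Fin K)).card := by
    refine Finset.card_le_card_of_injOn (fun x => Function.update x.1 u x.2)
      (fun _ _ => Finset.mem_coe.2 (Finset.mem_univ _)) ?_
    rintro ⟨w, a⟩ hw ⟨w', a'⟩ hw' e
    simp only [Finset.coe_product, Finset.coe_filter, Finset.mem_univ, true_and, Finset.coe_univ,
      Set.mem_prod, Set.mem_ofPred_eq, Set.mem_univ, and_true] at hw hw'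
    have ha : a = a' := by simpa using congrFun e u
    have hne : ∀ v, v ≠ u → w v = w' v := fun v hv => by simpa [hv] using congrFun e v
    refine Prod.ext (funext fun v => ?_) ha
    rcases eq_or_ne v u with rfl | hv
    · have h1 : ¬ (w v : ℕ) < w' v := hw.not_lt hw' fun v hv => by rw [hne v hv]
      have h2 : ¬ (w' v : ℕ) < w v := hw'.not_lt hw fun v hv => by rw [hne v hv]
      exact Fin.ext (le_antisymm (not_lt.1 h2) (not_lt.1 h1))
    · exact hne v hv
  rw [Finset.card_product] at this
  simpa using this

open Classical in
/-- The isolation lemma: random weights make some member of the family unique with probability at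
least one half. -/
theorem card_not_isolated_le (hF : F.Nonempty) (hmem : Function.Injective mem) {K : ℕ} (hK : 0 < K)
    (hKU : 2 * Fintype.card U ≤ K) :
    2 * (Finset.univ.filter fun w : U → Fin K => ¬ Isolated F mem fun v => w v).card ≤
      K ^ Fintype.card U := by
  have h1 : (Finset.univ.filter fun w : U → Fin K => ¬ Isolated F mem fun v => w v).card ≤
      ∑ u, (Finset.univ.filter fun w : U → Fin K => Ambiguous F mem u fun v => w v).card := by
    refine le_trans (Finset.card_le_card fun w hw => ?_) Finset.card_biUnion_le
    obtain ⟨u, hu⟩ := exists_ambiguous hF hmem (Finset.mem_filter.1 hw).2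
    exact Finset.mem_biUnion.2 ⟨u, Finset.mem_univ _, Finset.mem_filter.2 ⟨Finset.mem_univ _, hu⟩⟩
  have h2 : (∑ u, (Finset.univ.filter fun w : U → Fin K => Ambiguous F mem u fun v => w v).card) * K
      ≤ Fintype.card U * K ^ Fintype.card U := by
    rw [Finset.sum_mul]
    refine (Finset.sum_le_sum fun u _ => card_ambiguous_mul_le K u).trans ?_
    simp
  have h3 := Nat.mul_le_mul_right K h1
  have h4 := Nat.mul_le_mul_right (K ^ Fintype.card U) hKU
  refine Nat.le_of_mul_le_mul_right (?_ : _ * K ≤ _ * K) hK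
  nlinarith

end

/-! ### Weights from coin tosses -/

open MeasureTheory in
open Classical in
/-- A set of outcomes of the first `J` tosses has at most the probability `2⁻ᴶ` times its size. -/
theorem coinMeasure_le (J : ℕ) (S : Finset (Fin J → Bool)) :
    coinMeasure {ω | (fun i : Fin J => ω i) ∈ S} ≤ S.card * (1 / 2) ^ J := by
  have h1 : {ω : ℕ → Bool | (fun i : Fin J => ω i) ∈ S} =
      ⋃ f ∈ S, {ω : ℕ → Bool | (fun i : Fin J => ω i) = f} := by
    ext ω; simp
  have h2 : ∀ f : Fin J → Bool, coinMeasure {ω | (fun i : Fin J => ω i) = f} = (1 / 2) ^ J := by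
    intro f
    have : {ω : ℕ → Bool | (fun i : Fin J => ω i) = f} =
        Set.pi (Finset.range J : Finset ℕ) fun i => if h : i < J then {f ⟨i, h⟩} else Set.univ := by
      ext ω
      simp only [Set.mem_ofPred_eq, Set.mem_pi, Finset.coe_range, Set.mem_Iio, funext_iff]
      constructor
      · intro h i hi
        rw [dif_pos hi]
        exact h ⟨i, hi⟩
      · intro h i
        have := h i i.2
        rwa [dif_pos i.2] at this
    rw [this, coinMeasure, Measure.infinitePi_pi]
    · rw [Finset.prod_congr rfl (g := fun _ => 1 / 2), Finset.prod_const, Finset.card_range]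
      intro i hi
      rw [dif_pos (Finset.mem_range.1 hi), PMF.toMeasure_apply_singleton _ _
          (MeasurableSet.singleton _)]
      simp
    · intro i _
      exact MeasurableSet.of_discrete
  rw [h1]
  refine (measure_biUnion_finset_le S _).trans ?_
  simp only [h2]
  simp

section

variable {U : Type} [Fintype U]

/-- The weights of `b` bits that are read off a sequence of bits; `f` numbers the elements. -/
def bitWeight (f : U → ℕ) (b : ℕ) (β : ℕ → Bool) (u : U) : ℕ :=
  Nat.ofBits fun j : Fin b => β (f u * b + j)

theorem bitWeight_lt (f : U → ℕ) (b : ℕ) (β : ℕ → Bool) (u : U) : bitWeight f b β u < 2 ^ b :=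
  Nat.ofBits_lt_two_pow _

open Classical in
/-- An event on weights that has probability at most one half. -/
theorem coinMeasure_bitWeight_le {N : ℕ} (e : U ≃ Fin N) (b : ℕ)
    (S : Finset (U → Fin (2 ^ b))) (hS : 2 * S.card ≤ (2 ^ b) ^ N) :
    coinMeasure {ω | (fun u => ⟨bitWeight (fun u => e u) b ω u, bitWeight_lt _ _ _ _⟩) ∈ S} ≤
      1 / 2 := by
  set J := N * b with hJ
  -- the weights are in bijection with the first `J` tosses
  set wt : (Fin J → Bool) → U → Fin (2 ^ b) := fun g u =>
    ⟨bitWeight (fun u => e u) b (fun i => if h : i < J then g ⟨i, h⟩ else false) u,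
      bitWeight_lt _ _ _ _⟩ with hwt
  have hlt : ∀ (u : U) (j : Fin b), (e u : ℕ) * b + j < J := fun u j => by
    have := Nat.mul_le_mul_right b (Nat.succ_le_of_lt (e u).2)
    rw [Nat.succ_mul] at this
    omega
  have hinj : Function.Injective wt := by
    intro g g' h
    funext i
    have hb : 0 < b := Nat.pos_of_ne_zero fun h0 => by
      have h1 := i.2
      have h2 : J = 0 := by rw [hJ, h0, mul_zero]
      omega
    have hi : (i : ℕ) / b < N := Nat.div_lt_of_lt_mul (by rw [mul_comm]; exact i.2)
    have h1 := congrArg Fin.val (congrFun h (e.symm ⟨i / b, hi⟩))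
    simp only [hwt, bitWeight, Equiv.apply_symm_apply] at h1
    have h2 := congrArg (fun x => Nat.testBit x (i % b)) h1
    rw [Nat.testBit_ofBits_lt _ _ (Nat.mod_lt _ hb), Nat.testBit_ofBits_lt _ _ (Nat.mod_lt _ hb)]
      at h2
    simpa [Nat.div_add_mod'] using h2
  have hset : {ω : ℕ → Bool | (fun u => ⟨bitWeight (fun u => e u) b ω u,
      bitWeight_lt _ _ _ _⟩) ∈ S} =
      {ω | (fun i : Fin J => ω i) ∈ Finset.univ.filter fun g => wt g ∈ S} := by
    ext ω
    simp only [Set.mem_ofPred_eq, Finset.mem_filter, Finset.mem_univ, true_and]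
    refine iff_of_eq (congrArg (· ∈ S) (funext fun u => Fin.ext ?_))
    simp only [hwt, bitWeight]
    congr 1
    funext j
    rw [dif_pos (hlt u j)]
  rw [hset]
  refine (coinMeasure_le J _).trans ?_
  have hcard : (Finset.univ.filter fun g => wt g ∈ S).card ≤ S.card :=
    Finset.card_le_card_of_injOn wt (fun g hg => (Finset.mem_filter.1 hg).2) hinj.injOn
  have h2 : 2 * (Finset.univ.filter fun g => wt g ∈ S).card ≤ 2 ^ J := by
    refine le_trans (by omega) (hS.trans ?_)
    rw [← pow_mul, mul_comm]
  generalize (Finset.univ.filter fun g => wt g ∈ S).card = N at h2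
  have h3 : (2 : ENNReal) * N ≤ 2 ^ J := by exact_mod_cast h2
  calc (N : ENNReal) * (1 / 2) ^ J = (1 / 2) * ((2 * N) * (1 / 2) ^ J) := by
        rw [← mul_assoc, ← mul_assoc, one_div, ENNReal.inv_mul_cancel two_ne_zero
            ENNReal.ofNat_ne_top,
          one_mul]
    _ ≤ 1 / 2 * (2 ^ J * (1 / 2) ^ J) := by gcongr
    _ = 1 / 2 := by
        rw [← mul_pow, one_div, ENNReal.mul_inv_cancel two_ne_zero ENNReal.ofNat_ne_top, one_pow,
          mul_one]

end

/-! ### The decision rule -/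

/-- A formula that is monotone over the variables in `s` stays true when they decrease. -/
theorem ArFormula.Holds.mono {r : ℕ} {C : Type} [DecidableEq C] {φ : ArFormula r C}
    {k : Fin r → ℤ} (s : Finset C) (hs : ∀ x ∈ s, φ.MonotoneOver x) {c c' : C → ℕ}
    (h : ∀ x ∉ s, c' x = c x) (h' : ∀ x ∈ s, c' x ≤ c x) (hc : φ.Holds k c) : φ.Holds k c' := by
  induction s using Finset.induction_on generalizing c with
  | empty =>
    rwa [funext fun x => h x (Finset.notMem_empty x)]
  | insert x s hx ih =>
    refine ih (fun y hy => hs y (Finset.mem_insert_of_mem hy)) (c := Function.update c x (c' x))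
      (fun y hy => ?_) (fun y hy => ?_)
      (hs x (Finset.mem_insert_self _ _) k c _ (h' x (Finset.mem_insert_self _ _)) hc)
    · rcases eq_or_ne y x with rfl | hyx
      · simp
      · rw [Function.update_of_ne hyx]
        exact h y (by simp [hyx, hy])
    · rw [Function.update_of_ne (by rintro rfl; exact hx hy)]
      exact h' y (Finset.mem_insert_of_mem hy)

section

variable {dir : Bool} {p₀ q₀ r p₁ q₁ : ℕ}

/-- The values of the count variables according to the keys; the numbers of marked vertices stand
for the numbers of components of the quantified sets. -/
noncomputable def Inst.keyCounts (I : Inst dir p₀ q₀ r) (κ : KeySym p₁ q₁ → ℕ) :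
    CountVar p₀ q₀ p₁ q₁ → ℕ
  | .numV => I.G.n
  | .numE => I.G.m
  | .cardFX i => (I.FX i).card
  | .cardFY j => (I.FY j).card
  | .cardX i => κ (some (.inl (.inl i)))
  | .cardY j => κ (some (.inr j))
  | .ccFX i => I.G.ccV (I.FX i)
  | .ccFY j => I.G.ccE (I.FY j)
  | .ccX i => κ (some (.inl (.inr (.inl i))))
  | .ccY j => κ (some (.inl (.inr (.inr j))))

/-- Soundness: by monotonicity, the arithmetic formula stays true when the numbers of marked
vertices are replaced by the numbers of components, which are at most as large. -/
theorem ECMLC.Marked.holds {φ : ECMLC dir p₀ q₀ r} {I : Inst dir p₀ q₀ r}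
    {z : Visible φ.p₁ φ.q₁ I.G.n I.G.m} (hz : φ.Marked I z) {wV : Fin I.G.n → VSym φ.p₁ φ.q₁ → ℕ}
    {wE : Fin I.G.m → Fin φ.q₁ → ℕ}
    (h : φ.arith.Holds I.k (I.keyCounts (visibleKey wV wE z))) : φ.Holds I := by
  refine ⟨fun i => z.1 (.inl i), z.2, ?_, hz.1⟩
  refine h.mono (Finset.univ.image CountVar.ccX ∪ Finset.univ.image CountVar.ccY) ?_ ?_ ?_
  · intro x hx
    simp only [Finset.mem_union, Finset.mem_image, Finset.mem_univ, true_and] at hx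
    rcases hx with ⟨i, rfl⟩ | ⟨j, rfl⟩
    exacts [φ.mono_ccX i, φ.mono_ccY j]
  · intro x hx
    simp only [Finset.mem_union, Finset.mem_image, Finset.mem_univ, true_and] at hx
    cases x <;> simp only [Inst.counts, Inst.keyCounts, visibleKey_inl, visibleKey_inr]
    · exact absurd (Or.inl ⟨_, rfl⟩) hx
    · exact absurd (Or.inr ⟨_, rfl⟩) hx
  · intro x hx
    simp only [Finset.mem_union, Finset.mem_image, Finset.mem_univ, true_and] at hx
    rcases hx with ⟨i, rfl⟩ | ⟨j, rfl⟩
    · rw [Inst.keyCounts, visibleKey_inl]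
      exact card_components_le (hz.2 (.inl i))
    · rw [Inst.keyCounts, visibleKey_inl]
      exact card_components_le (hz.2 (.inr j))

/-- Completeness: with one mark for every component the numbers of marks are the numbers of
components. -/
theorem ECMLC.Holds.exists_marked {φ : ECMLC dir p₀ q₀ r} {I : Inst dir p₀ q₀ r} (h : φ.Holds I) :
    ∃ z : Visible φ.p₁ φ.q₁ I.G.n I.G.m, φ.Marked I z ∧ ∀ wV wE,
      φ.arith.Holds I.k (I.keyCounts (visibleKey wV wE z)) := by
  obtain ⟨X, Y, ha, hm⟩ := h
  choose mark hmark hcard using fun c => exists_allMarked (I.G.compGraph Y c) (I.G.compSet X Y c)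
  refine ⟨(Sum.elim X mark, Y), ⟨hm, hmark⟩, fun wV wE => ?_⟩
  convert ha using 1
  funext x
  cases x <;> simp only [Inst.counts, Inst.keyCounts, visibleKey_inl, visibleKey_inr, Sum.elim_inl,
    Sum.elim_inr, hcard] <;> rfl

/-- The things that get a weight: a vertex or an edge and one of the sets. -/
abbrev Item (p₁ q₁ n m : ℕ) : Type := Fin n × VSym p₁ q₁ ⊕ Fin m × Fin q₁

/-- The items that belong to a choice of the visible sets. -/
def Visible.mem {n m : ℕ} (z : Visible p₁ q₁ n m) : Item p₁ q₁ n m → Bool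
  | .inl (v, i) => decide (v ∈ z.1 i)
  | .inr (e, j) => decide (e ∈ z.2 j)

theorem Visible.mem_injective {n m : ℕ} :
    Function.Injective (Visible.mem : Visible p₁ q₁ n m → Item p₁ q₁ n m → Bool) := by
  intro z z' h
  refine Prod.ext (funext fun i => Finset.ext fun v => ?_) (funext fun j => Finset.ext fun e => ?_)
  · simpa [Visible.mem] using congrFun h (.inl (v, i))
  · simpa [Visible.mem] using congrFun h (.inr (e, j))

theorem visibleKey_none {n m : ℕ} (w : Item p₁ q₁ n m → ℕ) (z : Visible p₁ q₁ n m) :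
    visibleKey (fun v i => w (.inl (v, i))) (fun e j => w (.inr (e, j))) z none =
      setWeight w z.mem := by
  rw [setWeight, Fintype.sum_sum_type, Fintype.sum_prod_type, Fintype.sum_prod_type]
  rfl

/-- All the keys are at most `R`. -/
def KeyBound (p₁ q₁ n m : ℕ) (w : Item p₁ q₁ n m → ℕ) (R : ℕ) : Prop :=
  n ≤ R ∧ m ≤ R ∧ ∑ u, w u ≤ R

theorem KeyBound.le {n m R : ℕ} {w : Item p₁ q₁ n m → ℕ} (h : KeyBound p₁ q₁ n m w R)
    (z : Visible p₁ q₁ n m) (k : KeySym p₁ q₁) :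
    visibleKey (fun v i => w (.inl (v, i))) (fun e j => w (.inr (e, j))) z k ≤ R := by
  rcases k with _ | i | j
  · rw [visibleKey_none]
    exact le_trans (Finset.sum_le_sum fun u _ => by split <;> omega) h.2.2
  · rw [visibleKey_inl]
    exact (Finset.card_le_univ _).trans (by simpa using h.1)
  · rw [visibleKey_inr]
    exact (Finset.card_le_univ _).trans (by simpa using h.2.1)

/-- The values of the keys in a row of the final table. -/
noncomputable def rowKeys {R : ℕ} (x : Fin (numKeys p₁ q₁) → ZMod (R + 1)) (k : KeySym p₁ q₁) : ℕ :=
  (x (keyIdx p₁ q₁ k)).val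

/-- The modulus `R + 1` exceeds all the keys, so that they can be recovered from their residues. -/
theorem rowKeys_eq {n m R : ℕ} {w : Item p₁ q₁ n m → ℕ} (h : KeyBound p₁ q₁ n m w R)
    (z : Visible p₁ q₁ n m) :
    rowKeys (fun k => (visibleKey (fun v i => w (.inl (v, i))) (fun e j => w (.inr (e, j))) z
      ((keyIdx p₁ q₁).symm k) : ZMod (R + 1))) =
      visibleKey (fun v i => w (.inl (v, i))) (fun e j => w (.inr (e, j))) z := by
  funext k
  rw [rowKeys, Equiv.symm_apply_apply, ZMod.val_natCast_of_lt (Nat.lt_succ_of_le (h.le z k))]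

/-- The local counting problem for given weights of the items. -/
noncomputable abbrev LocalSystem.weighted (L : LocalSystem (XSym p₀ p₁ q₁) (Fin q₀ ⊕ Fin q₁))
    (I : Inst dir p₀ q₀ r) (w : Item p₁ q₁ I.G.n I.G.m → ℕ) (R : ℕ) :
    LocalProblem L.VLabel (Fin q₀ ⊕ Fin q₁ → Bool) L.M I.G.n I.G.m (numKeys p₁ q₁) R :=
  L.problem I (fun v i => w (.inl (v, i))) (fun e j => w (.inr (e, j))) R

/-- Some row of the final table has keys that satisfy the arithmetic part of the formula. -/
def ECMLC.Accepts (φ : ECMLC dir p₀ q₀ r)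
    (L : LocalSystem (XSym p₀ φ.p₁ φ.q₁) (Fin q₀ ⊕ Fin φ.q₁)) (I : Inst dir p₀ q₀ r)
    (ord : List (Fin I.G.n)) (w : Item φ.p₁ φ.q₁ I.G.n I.G.m → ℕ) (R : ℕ) : Prop :=
  ∃ x ∈ (L.weighted I w R).result ord, φ.arith.Holds I.k (I.keyCounts (rowKeys x.2))

/-- The choices of the visible sets that satisfy the modal formula, mark every component and have
the same cardinalities as `z₀`. -/
noncomputable def ECMLC.family (φ : ECMLC dir p₀ q₀ r) (I : Inst dir p₀ q₀ r)
    (z₀ : Visible φ.p₁ φ.q₁ I.G.n I.G.m) : Finset (Visible φ.p₁ φ.q₁ I.G.n I.G.m) := by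
  classical
  exact Finset.univ.filter fun z => φ.Marked I z ∧ (∀ i, (z.1 i).card = (z₀.1 i).card) ∧
    ∀ j, (z.2 j).card = (z₀.2 j).card

open Classical in
/-- The decision rule is sound for all weights, and it is complete for the weights that isolate a
member of a certain nonempty family: a solution that is unique for its key is counted an odd number
of times. -/
theorem ECMLC.exists_accepts (φ : ECMLC dir p₀ q₀ r) :
    ∃ L : LocalSystem (XSym p₀ φ.p₁ φ.q₁) (Fin q₀ ⊕ Fin φ.q₁), ∀ (I : Inst dir p₀ q₀ r)
      (ord : List (Fin I.G.n)), ord.Nodup → (∀ v, v ∈ ord) →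
      (∀ w R, KeyBound φ.p₁ φ.q₁ I.G.n I.G.m w R → φ.Accepts L I ord w R → φ.Holds I) ∧
      (φ.Holds I → ∃ F : Finset (Visible φ.p₁ φ.q₁ I.G.n I.G.m), F.Nonempty ∧
        ∀ w R, KeyBound φ.p₁ φ.q₁ I.G.n I.G.m w R → Isolated F Visible.mem w →
          φ.Accepts L I ord w R) := by
  obtain ⟨L, hL⟩ := φ.exists_localSystem
  refine ⟨L, fun I ord hord hord' => ⟨fun w R hR hacc => ?_, fun h => ?_⟩⟩
  · obtain ⟨x, hx, ha⟩ := hacc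
    rw [LocalProblem.mem_result_iff _ I.G.loopless hord hord', hL] at hx
    obtain ⟨z, hz⟩ := Finset.card_pos.1 hx.2.pos
    simp only [Finset.mem_filter, Finset.mem_univ, true_and] at hz
    rw [← hz.2, rowKeys_eq hR] at ha
    exact hz.1.holds ha
  · obtain ⟨z₀, hz₀, ha⟩ := h.exists_marked
    refine ⟨φ.family I z₀, ⟨z₀, by simp [family, hz₀]⟩, fun w R hR hw => ?_⟩
    obtain ⟨z, hz, hiso⟩ := hw
    simp only [family, Finset.mem_filter, Finset.mem_univ, true_and] at hz hiso
    refine ⟨(0, fun k => (visibleKey (fun v i => w (.inl (v, i))) (fun e j => w (.inr (e, j))) z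
      ((keyIdx φ.p₁ φ.q₁).symm k) : ZMod (R + 1))), ?_, ?_⟩
    · rw [LocalProblem.mem_result_iff _ I.G.loopless hord hord', hL]
      refine ⟨rfl, ?_⟩
      rw [Finset.card_eq_one.2 ⟨z, ?_⟩]
      · exact odd_one
      · ext z'
        simp only [Finset.mem_filter, Finset.mem_univ, true_and, Finset.mem_singleton]
        refine ⟨fun h' => ?_, ?_⟩
        · have hk := congrArg rowKeys h'.2
          rw [rowKeys_eq hR, rowKeys_eq hR] at hk
          refine hiso z' ⟨h'.1, fun i => ?_, fun j => ?_⟩ ?_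
          · have := congrFun hk (some (.inl i))
            rw [visibleKey_inl, visibleKey_inl] at this
            rw [this, hz.2.1]
          · have := congrFun hk (some (.inr j))
            rw [visibleKey_inr, visibleKey_inr] at this
            rw [this, hz.2.2]
          · have := congrFun hk none
            rwa [visibleKey_none, visibleKey_none] at this
        · rintro rfl
          exact ⟨hz.1, rfl⟩
    · rw [rowKeys_eq hR]
      have := ha (fun v i => w (.inl (v, i))) (fun e j => w (.inr (e, j)))
      have e : I.keyCounts (visibleKey (fun v i => w (.inl (v, i))) (fun e j => w (.inr (e,
          j))) z) =
          I.keyCounts (visibleKey (fun v i => w (.inl (v, i))) (fun e j => w (.inr (e, j))) z₀) :=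
              by
        funext x
        cases x <;> simp only [Inst.keyCounts, visibleKey_inl, visibleKey_inr, hz.2.1, hz.2.2]
      rwa [e]

end

/-! ### Counting components by merging labels -/

section

variable {n : ℕ}

/-- The labels `c` after the classes of the ends of an edge are merged. -/
def mergeStep (c : Fin n → Fin n) (e : Fin n × Fin n) : Fin n → Fin n := fun w =>
  if c w = c e.1 then c e.2 else c w

/-- The labels after the classes of the ends of all the edges of `l` are merged, starting from a
different label for every vertex. -/
def mergeAll (l : List (Fin n × Fin n)) : Fin n → Fin n := l.foldl mergeStep fun v => v

theorem mergeAll_concat (l : List (Fin n × Fin n)) (e : Fin n × Fin n) (w : Fin n) :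
    mergeAll (l ++ [e]) w = if mergeAll l w = mergeAll l e.1 then mergeAll l e.2 else mergeAll l w
        := by
  rw [mergeAll, List.foldl_append]
  rfl

theorem mergeAll_edge {l : List (Fin n × Fin n)} {e : Fin n × Fin n} (he : e ∈ l) :
    mergeAll l e.1 = mergeAll l e.2 := by
  induction l using List.reverseRecOn with
  | nil => simp at he
  | append_singleton l e' ih =>
    rw [mergeAll_concat, mergeAll_concat]
    rcases List.mem_append.1 he with he | he
    · rw [ih he]
    · rw [List.mem_singleton.1 he, if_pos rfl]
      split <;> rfl

/-- Vertices get the same label only if they are equivalent for every equivalence relation that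
contains the edges. -/
theorem mergeAll_sound {l : List (Fin n × Fin n)} (s : Setoid (Fin n)) (hs : ∀ e ∈ l, s e.1 e.2)
    {v w : Fin n} (h : mergeAll l v = mergeAll l w) : s v w := by
  induction l using List.reverseRecOn generalizing v w with
  | nil =>
    obtain rfl : v = w := h
    exact s.refl v
  | append_singleton l e ih =>
    have ih : ∀ {v w}, mergeAll l v = mergeAll l w → s v w :=
      ih fun e he => hs e (List.mem_append_left _ he)
    have he : s e.1 e.2 := hs e (by simp)
    rw [mergeAll_concat, mergeAll_concat] at h
    split at h <;> split at h
    · rename_i h1 h2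
      exact ih (h1.trans h2.symm)
    · rename_i h1 h2
      exact s.trans (ih h1) (s.trans he (ih h))
    · rename_i h1 h2
      exact s.trans (ih h) (s.trans (s.symm he) (s.symm (ih h2)))
    · exact ih h

theorem card_components_eq {H : SimpleGraph (Fin n)} {A : Finset (Fin n)} {c : Fin n → Fin n}
    (h : ∀ v w : (A : Set (Fin n)), (H.induce (A : Set (Fin n))).Reachable v w ↔ c v = c w) :
    Nat.card (H.induce (A : Set (Fin n))).ConnectedComponent = (A.image c).card := by
  let f : (H.induce (A : Set (Fin n))).ConnectedComponent → (A.image c) := fun C =>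
    C.lift (fun v : (A : Set (Fin n)) => (⟨c v, Finset.mem_image_of_mem c v.2⟩ : A.image c)) fun v w
        p _ =>
      Subtype.ext ((h v w).1 ⟨p⟩)
  have hf : Function.Bijective f := by
    constructor
    · intro C C'
      induction C using SimpleGraph.ConnectedComponent.ind with
      | h v =>
        induction C' using SimpleGraph.ConnectedComponent.ind with
        | h w =>
          intro e
          exact SimpleGraph.ConnectedComponent.sound ((h v w).2 (congrArg Subtype.val e))
    · rintro ⟨y, hy⟩
      obtain ⟨v, hv, rfl⟩ := Finset.mem_image.1 hy
      exact ⟨(H.induce (A : Set (Fin n))).connectedComponentMk ⟨v, hv⟩, rfl⟩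
  rw [Nat.card_eq_of_bijective f hf, Nat.card_eq_fintype_card, Fintype.card_coe]

/-- Merging the ends of the edges of the induced graph finds its components. -/
theorem card_components_mergeAll {H : SimpleGraph (Fin n)} {A : Finset (Fin n)}
    {l : List (Fin n × Fin n)}
    (hl : ∀ v w, v ∈ A → w ∈ A → (H.Adj v w ↔ (v, w) ∈ l ∨ (w, v) ∈ l))
    (hlA : ∀ e ∈ l, e.1 ∈ A ∧ e.2 ∈ A) :
    Nat.card (H.induce (A : Set (Fin n))).ConnectedComponent = (A.image (mergeAll l)).card := by
  refine card_components_eq fun v w => ⟨?_, fun h => ?_⟩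
  · rintro ⟨p⟩
    induction p with
    | nil => rfl
    | @cons u v w huv _ ih =>
      rw [← ih]
      rcases (hl u v u.2 v.2).1 (by simpa using huv) with h | h
      exacts [mergeAll_edge h, (mergeAll_edge h).symm]
  · let s : Setoid (Fin n) :=
      { r := fun v w => v = w ∨ ∃ (hv : v ∈ A) (hw : w ∈ A),
          (H.induce (A : Set (Fin n))).Reachable ⟨v, hv⟩ ⟨w, hw⟩
        iseqv := by
          refine ⟨fun v => Or.inl rfl, ?_, ?_⟩
          · rintro v w (rfl | ⟨hv, hw, h⟩)
            exacts [Or.inl rfl, Or.inr ⟨hw, hv, h.symm⟩]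
          · rintro v w x (rfl | ⟨hv, hw, h⟩) (rfl | ⟨hw', hx, h'⟩)
            exacts [Or.inl rfl, Or.inr ⟨hw', hx, h'⟩, Or.inr ⟨hv, hw, h⟩,
              Or.inr ⟨hv, hx, h.trans h'⟩] }
    have hs : ∀ e ∈ l, s e.1 e.2 := fun e he =>
      Or.inr ⟨(hlA e he).1, (hlA e he).2, SimpleGraph.Adj.reachable
        (by simpa using (hl _ _ (hlA e he).1 (hlA e he).2).2 (Or.inl he))⟩
    rcases mergeAll_sound s hs h with h | ⟨_, _, h⟩
    · rw [Subtype.ext h]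
    · exact h

end

namespace FinGraph

variable {dir : Bool} (G : FinGraph dir)

/-- The components of an induced subgraph, in a form that can be computed. -/
theorem ccV_eq (X : Finset (Fin G.n)) : G.ccV X =
    (X.image (mergeAll ((List.ofFn G.ends).filter fun e => decide (e.1 ∈ X) && decide
        (e.2 ∈ X)))).card := by
  refine card_components_mergeAll (fun v w hv hw => ?_) fun e he => by
    simpa using (List.mem_filter.1 he).2
  rw [toSimpleGraph, edgeGraph_adj]
  simp only [Set.mem_univ, true_and, Joins, List.mem_filter, List.mem_ofFn, hv, hw, decide_true,
    Bool.and_self, and_true]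
  exact exists_or

/-- The components of the graph formed by a set of edges, in a form that can be computed. -/
theorem ccE_eq (Y : Finset (Fin G.m)) : G.ccE Y =
    ((Finset.univ.filter fun v => ∃ e ∈ Y, (G.ends e).1 = v ∨ (G.ends e).2 = v).image
      (mergeAll (((List.finRange G.m).filter (· ∈ Y)).map G.ends))).card := by
  have : G.endpoints (Y : Set (Fin G.m)) =
      ((Finset.univ.filter fun v => ∃ e ∈ Y, (G.ends e).1 = v ∨ (G.ends e).2 = v :
        Finset (Fin G.n)) : Set (Fin G.n)) := by
    ext v; simp [endpoints]
  rw [ccE, this]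
  refine card_components_mergeAll (fun v w _ _ => ?_) fun e he => ?_
  · rw [edgeGraph_adj]
    simp only [Joins, List.mem_map, List.mem_filter, List.mem_finRange, true_and,
      decide_eq_true_eq, Finset.mem_coe]
    rw [← exists_or]
    exact exists_congr fun e => and_or_left
  · obtain ⟨e', he', rfl⟩ := List.mem_map.1 he
    have := (List.mem_filter.1 he').2
    simp only [decide_eq_true_eq] at this
    simp only [Finset.mem_filter, Finset.mem_univ, true_and]
    exact ⟨⟨e', this, Or.inl rfl⟩, ⟨e', this, Or.inr rfl⟩⟩

end FinGraph

/-! ### Sets, sums and components are feasible -/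

namespace Feas

variable {S : Type} {κ : Scale S} {a : S → Data} {n : S → ℕ}

theorem finEq {i j : ∀ s, Fin (n s)} (hi : Feas κ a fun s => .ofFin (i s))
    (hj : Feas κ a fun s => .ofFin (j s)) : Feas κ a fun s => .ofBool (decide (i s = j s)) :=
  (hi.eq (x := fun s => ((i s : ℕ) : ℤ)) (y := fun s => ((j s : ℕ) : ℤ)) hj).congr fun s => by
    simp only [Nat.cast_inj, Fin.ext_iff]

theorem mem {l : ∀ s, List (Fin (n s))} {i : ∀ s, Fin (n s)}
    (hlen : PolyBdd κ.time fun s => (l s).length) (hl : Feas κ a fun s => .ofList Data.ofFin (l s))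
    (hi : Feas κ a fun s => .ofFin (i s)) : Feas κ a fun s => .ofBool (decide (i s ∈ l s)) := by
  have heq : Feas (κ.pull (Entry.s : Entry l → S)) (fun q => .pair (.ofFin q.x) (a q.s))
      fun q => .ofBool (decide (q.x = i q.s)) :=
    finEq (n := fun q : Entry l => n q.s) (i := fun q => q.x) var0 (hi.pull _).weaken
  refine (any (eα := fun _ => Data.ofFin) (p := fun s x => decide (x = i s)) hlen hl heq).congr
    fun s => ?_
  congr 1
  rw [Bool.eq_iff_iff]
  simp

theorem memFinset {X : ∀ s, Finset (Fin (n s))} {i : ∀ s, Fin (n s)} (hn : Modest κ n)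
    (hX : Feas κ a fun s => .ofFinset (X s)) (hi : Feas κ a fun s => .ofFin (i s)) :
    Feas κ a fun s => .ofBool (decide (i s ∈ X s)) :=
  (mem (l := fun s => (List.finRange (n s)).filter (· ∈ X s))
    (hn.1.mono fun s => (List.length_filter_le _ _).trans (by simp)) hX hi).congr fun s => by simp

theorem cardFinset {X : ∀ s, Finset (Fin (n s))} (hn : Modest κ n)
    (hX : Feas κ a fun s => .ofFinset (X s)) : Feas κ a fun s => .int ((X s).card : ℕ) := by
  have hlen := hn.mono (f := fun s => ((List.finRange (n s)).filter (· ∈ X s)).length)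
    fun s => (List.length_filter_le _ _).trans (by simp)
  refine (length (α := fun s => Fin (n s)) (eα := fun _ => Data.ofFin) hlen.1 hlen.2 hX).congr
    fun s => ?_
  rw [← List.toFinset_card_of_nodup ((List.nodup_finRange _).filter _)]
  congr 3
  ext v
  simp

/-- A list of constant length. -/
theorem listConst {C : Type} {β : S → Type} {eβ : ∀ s, β s → Data} (l : List C)
    {f : ∀ s, C → β s} (h : ∀ c ∈ l, Feas κ a fun s => eβ s (f s c)) :
    Feas κ a fun s => .ofList (eβ s) (l.map (f s)) := by
  induction l with
  | nil => exact int 0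
  | cons c l ih =>
    exact (h c List.mem_cons_self).pair (ih fun c hc => h c (List.mem_cons_of_mem _ hc))

/-- A selection from a list of constant length. -/
theorem listConstFilter {C : Type} {β : S → Type} {eβ : ∀ s, β s → Data} (l : List C)
    {p : S → C → Bool} {f : ∀ s, C → β s} (hp : ∀ c ∈ l, Feas κ a fun s => .ofBool (p s c))
    (h : ∀ c ∈ l, Feas κ a fun s => eβ s (f s c)) :
    Feas κ a fun s => .ofList (eβ s) ((l.filter (p s)).map (f s)) := by
  induction l with
  | nil => exact int 0
  | cons c l ih =>
    have ih := ih (fun c hc => hp c (List.mem_cons_of_mem _ hc))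
      fun c hc => h c (List.mem_cons_of_mem _ hc)
    refine ((hp c List.mem_cons_self).ite' ((h c List.mem_cons_self).pair ih) ih).congr fun s => ?_
    rw [List.filter_cons]
    cases p s c <;> rfl

theorem vecConst {r : ℕ} {β : S → Type} {eβ : ∀ s, β s → Data} {f : ∀ s, Fin r → β s}
    (h : ∀ j, Feas κ a fun s => eβ s (f s j)) : Feas κ a fun s => .ofVec (eβ s) (f s) :=
  (listConst (List.finRange r) fun j _ => h j).congr fun s => by
    rw [Data.ofVec, List.ofFn_eq_map]

/-- A sum of constantly many terms. -/
theorem natSum {ι : Type} (t : Finset ι) {f : ι → S → ℕ} (h : ∀ i ∈ t, Feas κ a fun s => .int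
    (f i s))
    (hb : PolyBdd κ.word fun s => ∑ i ∈ t, f i s) :
    Feas κ a fun s => .int (∑ i ∈ t, f i s : ℕ) := by
  classical
  induction t using Finset.induction_on with
  | empty => exact (int 0).congr fun s => by simp
  | insert i t hi ih =>
    have hle : PolyBdd κ.word fun s => ∑ i ∈ t, f i s :=
      hb.mono fun s => by rw [Finset.sum_insert hi]; omega
    refine ((h i (Finset.mem_insert_self _ _)).add (ih (fun i hi => h i
        (Finset.mem_insert_of_mem hi))
      hle) (hb.mono fun s => ?_)).congr fun s => ?_
    · rw [Finset.sum_insert hi]; omega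
    · rw [Finset.sum_insert hi]; push_cast; rfl

theorem mergeAll {l : ∀ s, List (Fin (n s) × Fin (n s))} (hn : Modest κ n)
    (h : Feas κ a fun s => .int (n s)) (hlen : PolyBdd κ.time fun s => (l s).length)
    (hl : Feas κ a fun s => .ofList (fun e => .pair (.ofFin e.1) (.ofFin e.2)) (l s)) :
    Feas κ a fun s => .ofVec Data.ofFin (_root_.mergeAll (l s)) := by
  have hid : Feas κ a fun s => .ofVec Data.ofFin fun v : Fin (n s) => v :=
    ofFn (β := fun s => Fin (n s)) (eβ := fun _ => Data.ofFin) (x := fun _ v => v) hn h var0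
  refine foldl' (α := fun s => Fin (n s) × Fin (n s))
    (eα := fun _ e => .pair (.ofFin e.1) (.ofFin e.2)) (β := fun s => Fin (n s) → Fin (n s))
    (eβ := fun _ => .ofVec Data.ofFin) (init := fun _ v => v) (step := fun _ => mergeStep)
    hlen hl hid ?_
  set F := Frame (β := fun s => Fin (n s) → Fin (n s)) l (fun _ _ _ => True)
  have hn' : Modest (κ.pull (Frame.s : F → S)) fun q => n q.s := hn.pull _
  have hn'' : Modest ((κ.pull (Frame.s : F → S)).pull (Idx.s : Idx (fun q : F => n q.s) → F))
    fun i => n i.s.s := hn'.pull _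
  refine ofFn (β := fun q : F => Fin (n q.s)) (eβ := fun _ => Data.ofFin) (n := fun q : F => n q.s)
    (x := fun q => mergeStep q.b q.x) hn' (h.pull Frame.s).weaken.weaken ?_
  -- the environment holds a vertex, the edge, and the labels
  let env : Idx (fun q : F => n q.s) → Data := fun i => .pair (.ofFin i.i)
    (.pair (.pair (.ofFin i.s.x.1) (.ofFin i.s.x.2)) (.pair (.ofVec Data.ofFin i.s.b) (a i.s.s)))
  have hv : Feas ((κ.pull (Frame.s : F → S)).pull (Idx.s : Idx (fun q : F => n q.s) → F)) env
    fun i => .ofFin i.i := var0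
  have he : Feas ((κ.pull (Frame.s : F → S)).pull (Idx.s : Idx (fun q : F => n q.s) → F)) env
    fun i => .pair (.ofFin i.s.x.1) (.ofFin i.s.x.2) := var0.weaken
  have hc : Feas ((κ.pull (Frame.s : F → S)).pull (Idx.s : Idx (fun q : F => n q.s) → F)) env
    fun i => .ofVec Data.ofFin i.s.b := var0.weaken.weaken
  have hcv := get (n := fun i : Idx (fun q : F => n q.s) => n i.s.s) (β := fun i => Fin (n i.s.s))
    (eβ := fun _ => Data.ofFin) (x := fun i => i.s.b) (i := fun i => i.i) hn'' hc hv
  have hc1 := get (n := fun i : Idx (fun q : F => n q.s) => n i.s.s) (β := fun i => Fin (n i.s.s))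
    (eβ := fun _ => Data.ofFin) (x := fun i => i.s.b) (i := fun i => i.s.x.1) hn'' hc he.fst
  have hc2 := get (n := fun i : Idx (fun q : F => n q.s) => n i.s.s) (β := fun i => Fin (n i.s.s))
    (eβ := fun _ => Data.ofFin) (x := fun i => i.s.b) (i := fun i => i.s.x.2) hn'' hc he.snd
  refine ((finEq (n := fun i : Idx (fun q : F => n q.s) => n i.s.s) (i := fun i => i.s.b i.i)
    (j := fun i => i.s.b i.s.x.1) hcv hc1).ite' hc2 hcv).congr fun i => ?_
  rw [mergeStep]
  by_cases h : i.s.b i.i = i.s.b i.s.x.1 <;> simp [h]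

/-- The number of the labels of the vertices in `A`. -/
theorem cardImage {A : ∀ s, Finset (Fin (n s))} {c : ∀ s, Fin (n s) → Fin (n s)} (hn : Modest κ n)
    (h : Feas κ a fun s => .int (n s)) (hc : Feas κ a fun s => .ofVec Data.ofFin (c s))
    (hA : Feas (κ.pull (Idx.s : Idx n → S)) (fun q => .pair (.ofFin q.i) (a q.s))
      fun q => .ofBool (decide (q.i ∈ A q.s))) :
    Feas κ a fun s => .int (((A s).image (c s)).card : ℕ) := by
  set F := Entry fun s => List.finRange (n s)
  have hhit : Feas (κ.pull (Entry.s : F → S)) (fun q => .pair (.ofFin q.x) (a q.s))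
      fun q => .ofBool (decide (∃ v, (decide (v ∈ A q.s) && decide (c q.s v = q.x)) = true)) := by
    have hn' : Modest (κ.pull (Entry.s : F → S)) fun q => n q.s := hn.pull _
    refine anyFin (n := fun q : F => n q.s) hn' (h.pull Entry.s).weaken ?_
    let env : Idx (fun q : F => n q.s) → Data := fun i => .pair (.ofFin i.i)
      (.pair (.ofFin i.s.x) (a i.s.s))
    have hx : Feas ((κ.pull (Entry.s : F → S)).pull (Idx.s : Idx (fun q : F => n q.s) → F)) env
      fun i => .ofFin i.s.x := var0.weaken
    have hv : Feas ((κ.pull (Entry.s : F → S)).pull (Idx.s : Idx (fun q : F => n q.s) → F)) env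
      fun i => .ofFin i.i := var0
    have hmem : Feas ((κ.pull (Entry.s : F → S)).pull (Idx.s : Idx (fun q : F => n q.s) → F)) env
      fun i => .ofBool (decide (i.i ∈ A i.s.s)) :=
      (var0.pair id.weaken.weaken).comp
        (hA.pull fun i : Idx (fun q : F => n q.s) => (⟨i.s.s, i.i⟩ : Idx n))
    have hcF : Feas (κ.pull (Entry.s : F → S)) (fun q => .pair (.ofFin q.x) (a q.s))
      fun q => .ofVec Data.ofFin (c q.s) := (hc.pull Entry.s).weaken
    have hc' : Feas ((κ.pull (Entry.s : F → S)).pull (Idx.s : Idx (fun q : F => n q.s) → F)) env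
      fun i => .ofVec Data.ofFin (c i.s.s) := (hcF.pull Idx.s).weaken
    have hcv := get (n := fun i : Idx (fun q : F => n q.s) => n i.s.s) (β := fun i => Fin (n i.s.s))
      (eβ := fun _ => Data.ofFin) (x := fun i => c i.s.s) (i := fun i => i.i) (hn'.pull _) hc' hv
    exact hmem.and (finEq (n := fun i : Idx (fun q : F => n q.s) => n i.s.s)
      (i := fun i => c i.s.s i.i) (j := fun i => i.s.x) hcv hx)
  have hfilter := filter (α := fun s => Fin (n s)) (eα := fun _ => Data.ofFin)
    (l := fun s => List.finRange (n s))
    (p := fun s x => decide (∃ v, (decide (v ∈ A s) && decide (c s v = x)) = true))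
    (hn.1.mono (by simp)) (finRange hn.1 hn.2 h) hhit
  have hlen := hn.mono (f := fun s => ((List.finRange (n s)).filter fun x =>
    decide (∃ v, (decide (v ∈ A s) && decide (c s v = x)) = true)).length)
    fun s => (List.length_filter_le _ _).trans (by simp)
  refine (length (α := fun s => Fin (n s)) (eα := fun _ => Data.ofFin) hlen.1 hlen.2 hfilter).congr
    fun s => ?_
  rw [← List.toFinset_card_of_nodup ((List.nodup_finRange _).filter _)]
  congr 3
  ext v
  simp

end Feas

/-! ### Arithmetic formulas and elimination orders are feasible -/

namespace Feas

variable {S : Type} {κ : Scale S} {a : S → Data}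

section Arithmetic

variable {r : ℕ} {C : Type} {k : S → Fin r → ℤ} {c : S → C → ℕ}

theorem arTerm (hk : ∀ i, Feas κ a fun s => .int (k s i))
    (hk' : ∀ i, PolyBdd κ.word fun s => (k s i).natAbs) (hc : ∀ x, Feas κ a fun s => .int (c s x))
    (hc' : ∀ x, PolyBdd κ.word fun s => c s x) (t : ArTerm r C) :
    Feas κ a (fun s => .int (t.eval (k s) (c s))) ∧
      PolyBdd κ.word fun s => (t.eval (k s) (c s)).natAbs := by
  induction t with
  | const z => exact ⟨int z, .const κ.two_le_word z.natAbs⟩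
  | param i => exact ⟨hk i, hk' i⟩
  | count x => exact ⟨hc x, (hc' x).mono fun s => by simp [ArTerm.eval]⟩
  | add s t hs ht =>
    have hb := (hs.2.add κ.two_le_word ht.2).mono fun x => Int.natAbs_add_le _ _
    exact ⟨hs.1.add ht.1 hb, hb⟩
  | sub s t hs ht =>
    have hb := (hs.2.add κ.two_le_word ht.2).mono fun x => Int.natAbs_sub_le _ _
    exact ⟨hs.1.sub ht.1 hb, hb⟩
  | mul s t hs ht =>
    have hb := (hs.2.mul ht.2).mono fun x => (Int.natAbs_mul _ _).le
    exact ⟨hs.1.mul ht.1 hb, hb⟩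

open Classical in
/-- An arithmetic formula is fixed, so that it is evaluated in a constant number of operations, on
integers polynomial in those given. -/
theorem arFormula (hk : ∀ i, Feas κ a fun s => .int (k s i))
    (hk' : ∀ i, PolyBdd κ.word fun s => (k s i).natAbs) (hc : ∀ x, Feas κ a fun s => .int (c s x))
    (hc' : ∀ x, PolyBdd κ.word fun s => c s x) (φ : ArFormula r C) :
    Feas κ a fun s => .ofBool (decide (φ.Holds (k s) (c s))) := by
  have ht := fun t => (arTerm hk hk' hc hc' t).1
  induction φ with
  | eq s t => exact ((ht s).eq (ht t)).congr fun x => by congr 2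
  | le s t => exact ((ht s).le (ht t)).congr fun x => by congr 2
  | lt s t => exact ((ht s).lt (ht t)).congr fun x => by congr 2
  | neg φ ih =>
    refine ih.not.congr fun x => congrArg _ ?_
    rw [Bool.eq_iff_iff, decide_eq_true_iff, ArFormula.Holds]
    simp
  | and φ χ ih ih' =>
    refine (ih.and ih').congr fun x => congrArg _ ?_
    rw [Bool.eq_iff_iff, decide_eq_true_iff, ArFormula.Holds]
    simp
  | or φ χ ih ih' =>
    refine (ih.or ih').congr fun x => congrArg _ ?_
    rw [Bool.eq_iff_iff, decide_eq_true_iff, ArFormula.Holds]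
    simp

end Arithmetic

section Order

variable {n N : S → ℕ} {bag : ∀ s, Fin (N s) → Finset (Fin (n s))}

/-- The bags and the list of the vertices that are already eliminated are available. -/
structure Bags (κ : Scale S) (a : S → Data) (bag : ∀ s, Fin (N s) → Finset (Fin (n s)))
    (done : ∀ s, List (Fin (n s))) : Prop where
  hn : Modest κ n
  hN : Modest κ N
  n : Feas κ a fun s => .int (n s)
  N : Feas κ a fun s => .int (N s)
  bag : Feas κ a fun s => .ofVec Data.ofFinset (bag s)
  len : PolyBdd κ.time fun s => (done s).length
  done : Feas κ a fun s => .ofList Data.ofFin (done s)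

variable {done : ∀ s, List (Fin (n s))}

theorem Bags.pull {S' : Type} (h : Bags κ a bag done) (π : S' → S) :
    Bags (κ.pull π) (fun s => a (π s)) (fun s => bag (π s)) fun s => done (π s) :=
  ⟨h.hn.pull π, h.hN.pull π, h.n.pull π, h.N.pull π, h.bag.pull π, h.len.pull π, h.done.pull π⟩

theorem Bags.weaken {f : S → Data} (h : Bags κ a bag done) :
    Bags κ (fun s => .pair (f s) (a s)) bag done :=
  ⟨h.hn, h.hN, h.n.weaken, h.N.weaken, h.bag.weaken, h.len, h.done.weaken⟩

theorem Bags.mem {x : ∀ s, Fin (N s)} {v : ∀ s, Fin (n s)} (h : Bags κ a bag done)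
    (hx : Feas κ a fun s => .ofFin (x s)) (hv : Feas κ a fun s => .ofFin (v s)) :
    Feas κ a fun s => .ofBool (decide (v s ∈ bag s (x s))) :=
  memFinset h.hn (get (β := fun s => Finset (Fin (n s))) (eβ := fun _ => Data.ofFinset) h.hN h.bag
    hx) hv

theorem Bags.subset {x y : ∀ s, Fin (N s)} (h : Bags κ a bag done)
    (hx : Feas κ a fun s => .ofFin (x s)) (hy : Feas κ a fun s => .ofFin (y s)) :
    Feas κ a fun s => .ofBool (decide (∀ u, (!decide (u ∈ bag s (y s)) ||
      (decide (u ∈ done s) || decide (u ∈ bag s (x s)))) = true)) := by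
  have h' : Bags (κ.pull (Idx.s : Idx n → S)) (fun q => .pair (.ofFin q.i) (a q.s))
    (fun q => bag q.s) fun q => done q.s := (h.pull Idx.s).weaken
  have hu : Feas (κ.pull (Idx.s : Idx n → S)) (fun q => .pair (.ofFin q.i) (a q.s))
    fun q => .ofFin q.i := var0
  have hx' : Feas (κ.pull (Idx.s : Idx n → S)) (fun q => .pair (.ofFin q.i) (a q.s))
    fun q => .ofFin (x q.s) := (hx.pull Idx.s).weaken
  have hy' : Feas (κ.pull (Idx.s : Idx n → S)) (fun q => .pair (.ofFin q.i) (a q.s))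
    fun q => .ofFin (y q.s) := (hy.pull Idx.s).weaken
  exact allFin h.hn h.n ((h'.mem hy' hu).not.or ((Feas.mem h'.len h'.done hu).or (h'.mem hx' hu)))

theorem Bags.covers {x : ∀ s, Fin (N s)} {v : ∀ s, Fin (n s)} (h : Bags κ a bag done)
    (hx : Feas κ a fun s => .ofFin (x s)) (hv : Feas κ a fun s => .ofFin (v s)) :
    Feas κ a fun s => .ofBool (decide (∀ y, (!decide (v s ∈ bag s y) ||
      decide (∀ u, (!decide (u ∈ bag s y) ||
        (decide (u ∈ done s) || decide (u ∈ bag s (x s)))) = true)) = true)) := by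
  have h' : Bags (κ.pull (Idx.s : Idx N → S)) (fun q => .pair (.ofFin q.i) (a q.s))
    (fun q => bag q.s) fun q => done q.s := (h.pull Idx.s).weaken
  have hy' : Feas (κ.pull (Idx.s : Idx N → S)) (fun q => .pair (.ofFin q.i) (a q.s))
    fun q => .ofFin q.i := var0
  have hx' : Feas (κ.pull (Idx.s : Idx N → S)) (fun q => .pair (.ofFin q.i) (a q.s))
    fun q => .ofFin (x q.s) := (hx.pull Idx.s).weaken
  have hv' : Feas (κ.pull (Idx.s : Idx N → S)) (fun q => .pair (.ofFin q.i) (a q.s))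
    fun q => .ofFin (v q.s) := (hv.pull Idx.s).weaken
  exact allFin h.hN h.N ((h'.mem hy' hv').not.or (h'.subset hx' hy'))

open Classical in
theorem Bags.simplicial {v : ∀ s, Fin (n s)} (h : Bags κ a bag done)
    (hv : Feas κ a fun s => .ofFin (v s)) :
    Feas κ a fun s => .ofBool (decide (Simplicial (bag s) (done s) (v s))) := by
  have h' : Bags (κ.pull (Idx.s : Idx N → S)) (fun q => .pair (.ofFin q.i) (a q.s))
    (fun q => bag q.s) fun q => done q.s := (h.pull Idx.s).weaken
  have hx' : Feas (κ.pull (Idx.s : Idx N → S)) (fun q => .pair (.ofFin q.i) (a q.s))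
    fun q => .ofFin q.i := var0
  have hv' : Feas (κ.pull (Idx.s : Idx N → S)) (fun q => .pair (.ofFin q.i) (a q.s))
    fun q => .ofFin (v q.s) := (hv.pull Idx.s).weaken
  have hany := anyFin (p := fun s x => decide (∀ y, (!decide (v s ∈ bag s y) ||
    decide (∀ u, (!decide (u ∈ bag s y) ||
      (decide (u ∈ done s) || decide (u ∈ bag s x))) = true)) = true)) h.hN h.N (h'.covers hx' hv')
  refine ((Feas.mem h.len h.done hv).not.and hany).congr
    fun s => ?_
  congr 1
  rw [Bool.eq_iff_iff, decide_eq_true_iff (p := Simplicial _ _ _), Simplicial]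
  simp only [Bool.and_eq_true, Bool.not_eq_true', decide_eq_false_iff_not,
    decide_eq_true_eq, Bool.or_eq_true, or_iff_not_imp_left]
  simp only [not_not]

/-- The order of elimination is found by trying all the vertices and all the bags at every step. -/
theorem elimOrder (hn : Modest κ n) (hN : Modest κ N) (h : Feas κ a fun s => .int (n s))
    (hN' : Feas κ a fun s => .int (N s)) (hbag : Feas κ a fun s => .ofVec Data.ofFinset (bag s)) :
    Feas κ a fun s => .ofList Data.ofFin (_root_.elimOrder (bag s)) := by
  classical
  have haux : Feas κ a fun s => .ofList Data.ofFin (elimOrderAux (bag s) (List.finRange (n s))) :=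
      by
    refine foldl (α := fun s => Fin (n s)) (eα := fun _ => Data.ofFin)
      (β := fun s => List (Fin (n s))) (eβ := fun _ => .ofList Data.ofFin)
      (l := fun s => List.finRange (n s)) (init := fun _ => [])
      (step := fun s done i => ((List.finRange (n s)).filter fun v =>
        decide (Simplicial (bag s) done v)).headD i :: done)
      (fun s pre done => done.length = pre.length) (by simp) (fun q => by simp [q.inv])
      (hn.1.mono (by simp)) (finRange hn.1 hn.2 h) (int 0) ?_
    set Inv : ∀ s, List (Fin (n s)) → List (Fin (n s)) → Prop :=
      fun s pre done => done.length = pre.length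
    set F := Frame (fun s => List.finRange (n s)) Inv
    have hn' : Modest (κ.pull (Frame.s : F → S)) fun q => n q.s := hn.pull _
    have hlen : PolyBdd (κ.pull (Frame.s : F → S)).time fun q => q.b.length := hn'.1.mono fun q =>
        by
      have h1 := congrArg List.length q.eq
      have h2 : q.b.length = q.pre.length := q.inv
      simp at h1
      omega
    let env : F → Data := fun q => .pair (.ofFin q.x) (.pair (.ofList Data.ofFin q.b) (a q.s))
    have hB : Bags (κ.pull (Frame.s : F → S)) env (fun q => bag q.s) fun q => q.b :=
      ⟨hn', hN.pull _, (h.pull Frame.s).weaken.weaken, (hN'.pull Frame.s).weaken.weaken,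
        (hbag.pull Frame.s).weaken.weaken, hlen, var0.weaken⟩
    have hfilter := filter (κ := κ.pull (Frame.s : F → S)) (a := env) (α := fun q => Fin (n q.s))
      (eα := fun _ => Data.ofFin) (l := fun q => List.finRange (n q.s))
      (p := fun q v => decide (Simplicial (bag q.s) q.b v)) (hn'.1.mono (by simp))
      (finRange hn'.1 hn'.2 hB.n) ((hB.pull Entry.s).weaken.simplicial var0)
    exact (headD (eα := fun q : F => Data.ofFin) hfilter var0).pair var0.weaken
  refine reverse (eα := fun _ => Data.ofFin) (hn.1.mono fun s => ?_) haux
  have : ∀ l : List (Fin (n s)), (elimOrderAux (bag s) l).length = l.length := by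
    intro l
    induction l using List.reverseRecOn with
    | nil => rfl
    | append_singleton l i ih =>
      rw [elimOrderAux, List.foldl_append, ← elimOrderAux]
      simp [ih]
  rw [this]
  simp

end Order

end Feas

/-! ### The input is feasible -/

/-- An instance with a tree decomposition. -/
structure AlgInput (dir : Bool) (p₀ q₀ r : ℕ) where
  I : Inst dir p₀ q₀ r
  T : TreeDecomp I.G

namespace AlgInput

variable {dir : Bool} {p₀ q₀ r : ℕ}

/-- The input of the algorithm, in the encodings that the statement prescribes. -/
def encode (s : AlgInput dir p₀ q₀ r) : Data := .pair s.I.encode s.T.encode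

theorem one_le_tree (s : AlgInput dir p₀ q₀ r) : 1 ≤ s.T.tree.n := by
  obtain ⟨x⟩ := s.T.isTree.1.nonempty
  exact Nat.one_le_iff_ne_zero.2 fun h => (Fin.cast h x).elim0

/-- The resources: `(c + 1) ^ width` times the size of the input for the time, the size of the input
and the parameters for the integers. -/
def scale (dir : Bool) (p₀ q₀ r c : ℕ) : Scale (AlgInput dir p₀ q₀ r) where
  time s := (c + 1) ^ s.T.width * (s.I.G.size + s.T.tree.n + 1)
  word s := s.I.G.size + s.T.tree.n + (∑ i, (s.I.k i).natAbs) + 1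
  two_le_time s := by
    have h1 := s.one_le_tree
    have h2 := Nat.one_le_pow s.T.width (c + 1) (by omega)
    nlinarith
  two_le_word s := by
    have h1 := s.one_le_tree
    omega

variable {c : ℕ}

theorem modest_size : Modest (scale dir p₀ q₀ r c) fun s => s.I.G.size + s.T.tree.n + 1 := by
  refine ⟨PolyBdd.base.mono fun s => ?_, PolyBdd.base.mono fun s => ?_⟩
  · exact Nat.le_mul_of_pos_left _ (Nat.pos_of_ne_zero (by simp))
  · change _ ≤ s.I.G.size + s.T.tree.n + (∑ i, (s.I.k i).natAbs) + 1
    omega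

theorem modest_n : Modest (scale dir p₀ q₀ r c) fun s => s.I.G.n :=
  modest_size.mono fun s => by rw [FinGraph.size]; omega

theorem modest_m : Modest (scale dir p₀ q₀ r c) fun s => s.I.G.m :=
  modest_size.mono fun s => by rw [FinGraph.size]; omega

theorem modest_N : Modest (scale dir p₀ q₀ r c) fun s => s.T.tree.n :=
  modest_size.mono fun s => by omega

theorem polyBdd_k (i : Fin r) : PolyBdd (scale dir p₀ q₀ r c).word fun s => (s.I.k i).natAbs :=
  PolyBdd.base.mono fun s => by
    change _ ≤ s.I.G.size + s.T.tree.n + (∑ i, (s.I.k i).natAbs) + 1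
    have := Finset.single_le_sum (f := fun i => (s.I.k i).natAbs) (fun _ _ => Nat.zero_le _)
      (Finset.mem_univ i)
    omega

theorem feas_graph : Feas (scale dir p₀ q₀ r c) encode fun s => s.I.G.encode :=
  Feas.id.fst (f := fun s : AlgInput dir p₀ q₀ r => s.I.encode) |>.fst

theorem feas_n : Feas (scale dir p₀ q₀ r c) encode fun s => .int s.I.G.n := feas_graph.fst

theorem feas_ends : Feas (scale dir p₀ q₀ r c) encode fun s =>
    .ofVec (fun e => .pair (.ofFin e.1) (.ofFin e.2)) s.I.G.ends := feas_graph.snd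

theorem feas_m : Feas (scale dir p₀ q₀ r c) encode fun s => .int s.I.G.m := by
  have hlen := (modest_m (dir := dir) (p₀ := p₀) (q₀ := q₀) (r := r) (c := c)).mono
    (f := fun s => (List.ofFn s.I.G.ends).length) fun s => by simp
  exact (Feas.length (α := fun s : AlgInput dir p₀ q₀ r => Fin s.I.G.n × Fin s.I.G.n)
    (eα := fun _ e => .pair (.ofFin e.1) (.ofFin e.2)) hlen.1 hlen.2 feas_ends).congr fun s =>
        by simp

theorem feas_FX (i : Fin p₀) : Feas (scale dir p₀ q₀ r c) encode fun s => .ofFinset (s.I.FX i) :=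
  Feas.get (n := fun _ => p₀) (β := fun s : AlgInput dir p₀ q₀ r => Finset (Fin s.I.G.n))
    (eβ := fun _ => Data.ofFinset) (x := fun s => s.I.FX) (i := fun _ => i) (.const _)
    (Feas.id.fst (f := fun s : AlgInput dir p₀ q₀ r => s.I.encode) |>.snd.fst) (Feas.const _)

theorem feas_FY (j : Fin q₀) : Feas (scale dir p₀ q₀ r c) encode fun s => .ofFinset (s.I.FY j) :=
  Feas.get (n := fun _ => q₀) (β := fun s : AlgInput dir p₀ q₀ r => Finset (Fin s.I.G.m))
    (eβ := fun _ => Data.ofFinset) (x := fun s => s.I.FY) (i := fun _ => j) (.const _)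
    (Feas.id.fst (f := fun s : AlgInput dir p₀ q₀ r => s.I.encode) |>.snd.snd.fst) (Feas.const _)

theorem feas_k (i : Fin r) : Feas (scale dir p₀ q₀ r c) encode fun s => .int (s.I.k i) :=
  Feas.get (n := fun _ => r) (β := fun _ : AlgInput dir p₀ q₀ r => ℤ)
    (eβ := fun _ => Data.int) (x := fun s => s.I.k) (i := fun _ => i) (.const _)
    (Feas.id.fst (f := fun s : AlgInput dir p₀ q₀ r => s.I.encode) |>.snd.snd.snd) (Feas.const _)

theorem feas_N : Feas (scale dir p₀ q₀ r c) encode fun s => .int s.T.tree.n :=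
  Feas.id.snd (g := fun s : AlgInput dir p₀ q₀ r => s.T.encode) |>.fst.fst

theorem feas_bag : Feas (scale dir p₀ q₀ r c) encode fun s => .ofVec Data.ofFinset s.T.bag :=
  Feas.id.snd (g := fun s : AlgInput dir p₀ q₀ r => s.T.encode) |>.snd

theorem feas_elimOrder : Feas (scale dir p₀ q₀ r c) encode fun s =>
    .ofList Data.ofFin (elimOrder s.T.bag) :=
  Feas.elimOrder modest_n modest_N feas_n feas_N feas_bag

theorem feas_cardFX (i : Fin p₀) :
    Feas (scale dir p₀ q₀ r c) encode fun s => .int ((s.I.FX i).card : ℕ) :=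
  Feas.cardFinset modest_n (feas_FX i)

theorem feas_cardFY (j : Fin q₀) :
    Feas (scale dir p₀ q₀ r c) encode fun s => .int ((s.I.FY j).card : ℕ) :=
  Feas.cardFinset modest_m (feas_FY j)

theorem feas_ccFX (i : Fin p₀) :
    Feas (scale dir p₀ q₀ r c) encode fun s => .int (s.I.G.ccV (s.I.FX i) : ℕ) := by
  set F := Feas.Entry fun s : AlgInput dir p₀ q₀ r => List.ofFn s.I.G.ends
  have hlen : PolyBdd (scale dir p₀ q₀ r c).time fun s => (List.ofFn s.I.G.ends).length :=
    modest_m.1.mono fun s => by simp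
  have hn : Modest ((scale dir p₀ q₀ r c).pull (Feas.Entry.s : F → _)) fun q => q.s.I.G.n :=
    modest_n.pull _
  let env : F → Data := fun q => .pair (.pair (.ofFin q.x.1) (.ofFin q.x.2)) q.s.encode
  have he : Feas ((scale dir p₀ q₀ r c).pull (Feas.Entry.s : F → _)) env
    fun q => .pair (.ofFin q.x.1) (.ofFin q.x.2) := Feas.var0
  have hX : Feas ((scale dir p₀ q₀ r c).pull (Feas.Entry.s : F → _)) env
    fun q => .ofFinset (q.s.I.FX i) := ((feas_FX i).pull Feas.Entry.s).weaken
  have hfilter := Feas.filter (α := fun s : AlgInput dir p₀ q₀ r => Fin s.I.G.n × Fin s.I.G.n)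
    (eα := fun _ e => .pair (.ofFin e.1) (.ofFin e.2))
    (p := fun s e => decide (e.1 ∈ s.I.FX i) && decide (e.2 ∈ s.I.FX i)) hlen feas_ends
    ((Feas.memFinset (n := fun q : F => q.s.I.G.n) (X := fun q => q.s.I.FX i) (i := fun q => q.x.1)
      hn hX he.fst).and (Feas.memFinset (n := fun q : F => q.s.I.G.n) (X := fun q => q.s.I.FX i)
      (i := fun q => q.x.2) hn hX he.snd))
  refine (Feas.cardImage (n := fun s : AlgInput dir p₀ q₀ r => s.I.G.n) (A := fun s => s.I.FX i)
    modest_n feas_n (Feas.mergeAll (n := fun s : AlgInput dir p₀ q₀ r => s.I.G.n) modest_n feas_n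
      (hlen.mono fun s => List.length_filter_le _ _) hfilter)
    (Feas.memFinset (n := fun q : Idx (fun s : AlgInput dir p₀ q₀ r => s.I.G.n) => q.s.I.G.n)
      (X := fun q => q.s.I.FX i) (i := fun q => q.i) (modest_n.pull _)
      ((feas_FX i).pull Idx.s).weaken Feas.var0)).congr fun s => ?_
  rw [FinGraph.ccV_eq]

theorem feas_ccFY (j : Fin q₀) :
    Feas (scale dir p₀ q₀ r c) encode fun s => .int (s.I.G.ccE (s.I.FY j) : ℕ) := by
  set l := fun s : AlgInput dir p₀ q₀ r => (List.finRange s.I.G.m).filter (· ∈ s.I.FY j)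
  have hlen : PolyBdd (scale dir p₀ q₀ r c).time fun s => (l s).length :=
    modest_m.1.mono fun s => (List.length_filter_le _ _).trans (by simp)
  have hmap := Feas.map (κ := scale dir p₀ q₀ r c) (a := encode)
    (α := fun s : AlgInput dir p₀ q₀ r => Fin s.I.G.m) (eα := fun _ => Data.ofFin)
    (β := fun s => Fin s.I.G.n × Fin s.I.G.n) (eβ := fun _ e => .pair (.ofFin e.1) (.ofFin e.2))
    (l := l) (f := fun s => s.I.G.ends) hlen (feas_FY j)
    (Feas.get (n := fun q : Feas.Entry l => q.s.I.G.m) (β := fun q => Fin q.s.I.G.n × Fin q.s.I.G.n)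
      (eβ := fun _ e => .pair (.ofFin e.1) (.ofFin e.2)) (x := fun q => q.s.I.G.ends)
      (i := fun q => q.x) (modest_m.pull _) (feas_ends.pull Feas.Entry.s).weaken Feas.var0)
  set V := Idx fun s : AlgInput dir p₀ q₀ r => s.I.G.n
  -- whether a vertex is an end of an edge of the set
  have hmem : Feas ((scale dir p₀ q₀ r c).pull (Idx.s : V → _)) (fun q => .pair
      (.ofFin q.i) q.s.encode)
      fun q => .ofBool ((l q.s).any fun e =>
        decide ((q.s.I.G.ends e).1 = q.i) || decide ((q.s.I.G.ends e).2 = q.i)) := by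
    have hl : Feas ((scale dir p₀ q₀ r c).pull (Idx.s : V → _))
      (fun q => .pair (.ofFin q.i) q.s.encode) fun q => .ofList Data.ofFin (l q.s) :=
      ((feas_FY j).pull Idx.s).weaken
    refine Feas.any (α := fun q : V => Fin q.s.I.G.m) (eα := fun _ => Data.ofFin)
      (l := fun q => l q.s) (p := fun q e => decide ((q.s.I.G.ends e).1 = q.i) ||
        decide ((q.s.I.G.ends e).2 = q.i)) (hlen.pull _) hl ?_
    set F := Feas.Entry fun q : V => l q.s
    let env : F → Data := fun x => .pair (.ofFin x.x) (.pair (.ofFin x.s.i) x.s.s.encode)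
    have hs : Feas (((scale dir p₀ q₀ r c).pull (Idx.s : V → _)).pull (Feas.Entry.s : F → V)) env
      fun x => x.s.s.encode := Feas.id.weaken.weaken
    have hv : Feas (((scale dir p₀ q₀ r c).pull (Idx.s : V → _)).pull (Feas.Entry.s : F → V)) env
      fun x => .ofFin x.s.i := Feas.var0.weaken
    have hends := hs.comp (feas_ends.pull fun x : F => x.s.s)
    have he := Feas.get (n := fun x : F => x.s.s.I.G.m)
      (β := fun x => Fin x.s.s.I.G.n × Fin x.s.s.I.G.n)
      (eβ := fun _ e => .pair (.ofFin e.1) (.ofFin e.2)) (x := fun x => x.s.s.I.G.ends)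
      (i := fun x => x.x) ((modest_m.pull Idx.s).pull _) hends Feas.var0
    exact (Feas.finEq (n := fun x : F => x.s.s.I.G.n) (i := fun x => (x.s.s.I.G.ends x.x).1)
      (j := fun x => x.s.i) he.fst hv).or (Feas.finEq (n := fun x : F => x.s.s.I.G.n)
      (i := fun x => (x.s.s.I.G.ends x.x).2) (j := fun x => x.s.i) he.snd hv)
  refine (Feas.cardImage (n := fun s : AlgInput dir p₀ q₀ r => s.I.G.n)
    (A := fun s => Finset.univ.filter fun v => ∃ e ∈ s.I.FY j, (s.I.G.ends e).1 = v ∨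
        (s.I.G.ends e).2 = v)
    modest_n feas_n (Feas.mergeAll (n := fun s : AlgInput dir p₀ q₀ r => s.I.G.n) modest_n feas_n
      (hlen.mono fun s => by simp) hmap) (hmem.congr fun q => ?_)).congr fun s => ?_
  · congr 1
    rw [Bool.eq_iff_iff]
    simp [l]
  · rw [FinGraph.ccE_eq]

/-- The fixed sets that contain a vertex. -/
theorem feas_vertexClass : Feas (scale dir p₀ q₀ r c) encode fun s =>
    .ofVec Data.ofElt (memLabel s.I.FX) :=
  Feas.ofFn (β := fun _ => Fin p₀ → Bool) (eβ := fun _ => Data.ofElt) (x := fun s =>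
      memLabel s.I.FX)
    modest_n feas_n (Feas.funElt fun i => Feas.eltOfBool (Feas.memFinset
      (n := fun q : Idx (fun s : AlgInput dir p₀ q₀ r => s.I.G.n) => q.s.I.G.n)
      (X := fun q => q.s.I.FX i) (i := fun q => q.i) (modest_n.pull _)
      ((feas_FX i).pull Idx.s).weaken Feas.var0))

theorem feas_edgeClass : Feas (scale dir p₀ q₀ r c) encode fun s =>
    .ofVec Data.ofElt (memLabel s.I.FY) :=
  Feas.ofFn (β := fun _ => Fin q₀ → Bool) (eβ := fun _ => Data.ofElt) (x := fun s =>
      memLabel s.I.FY)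
    modest_m feas_m (Feas.funElt fun j => Feas.eltOfBool (Feas.memFinset
      (n := fun q : Idx (fun s : AlgInput dir p₀ q₀ r => s.I.G.m) => q.s.I.G.m)
      (X := fun q => q.s.I.FY j) (i := fun q => q.i) (modest_m.pull _)
      ((feas_FY j).pull Idx.s).weaken Feas.var0))

end AlgInput

/-! ### Random weights -/

/-- Repeated doubling of `1` until `2 * N` is reached; the power of two and its exponent. -/
def doubling (N : ℕ) : ℕ × ℕ :=
  (List.finRange (2 * N)).foldl (fun p _ => if p.1 < 2 * N then (2 * p.1, p.2 + 1) else p) (1, 0)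

/-- The number of bits of the weights of `N` items. -/
def bitLen (N : ℕ) : ℕ := (doubling N).2

theorem doubling_inv (N : ℕ) (l : List (Fin (2 * N))) (p : ℕ × ℕ)
    (hp : p = l.foldl (fun p _ => if p.1 < 2 * N then (2 * p.1, p.2 + 1) else p) (1, 0)) :
    p.1 = 2 ^ p.2 ∧ p.1 ≤ 4 * N + 1 ∧ p.2 ≤ l.length ∧ (2 * N ≤ p.1 ∨ p.2 = l.length) := by
  induction l using List.reverseRecOn generalizing p with
  | nil => subst hp; simp
  | append_singleton l i ih =>
    rw [List.foldl_append] at hp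
    obtain ⟨h1, h2, h3, h4⟩ := ih _ rfl
    simp only [List.foldl_cons, List.foldl_nil] at hp
    rw [List.length_append, List.length_singleton]
    split at hp <;> subst hp
    · rename_i h
      exact ⟨by rw [h1, pow_succ, mul_comm], by dsimp only; omega, by dsimp only; omega,
        by dsimp only; omega⟩
    · exact ⟨h1, h2, by omega, by omega⟩

theorem two_pow_bitLen (N : ℕ) : 2 ^ bitLen N = (doubling N).1 := (doubling_inv N _ _ rfl).1.symm

theorem two_pow_bitLen_le (N : ℕ) : 2 ^ bitLen N ≤ 4 * N + 1 :=
  two_pow_bitLen N ▸ (doubling_inv N _ _ rfl).2.1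

theorem bitLen_le (N : ℕ) : bitLen N ≤ 2 * N := by
  have h := (doubling_inv N (List.finRange (2 * N)) _ rfl).2.2.1
  rwa [List.length_finRange] at h

theorem le_two_pow_bitLen (N : ℕ) : 2 * N ≤ 2 ^ bitLen N := by
  have h := doubling_inv N (List.finRange (2 * N)) _ rfl
  rcases h.2.2.2 with h | h
  · exact two_pow_bitLen N ▸ h
  · have : bitLen N = 2 * N := by rwa [List.length_finRange] at h
    rw [this]
    exact Nat.lt_two_pow_self.le

namespace Feas

variable {S : Type} {κ : Scale S} {a : S → Data}

theorem doubling {N : S → ℕ} (hN : Modest κ N) (h : Feas κ a fun s => .int (N s)) :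
    Feas κ a fun s => .pair (.int ((doubling (N s)).1 : ℕ)) (.int ((doubling (N s)).2 : ℕ)) := by
  have h2 : Feas κ a fun s => .int (2 * N s : ℕ) := ((int 2).mul h
    ((hN.2.mul (.const κ.two_le_word 2)).mono fun s => by
      simp [Int.natAbs_mul, mul_comm])).congr fun s => by push_cast; rfl
  have hN2 : Modest κ fun s => 2 * N s := (Modest.const 2).mul hN
  refine foldl (α := fun s => Fin (2 * N s)) (eα := fun _ => Data.ofFin) (β := fun _ => ℕ × ℕ)
    (eβ := fun _ p => .pair (.int (p.1 : ℕ)) (.int (p.2 : ℕ)))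
    (l := fun s => List.finRange (2 * N s))
    (step := fun s p _ => if p.1 < 2 * N s then (2 * p.1, p.2 + 1) else p) (init := fun _ => (1, 0))
    (fun s pre p => p = pre.foldl (fun p _ => if p.1 < 2 * N s then (2 * p.1, p.2 + 1) else p) (1,
        0))
    (fun s => rfl) (fun q => by rw [List.foldl_append, ← q.inv]; rfl)
    (hN2.1.mono (by simp)) (finRange hN2.1 hN2.2 h2) ((int 1).pair (int 0)) ?_
  set Inv : ∀ s, List (Fin (2 * N s)) → ℕ × ℕ → Prop := fun s pre p =>
    p = pre.foldl (fun p _ => if p.1 < 2 * N s then (2 * p.1, p.2 + 1) else p) (1, 0)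
  set F := Frame (fun s => List.finRange (2 * N s)) Inv
  let env : F → Data := fun q => .pair (.ofFin q.x) (.pair (.pair (.int (q.b.1 : ℕ))
    (.int (q.b.2 : ℕ))) (a q.s))
  have hinv := fun q : F => doubling_inv (N q.s) q.pre q.b q.inv
  have hb : Feas (κ.pull (Frame.s : F → S)) env fun q => .pair (.int (q.b.1 : ℕ)) (.int
      (q.b.2 : ℕ)) :=
    var0.weaken
  have h2' : Feas (κ.pull (Frame.s : F → S)) env fun q => .int (2 * N q.s : ℕ) :=
    (h2.pull Frame.s).weaken.weaken
  have hNF : Modest (κ.pull (Frame.s : F → S)) fun q => N q.s := hN.pull _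
  have hb1 : PolyBdd (κ.pull (Frame.s : F → S)).word fun q => 2 * q.b.1 :=
    (((Modest.const 8).mul hNF).add (.const 2)).2.mono fun q => by
      have := (hinv q).2.1
      omega
  have hb2 : PolyBdd (κ.pull (Frame.s : F → S)).word fun q => q.b.2 + 1 :=
    (((Modest.const 2).mul hNF).add (.const 1)).2.mono fun q => by
      have := (hinv q).2.2.1
      have h1 := congrArg List.length q.eq
      simp at h1
      omega
  have hdouble : Feas (κ.pull (Frame.s : F → S)) env fun q => .int (2 * q.b.1 : ℕ) :=
    ((int 2).mul hb.fst (hb1.mono fun q => by simp [Int.natAbs_mul])).congr fun q => by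
      push_cast; rfl
  have hsucc : Feas (κ.pull (Frame.s : F → S)) env fun q => .int (q.b.2 + 1 : ℕ) :=
    (hb.snd.add (int 1) (hb2.mono fun q => by omega)).congr fun q => by push_cast; rfl
  refine ((hb.fst.lt h2').ite' (hdouble.pair hsucc) hb).congr fun q => ?_
  by_cases hlt : q.b.1 < 2 * N q.s
  · rw [if_pos hlt, if_pos (by simpa using mod_cast hlt)]
  · rw [if_neg hlt, if_neg (by rw [decide_eq_true_iff, Nat.cast_lt]; exact hlt)]

theorem bitLen {N : S → ℕ} (hN : Modest κ N) (h : Feas κ a fun s => .int (N s)) :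
    Feas κ a fun s => .int (_root_.bitLen (N s) : ℕ) := (doubling hN h).snd

theorem two_pow_bitLen {N : S → ℕ} (hN : Modest κ N) (h : Feas κ a fun s => .int (N s)) :
    Feas κ a fun s => .int (2 ^ _root_.bitLen (N s) : ℕ) :=
  (doubling hN h).fst.congr fun s => by rw [_root_.two_pow_bitLen]

/-- Numbers that are given by a block of bits. -/
theorem ofBits {l : ∀ _ : S, List Bool} {b i : S → ℕ} (hl : Feas κ a fun s => .ofList Data.ofBool
    (l s))
    (hlen : Modest κ fun s => (l s).length) (hb : Modest κ b) (hb' : Feas κ a fun s => .int (b s))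
    (hi : Feas κ a fun s => .int (i s)) (hi' : PolyBdd κ.word i)
    (hpow : PolyBdd κ.word fun s => 2 ^ b s) :
    Feas κ a fun s => .int (Nat.ofBits fun j : Fin (b s) => (l s).getD (i s * b s + j) false : ℕ) :=
        by
  have hlt : ∀ {s : S} (pre : List (Fin (b s))), pre.foldl (fun acc (j : Fin (b s)) =>
      2 * acc + ((l s).getD (i s * b s + j) false).toNat) 0 < 2 ^ pre.length := by
    intro s pre
    induction pre using List.reverseRecOn with
    | nil => simp
    | append_singleton pre j ih =>
      rw [List.foldl_append, List.length_append, List.length_singleton, pow_succ]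
      have := Bool.toNat_lt ((l s).getD (i s * b s + j) false)
      simp only [List.foldl_cons, List.foldl_nil]
      omega
  have hfold := foldl (α := fun s => Fin (b s)) (eα := fun _ => Data.ofFin) (β := fun _ => ℕ)
    (eβ := fun _ p => .int (p : ℕ)) (l := fun s => (List.finRange (b s)).reverse)
    (step := fun s acc j => 2 * acc + ((l s).getD (i s * b s + j) false).toNat) (init := fun _ => 0)
    (κ := κ) (a := a) (fun s pre p => p = pre.foldl (fun acc (j : Fin (b s)) =>
      2 * acc + ((l s).getD (i s * b s + j) false).toNat) 0)
    (fun s => rfl) (fun q => by rw [List.foldl_append, ← q.inv]; rfl)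
    (hb.1.mono (by simp)) (reverse (hb.1.mono (by simp)) (finRange hb.1 hb.2 hb')) (int 0) ?_
  · refine hfold.congr fun s => ?_
    rw [List.foldl_reverse, Nat.ofBits, Fin.foldr_eq_finRange_foldr]
  · set Inv : ∀ s, List (Fin (b s)) → ℕ → Prop := fun s pre p =>
      p = pre.foldl (fun acc (j : Fin (b s)) =>
        2 * acc + ((l s).getD (i s * b s + j) false).toNat) 0
    set F := Frame (fun s => (List.finRange (b s)).reverse) Inv
    let env : F → Data := fun q => .pair (.ofFin q.x) (.pair (.int (q.b : ℕ)) (a q.s))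
    have hj : Feas (κ.pull (Frame.s : F → S)) env fun q => .int (q.x : ℕ) := var0
    have hacc : Feas (κ.pull (Frame.s : F → S)) env fun q => .int (q.b : ℕ) := var0.weaken
    have hi1 : Feas (κ.pull (Frame.s : F → S)) env fun q => .int (i q.s) :=
      (hi.pull Frame.s).weaken.weaken
    have hb1 : Feas (κ.pull (Frame.s : F → S)) env fun q => .int (b q.s) :=
      (hb'.pull Frame.s).weaken.weaken
    have hl1 : Feas (κ.pull (Frame.s : F → S)) env fun q => .ofList Data.ofBool (l q.s) :=
      (hl.pull Frame.s).weaken.weaken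
    have hmul : PolyBdd (κ.pull (Frame.s : F → S)).word fun q => i q.s * b q.s :=
      (hi'.mul hb.2).pull Frame.s
    have hidx : PolyBdd (κ.pull (Frame.s : F → S)).word fun q => i q.s * b q.s + q.x :=
      (((hi'.mul hb.2).add κ.two_le_word hb.2).pull Frame.s).mono fun q =>
        Nat.add_le_add_left q.x.2.le _
    have hpos : Feas (κ.pull (Frame.s : F → S)) env fun q => .int (i q.s * b q.s + q.x : ℕ) :=
      ((hi1.mul hb1 (hmul.mono fun q => by simp [Int.natAbs_mul])).add hj
        (hidx.mono fun q => by omega)).congr fun q => by push_cast; rfl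
    have hbit := getD (eα := fun _ : F => Data.ofBool) hidx (hlen.pull Frame.s) hl1 hpos
    have hbit' : Feas (κ.pull (Frame.s : F → S)) env
        fun q => .int (((l q.s).getD (i q.s * b q.s + q.x) false).toNat : ℕ) :=
      hbit.congr fun q => by
        rw [show Data.int 0 = Data.ofBool false from rfl, List.getD_map]
        cases (l q.s).getD (i q.s * b q.s + q.x) false <;> rfl
    have hbound : PolyBdd (κ.pull (Frame.s : F → S)).word fun q => 2 * q.b + 1 :=
      (((PolyBdd.const κ.two_le_word 2).mul hpow).pull Frame.s).mono fun q => by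
        have h1 : q.b < 2 ^ q.pre.length := by
          have := q.inv
          rw [this]
          exact hlt q.pre
        have h2 := congrArg List.length q.eq
        simp at h2
        have h3 := Nat.pow_le_pow_right (n := 2) (by omega) (show q.pre.length ≤ b q.s by omega)
        omega
    refine (((int 2).mul hacc (hbound.mono fun q => by simp [Int.natAbs_mul])).add hbit'
      (hbound.mono fun q => ?_)).congr fun q => by push_cast; rfl
    have := Bool.toNat_lt ((l q.s).getD (i q.s * b q.s + q.x) false)
    omega

end Feas

/-! ### The computation after the coin tosses -/

/-- The numbers of the items. -/
noncomputable def itemIdx (p₁ q₁ n m : ℕ) :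
    Item p₁ q₁ n m ≃ Fin (n * Fintype.card (VSym p₁ q₁) + m * q₁) :=
  (Equiv.sumCongr ((Equiv.prodCongr (Equiv.refl _) (Fintype.equivFin _)).trans finProdFinEquiv)
    finProdFinEquiv).trans finSumFinEquiv

theorem itemIdx_inl {p₁ q₁ n m : ℕ} (v : Fin n) (i : VSym p₁ q₁) :
    (itemIdx p₁ q₁ n m (.inl (v, i)) : ℕ) =
      Fintype.equivFin (VSym p₁ q₁) i + Fintype.card (VSym p₁ q₁) * v := rfl

theorem itemIdx_inr {p₁ q₁ n m : ℕ} (e : Fin m) (j : Fin q₁) :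
    (itemIdx p₁ q₁ n m (.inr (e, j)) : ℕ) = n * Fintype.card (VSym p₁ q₁) + (j + q₁ * e) := rfl

section

variable {dir : Bool} {p₀ q₀ r : ℕ}

namespace AlgInput

/-- The number of items. -/
def numItems (p₁ q₁ : ℕ) (s : AlgInput dir p₀ q₀ r) : ℕ :=
  s.I.G.n * Fintype.card (VSym p₁ q₁) + s.I.G.m * q₁

/-- The number of coin tosses. -/
def numBits (p₁ q₁ : ℕ) (s : AlgInput dir p₀ q₀ r) : ℕ :=
  s.numItems p₁ q₁ * bitLen (s.numItems p₁ q₁)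

/-- A bound for all the keys. -/
def keyBound (p₁ q₁ : ℕ) (s : AlgInput dir p₀ q₀ r) : ℕ :=
  s.I.G.n + s.I.G.m + s.numItems p₁ q₁ * 2 ^ bitLen (s.numItems p₁ q₁)

variable {c p₁ q₁ : ℕ}

theorem modest_numItems : Modest (scale dir p₀ q₀ r c) (numItems p₁ q₁) :=
  (modest_n.mul (.const _)).add (modest_m.mul (.const _))

theorem modest_two_pow : Modest (scale dir p₀ q₀ r c) fun s => 2 ^ bitLen (s.numItems p₁ q₁) :=
  (((Modest.const 4).mul modest_numItems).add (.const 1)).mono fun _ => two_pow_bitLen_le _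

theorem modest_bitLen : Modest (scale dir p₀ q₀ r c) fun s => bitLen (s.numItems p₁ q₁) :=
  ((Modest.const 2).mul modest_numItems).mono fun _ => bitLen_le _

theorem modest_numBits : Modest (scale dir p₀ q₀ r c) (numBits p₁ q₁) :=
  modest_numItems.mul modest_bitLen

theorem modest_keyBound : Modest (scale dir p₀ q₀ r c) (keyBound p₁ q₁) :=
  (modest_n.add modest_m).add (modest_numItems.mul modest_two_pow)

theorem feas_numItems : Feas (scale dir p₀ q₀ r c) encode fun s => .int (s.numItems p₁ q₁) :=
  (((feas_n.mul (.int (Fintype.card (VSym p₁ q₁) : ℕ)) ((modest_n.mul (.const _)).2.mono fun s => by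
    rw [Int.natAbs_mul]; exact le_rfl)).add (feas_m.mul (.int (q₁ : ℕ)) ((modest_m.mul
        (.const _)).2.mono
    fun s => by rw [Int.natAbs_mul]; exact le_rfl)) (modest_numItems.2.mono fun s => by
      rw [← Nat.cast_mul, ← Nat.cast_mul, ← Nat.cast_add, Int.natAbs_natCast]; exact le_rfl))).congr
    fun s => by rw [numItems]; push_cast; rfl

theorem feas_bitLen : Feas (scale dir p₀ q₀ r c) encode fun s =>
    .int (bitLen (s.numItems p₁ q₁) : ℕ) := Feas.bitLen modest_numItems feas_numItems

theorem feas_numBits : Feas (scale dir p₀ q₀ r c) encode fun s => .int (s.numBits p₁ q₁) :=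
  (feas_numItems.mul feas_bitLen (modest_numBits.2.mono fun s => by
    rw [← Nat.cast_mul, Int.natAbs_natCast]; exact le_rfl)).congr fun s => by
      rw [numBits]; push_cast; rfl

theorem feas_keyBound : Feas (scale dir p₀ q₀ r c) encode fun s => .int (s.keyBound p₁ q₁) := by
  have h1 := (modest_n (dir := dir) (p₀ := p₀) (q₀ := q₀) (r := r) (c := c)).add modest_m
  have h2 : Modest (scale dir p₀ q₀ r c) fun s =>
      s.numItems p₁ q₁ * 2 ^ bitLen (s.numItems p₁ q₁) := modest_numItems.mul modest_two_pow
  refine ((feas_n.add feas_m (h1.2.mono fun s => ?_)).add (feas_numItems.mul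
    (Feas.two_pow_bitLen modest_numItems feas_numItems) (h2.2.mono fun s => ?_))
    ((h1.add h2).2.mono fun s => ?_)).congr fun s => by rw [keyBound]; push_cast; rfl
  · rw [← Nat.cast_add, Int.natAbs_natCast]
  · rw [← Nat.cast_mul, Int.natAbs_natCast]
  · rw [← Nat.cast_add, ← Nat.cast_mul, ← Nat.cast_add, Int.natAbs_natCast]

end AlgInput

/-- An instance with a tree decomposition and with the outcomes of the coin tosses. -/
structure BitInput (dir : Bool) (p₀ q₀ r p₁ q₁ : ℕ) where
  s : AlgInput dir p₀ q₀ r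
  bits : List Bool
  len : bits.length = s.numBits p₁ q₁

namespace BitInput

variable {p₁ q₁ c : ℕ}

/-- The tosses are stored in the order in which a program accumulates them, the last one first. -/
def encode (x : BitInput dir p₀ q₀ r p₁ q₁) : Data :=
  .pair (.ofList Data.ofBool x.bits.reverse) x.s.encode

/-- The weights of the items. -/
noncomputable def weight (x : BitInput dir p₀ q₀ r p₁ q₁) (u : Item p₁ q₁ x.s.I.G.n x.s.I.G.m) : ℕ
    :=
  bitWeight (fun u => itemIdx p₁ q₁ x.s.I.G.n x.s.I.G.m u) (bitLen (x.s.numItems p₁ q₁))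
    (fun i => x.bits.getD i false) u

theorem weight_lt (x : BitInput dir p₀ q₀ r p₁ q₁) (u) :
    x.weight u < 2 ^ bitLen (x.s.numItems p₁ q₁) := bitWeight_lt _ _ _ _

theorem keyBound_weight (x : BitInput dir p₀ q₀ r p₁ q₁) :
    KeyBound p₁ q₁ x.s.I.G.n x.s.I.G.m x.weight (x.s.keyBound p₁ q₁) := by
  refine ⟨by rw [AlgInput.keyBound]; omega, by rw [AlgInput.keyBound]; omega, ?_⟩
  refine (Finset.sum_le_card_nsmul _ _ _ fun u _ => (x.weight_lt u).le).trans ?_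
  rw [Finset.card_univ, Fintype.card_congr (itemIdx p₁ q₁ _ _), Fintype.card_fin, AlgInput.keyBound,
    smul_eq_mul]
  exact Nat.le_add_left _ _

/-- The yardsticks for the inputs with coin tosses. -/
abbrev scale (dir : Bool) (p₀ q₀ r p₁ q₁ c : ℕ) : Scale (BitInput dir p₀ q₀ r p₁ q₁) :=
  (AlgInput.scale dir p₀ q₀ r c).pull BitInput.s

theorem lift {f : AlgInput dir p₀ q₀ r → Data}
    (h : Feas (AlgInput.scale dir p₀ q₀ r c) AlgInput.encode f) :
    Feas (scale dir p₀ q₀ r p₁ q₁ c) encode fun x => f x.s := (h.pull BitInput.s).weaken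

theorem dims : Dims (scale dir p₀ q₀ r p₁ q₁ c) encode (fun x => x.s.I.G.n)
    fun x => x.s.keyBound p₁ q₁ :=
  ⟨AlgInput.modest_n.pull _, AlgInput.modest_keyBound.pull _, lift AlgInput.feas_n,
    lift AlgInput.feas_keyBound⟩

theorem modest_bits : Modest (scale dir p₀ q₀ r p₁ q₁ c) fun x => x.bits.length :=
  (AlgInput.modest_numBits.pull BitInput.s).mono fun x => x.len.le

theorem feas_bits : Feas (scale dir p₀ q₀ r p₁ q₁ c) encode fun x => .ofList Data.ofBool x.bits :=
  (Feas.reverse (eα := fun _ => Data.ofBool) (modest_bits.1.mono (by simp)) Feas.var0).congr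
    fun x => by rw [List.reverse_reverse]

section Weights

variable {S : Type} {π : S → BitInput dir p₀ q₀ r p₁ q₁} {a : S → Data}

theorem feas_weight (h : Feas ((scale dir p₀ q₀ r p₁ q₁ c).pull π) a fun s => (π s).encode)
    {u : ∀ s, Item p₁ q₁ (π s).s.I.G.n (π s).s.I.G.m}
    (hu : Feas ((scale dir p₀ q₀ r p₁ q₁ c).pull π) a fun s => .int (itemIdx p₁ q₁ _ _ (u s) : ℕ)) :
    Feas ((scale dir p₀ q₀ r p₁ q₁ c).pull π) a fun s => .int ((π s).weight (u s) : ℕ) :=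
  Feas.ofBits (l := fun s => (π s).bits) (i := fun s => itemIdx p₁ q₁ _ _ (u s))
    (b := fun s => bitLen ((π s).s.numItems p₁ q₁)) (h.comp (feas_bits.pull π))
    (modest_bits.pull π) ((AlgInput.modest_bitLen.pull BitInput.s).pull π)
    (h.comp ((lift AlgInput.feas_bitLen).pull π)) hu
    (((AlgInput.modest_numItems.pull BitInput.s).pull π).2.mono fun s => (itemIdx p₁ q₁ _ _
        (u s)).2.le)
    ((AlgInput.modest_two_pow.pull BitInput.s).pull π).2

theorem polyBdd_weight (t : Finset (VSym p₁ q₁)) {v : ∀ s, Fin (π s).s.I.G.n} :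
    PolyBdd ((scale dir p₀ q₀ r p₁ q₁ c).pull π).word fun s => ∑ i ∈ t, (π s).weight (.inl (v s,
        i)) :=
  (((Modest.const t.card).mul (AlgInput.modest_two_pow.pull BitInput.s)).pull π).2.mono fun s => by
    refine (Finset.sum_le_card_nsmul _ _ _ fun i _ => ((π s).weight_lt _).le).trans ?_
    rw [smul_eq_mul]

theorem polyBdd_weight' (t : Finset (Fin q₁)) {e : ∀ s, Fin (π s).s.I.G.m} :
    PolyBdd ((scale dir p₀ q₀ r p₁ q₁ c).pull π).word fun s => ∑ j ∈ t, (π s).weight (.inr (e s,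
        j)) :=
  (((Modest.const t.card).mul (AlgInput.modest_two_pow.pull BitInput.s)).pull π).2.mono fun s => by
    refine (Finset.sum_le_card_nsmul _ _ _ fun i _ => ((π s).weight_lt _).le).trans ?_
    rw [smul_eq_mul]

theorem feas_vertexWeight (h : Feas ((scale dir p₀ q₀ r p₁ q₁ c).pull π) a fun s => (π s).encode)
    {v : ∀ s, Fin (π s).s.I.G.n}
    (hv : Feas ((scale dir p₀ q₀ r p₁ q₁ c).pull π) a fun s => .ofFin (v s)) (i : VSym p₁ q₁) :
    Feas ((scale dir p₀ q₀ r p₁ q₁ c).pull π) a fun s => .int ((π s).weight (.inl (v s, i)) : ℕ) :=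
        by
  refine feas_weight h ?_
  have hn : Modest ((scale dir p₀ q₀ r p₁ q₁ c).pull π) fun s => (π s).s.I.G.n :=
    (AlgInput.modest_n.pull BitInput.s).pull π
  have hb := ((Modest.const (Fintype.card (VSym p₁ q₁))).mul hn).2
  have hb' := (((Modest.const (Fintype.card (VSym p₁ q₁))).mul hn).add
    (.const (Fintype.card (VSym p₁ q₁)))).2
  refine ((Feas.int (Fintype.equivFin (VSym p₁ q₁) i : ℕ)).add ((Feas.int
    (Fintype.card (VSym p₁ q₁) : ℕ)).mul (y := fun s => ((v s : ℕ) : ℤ)) hv (hb.mono fun s => ?_))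
    (hb'.mono fun s => ?_)).congr fun s => by rw [itemIdx_inl]; push_cast; rfl
  · rw [← Nat.cast_mul, Int.natAbs_natCast]
    exact Nat.mul_le_mul_left _ (v s).2.le
  · rw [← Nat.cast_mul, ← Nat.cast_add, Int.natAbs_natCast, add_comm]
    exact Nat.add_le_add (Nat.mul_le_mul_left _ (v s).2.le) (Fintype.equivFin (VSym p₁ q₁) i).2.le

theorem feas_edgeWeight (h : Feas ((scale dir p₀ q₀ r p₁ q₁ c).pull π) a fun s => (π s).encode)
    {e : ∀ s, Fin (π s).s.I.G.m}
    (he : Feas ((scale dir p₀ q₀ r p₁ q₁ c).pull π) a fun s => .ofFin (e s)) (j : Fin q₁) :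
    Feas ((scale dir p₀ q₀ r p₁ q₁ c).pull π) a fun s => .int ((π s).weight (.inr (e s, j)) : ℕ) :=
        by
  refine feas_weight h ?_
  have hn : Modest ((scale dir p₀ q₀ r p₁ q₁ c).pull π) fun s => (π s).s.I.G.n :=
    (AlgInput.modest_n.pull BitInput.s).pull π
  have hm : Modest ((scale dir p₀ q₀ r p₁ q₁ c).pull π) fun s => (π s).s.I.G.m :=
    (AlgInput.modest_m.pull BitInput.s).pull π
  have hN : Modest ((scale dir p₀ q₀ r p₁ q₁ c).pull π) fun s => (π s).s.numItems p₁ q₁ :=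
    (AlgInput.modest_numItems.pull BitInput.s).pull π
  have hn' : Feas ((scale dir p₀ q₀ r p₁ q₁ c).pull π) a fun s => .int (π s).s.I.G.n :=
    h.comp ((lift AlgInput.feas_n).pull π)
  have hidx : ∀ s, (π s).s.I.G.n * Fintype.card (VSym p₁ q₁) + (j + q₁ * e s) ≤
    (π s).s.numItems p₁ q₁ := fun s => (itemIdx p₁ q₁ _ _ (.inr (e s, j))).2.le
  have hq : Feas ((scale dir p₀ q₀ r p₁ q₁ c).pull π) a fun s => .int (q₁ * e s : ℕ) :=
    ((Feas.int (q₁ : ℕ)).mul (y := fun s => ((e s : ℕ) : ℤ)) he (hN.2.mono fun s => by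
      rw [← Nat.cast_mul, Int.natAbs_natCast]; have := hidx s; omega)).congr fun s => by
        push_cast; rfl
  have hq' : Feas ((scale dir p₀ q₀ r p₁ q₁ c).pull π) a fun s => .int (j + q₁ * e s : ℕ) :=
    ((Feas.int (j : ℕ)).add hq (hN.2.mono fun s => by
      rw [← Nat.cast_add, Int.natAbs_natCast]; have := hidx s; omega)).congr fun s => by
        push_cast; rfl
  have hnc : Feas ((scale dir p₀ q₀ r p₁ q₁ c).pull π) a
      fun s => .int ((π s).s.I.G.n * Fintype.card (VSym p₁ q₁) : ℕ) :=
    (hn'.mul (Feas.int (Fintype.card (VSym p₁ q₁) : ℕ)) (hN.2.mono fun s => by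
      rw [← Nat.cast_mul, Int.natAbs_natCast]; have := hidx s; omega)).congr fun s => by
        push_cast; rfl
  exact (hnc.add hq' (hN.2.mono fun s => by
      rw [← Nat.cast_add, Int.natAbs_natCast]; exact hidx s)).congr fun s => by
        rw [itemIdx_inr]; push_cast; rfl

end Weights

end BitInput

end

/-! ### The tables of an instance are feasible -/

section

variable {dir : Bool} {p₀ q₀ r p₁ q₁ c : ℕ}

namespace BitInput

/-- The local counting problem for the random weights. -/
noncomputable def problem (L : LocalSystem (XSym p₀ p₁ q₁) (Fin q₀ ⊕ Fin q₁))
    (x : BitInput dir p₀ q₀ r p₁ q₁) :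
    LocalProblem L.VLabel (Fin q₀ ⊕ Fin q₁ → Bool) L.M x.s.I.G.n x.s.I.G.m (numKeys p₁ q₁)
      (x.s.keyBound p₁ q₁) :=
  L.weighted x.s.I x.weight (x.s.keyBound p₁ q₁)

theorem sum_vertex_weight_le (x : BitInput dir p₀ q₀ r p₁ q₁) (v : Fin x.s.I.G.n) :
    ∑ i, x.weight (.inl (v, i)) ≤ x.s.keyBound p₁ q₁ := by
  refine le_trans ?_ x.keyBound_weight.2.2
  rw [Fintype.sum_sum_type (f := x.weight), Fintype.sum_prod_type (f := fun u => x.weight (.inl u))]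
  exact (Finset.single_le_sum (f := fun v => ∑ i, x.weight (.inl (v, i)))
    (fun _ _ => Nat.zero_le _) (Finset.mem_univ v)).trans (Nat.le_add_right _ _)

theorem sum_edge_weight_le (x : BitInput dir p₀ q₀ r p₁ q₁) (e : Fin x.s.I.G.m) :
    ∑ j, x.weight (.inr (e, j)) ≤ x.s.keyBound p₁ q₁ := by
  refine le_trans ?_ x.keyBound_weight.2.2
  rw [Fintype.sum_sum_type (f := x.weight), Fintype.sum_prod_type (f := fun u => x.weight (.inr u))]
  exact (Finset.single_le_sum (f := fun e => ∑ j, x.weight (.inr (e, j)))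
    (fun _ _ => Nat.zero_le _) (Finset.mem_univ e)).trans (Nat.le_add_left _ _)

theorem vertexKey_le (x : BitInput dir p₀ q₀ r p₁ q₁) (v : Fin x.s.I.G.n) (y : VSym p₁ q₁ → Bool)
    (k : KeySym p₁ q₁) :
    vertexKey (fun v i => x.weight (.inl (v, i))) v y k ≤ x.s.keyBound p₁ q₁ := by
  have hv := v.2
  rcases k with _ | i | j
  · refine le_trans (Finset.sum_le_sum fun i _ => ?_) (x.sum_vertex_weight_le v)
    dsimp only
    split <;> omega
  · simp only [vertexKey, AlgInput.keyBound]
    split <;> omega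
  · exact Nat.zero_le _

theorem edgeKey_le (x : BitInput dir p₀ q₀ r p₁ q₁) (e : Fin x.s.I.G.m) (y : Fin q₁ → Bool)
    (k : KeySym p₁ q₁) :
    edgeKey (fun e j => x.weight (.inr (e, j))) e y k ≤ x.s.keyBound p₁ q₁ := by
  have he := e.2
  rcases k with _ | i | j
  · refine le_trans (Finset.sum_le_sum fun j _ => ?_) (x.sum_edge_weight_le e)
    dsimp only
    split <;> omega
  · exact Nat.zero_le _
  · simp only [edgeKey, AlgInput.keyBound]
    split <;> omega

section Keys

variable {S : Type} {π : S → BitInput dir p₀ q₀ r p₁ q₁} {a : S → Data}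

theorem feas_vertexKey (h : Feas ((scale dir p₀ q₀ r p₁ q₁ c).pull π) a fun s => (π s).encode)
    {v : ∀ s, Fin (π s).s.I.G.n}
    (hv : Feas ((scale dir p₀ q₀ r p₁ q₁ c).pull π) a fun s => .ofFin (v s))
    (y : VSym p₁ q₁ → Bool) (k : KeySym p₁ q₁) :
    Feas ((scale dir p₀ q₀ r p₁ q₁ c).pull π) a fun s =>
      .int (vertexKey (fun v i => (π s).weight (.inl (v, i))) (v s) y k : ℕ) := by
  rcases k with _ | i | j
  · refine Feas.natSum Finset.univ (f := fun i s => if y i then (π s).weight (.inl (v s, i)) else 0)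
      (fun i _ => ?_) ((polyBdd_weight (v := v) Finset.univ).mono fun s =>
          Finset.sum_le_sum fun i _ => ?_)
    · cases y i
      · exact Feas.int 0
      · exact feas_vertexWeight h hv i
    · split <;> omega
  · exact Feas.int (if y i then 1 else 0 : ℕ)
  · exact Feas.int 0

theorem feas_edgeKey (h : Feas ((scale dir p₀ q₀ r p₁ q₁ c).pull π) a fun s => (π s).encode)
    {e : ∀ s, Fin (π s).s.I.G.m}
    (he : Feas ((scale dir p₀ q₀ r p₁ q₁ c).pull π) a fun s => .ofFin (e s))
    (y : Fin q₁ → Bool) (k : KeySym p₁ q₁) :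
    Feas ((scale dir p₀ q₀ r p₁ q₁ c).pull π) a fun s =>
      .int (edgeKey (fun e j => (π s).weight (.inr (e, j))) (e s) y k : ℕ) := by
  rcases k with _ | i | j
  · refine Feas.natSum Finset.univ (f := fun j s => if y j then (π s).weight (.inr (e s, j)) else 0)
      (fun j _ => ?_) ((polyBdd_weight' (e := e) Finset.univ).mono fun s =>
          Finset.sum_le_sum fun j _ => ?_)
    · cases y j
      · exact Feas.int 0
      · exact feas_edgeWeight h he j
    · split <;> omega
  · exact Feas.int 0
  · exact Feas.int (if y j then 1 else 0 : ℕ)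

end Keys

variable (L : LocalSystem (XSym p₀ p₁ q₁) (Fin q₀ ⊕ Fin q₁))

theorem feas_vrow (lab : L.VLabel) :
    Feas ((scale dir p₀ q₀ r p₁ q₁ c).pull (Idx.s : Idx (fun x : BitInput dir p₀ q₀ r p₁ q₁ =>
        x.s.I.G.n) → _)) (fun q => .pair (.ofFin q.i) q.s.encode)
      fun q => ((q.s.problem L).vrow q.i lab).encode := by
  set V := Idx fun x : BitInput dir p₀ q₀ r p₁ q₁ => x.s.I.G.n
  have hD := (dims (dir := dir) (p₀ := p₀) (q₀ := q₀) (r := r) (p₁ := p₁) (q₁ := q₁) (c := c)).pull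
    (Idx.s : V → _) |>.weaken (f := fun q => .ofFin q.i)
  refine Feas.rowOfCells (n := fun q : V => q.s.s.I.G.n) (R := fun q => q.s.s.keyBound p₁ q₁)
    (c := fun q => ((q.s.problem L).vrow q.i lab).1) (k := fun q =>
        ((q.s.problem L).vrow q.i lab).2)
    hD ?_ ?_
  · have heq := Feas.finEq (κ := ((scale dir p₀ q₀ r p₁ q₁ c).pull (Idx.s : V → _)).pull
        (Idx.s : Idx (fun q : V => q.s.s.I.G.n) → _))
      (a := fun w => .pair (.ofFin w.i) (.pair (.ofFin w.s.i) w.s.s.encode))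
      (n := fun w => w.s.s.s.I.G.n) (i := fun w => w.i) (j := fun w => w.s.i) Feas.var0
      Feas.var0.weaken
    refine (heq.ite' (Feas.const (.ofElt (Cell.val lab 0 : Cell L.VLabel L.M)))
      (Feas.const (.ofElt (0 : Cell L.VLabel L.M)))).congr fun w => ?_
    rw [LocalProblem.vrow]
    by_cases hw : w.i = w.s.i <;> simp [hw]
  · refine Feas.vecConst (β := fun q : V => ZMod (q.s.s.keyBound p₁ q₁ + 1))
      (eβ := fun _ z => .int z.val) fun j => ?_
    refine (feas_vertexKey (π := fun q : V => q.s) Feas.id.weaken (v := fun q : V => q.i) Feas.var0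
      (fun i => lab.1 (.inr (.inl i))) ((keyIdx p₁ q₁).symm j)).congr fun q => ?_
    congr 2
    exact (ZMod.val_natCast_of_lt (Nat.lt_succ_of_le (q.s.vertexKey_le _ _ _))).symm

theorem feas_vtable :
    Feas ((scale dir p₀ q₀ r p₁ q₁ c).pull (Idx.s : Idx (fun x : BitInput dir p₀ q₀ r p₁ q₁ =>
        x.s.I.G.n) → _)) (fun q => .pair (.ofFin q.i) q.s.encode)
      fun q => Table.encode ((q.s.problem L).vtable q.i) :=
  Feas.listConst (eβ := fun _ => Row.encode) _ fun lab _ => feas_vrow L lab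

theorem feas_erow (y : L.VLabel × L.VLabel × (Fin q₀ ⊕ Fin q₁ → Bool)) :
    Feas ((scale dir p₀ q₀ r p₁ q₁ c).pull (Idx.s : Idx (fun x : BitInput dir p₀ q₀ r p₁ q₁ =>
        x.s.I.G.m) → _)) (fun q => .pair (.ofFin q.i) q.s.encode)
      fun q => ((q.s.problem L).erow q.i y).encode := by
  set V := Idx fun x : BitInput dir p₀ q₀ r p₁ q₁ => x.s.I.G.m
  have hD := (dims (dir := dir) (p₀ := p₀) (q₀ := q₀) (r := r) (p₁ := p₁) (q₁ := q₁) (c := c)).pull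
    (Idx.s : V → _) |>.weaken (f := fun q => .ofFin q.i)
  have henc : Feas ((scale dir p₀ q₀ r p₁ q₁ c).pull (Idx.s : V → _))
    (fun q => .pair (.ofFin q.i) q.s.encode) fun q => q.s.encode := Feas.id.weaken
  have hends := henc.comp ((lift AlgInput.feas_ends).pull (Idx.s : V → _))
  have he := Feas.get (n := fun q : V => q.s.s.I.G.m)
      (β := fun q => Fin q.s.s.I.G.n × Fin q.s.s.I.G.n)
      (eβ := fun _ e => .pair (.ofFin e.1) (.ofFin e.2)) (x := fun q => q.s.s.I.G.ends)
      (i := fun q => q.i) ((AlgInput.modest_m.pull BitInput.s).pull _) hends Feas.var0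
  refine Feas.rowOfCells (n := fun q : V => q.s.s.I.G.n) (R := fun q => q.s.s.keyBound p₁ q₁)
    (c := fun q => ((q.s.problem L).erow q.i y).1) (k := fun q => ((q.s.problem L).erow q.i y).2)
    hD ?_ ?_
  · have he' := (he.pull (Idx.s : Idx (fun q : V => q.s.s.I.G.n) → _)).weaken (f := fun w =>
        .ofFin w.i)
    have heq := Feas.finEq (κ := ((scale dir p₀ q₀ r p₁ q₁ c).pull (Idx.s : V → _)).pull
        (Idx.s : Idx (fun q : V => q.s.s.I.G.n) → _))
      (a := fun w => .pair (.ofFin w.i) (.pair (.ofFin w.s.i) w.s.s.encode))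
      (n := fun w => w.s.s.s.I.G.n) (i := fun w => w.i) (j := fun w => (w.s.s.s.I.G.ends w.s.i).1)
      Feas.var0 he'.fst
    have heq' := Feas.finEq (κ := ((scale dir p₀ q₀ r p₁ q₁ c).pull (Idx.s : V → _)).pull
        (Idx.s : Idx (fun q : V => q.s.s.I.G.n) → _))
      (a := fun w => .pair (.ofFin w.i) (.pair (.ofFin w.s.i) w.s.s.encode))
      (n := fun w => w.s.s.s.I.G.n) (i := fun w => w.i) (j := fun w => (w.s.s.s.I.G.ends w.s.i).2)
      Feas.var0 he'.snd
    let con : L.M × L.M := (L.con y.2.1.1 y.2.1.2 y.2.2 true, L.con y.1.1 y.1.2 y.2.2 false)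
    refine (heq.ite' (Feas.const (.ofElt (Cell.val y.1 con.1 : Cell L.VLabel L.M)))
      (heq'.ite' (Feas.const (.ofElt (Cell.val y.2.1 con.2 : Cell L.VLabel L.M)))
      (Feas.const (.ofElt (0 : Cell L.VLabel L.M))))).congr fun w => ?_
    rw [LocalProblem.erow]
    change _ = Data.ofElt (if w.i = (w.s.s.s.I.G.ends w.s.i).1 then Cell.val y.1 con.1
      else if w.i = (w.s.s.s.I.G.ends w.s.i).2 then Cell.val y.2.1 con.2 else 0)
    by_cases hw : w.i = (w.s.s.s.I.G.ends w.s.i).1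
    · simp [hw]
    · by_cases hw' : w.i = (w.s.s.s.I.G.ends w.s.i).2
      · rw [if_neg hw, if_pos hw', decide_eq_false hw, decide_eq_true hw']
        rfl
      · simp only [hw, hw', decide_false, Bool.false_eq_true, if_false]
  · refine Feas.vecConst (β := fun q : V => ZMod (q.s.s.keyBound p₁ q₁ + 1))
      (eβ := fun _ z => .int z.val) fun j => ?_
    refine (feas_edgeKey (π := fun q : V => q.s) Feas.id.weaken (e := fun q : V => q.i) Feas.var0
      (fun j => y.2.2 (.inr j)) ((keyIdx p₁ q₁).symm j)).congr fun q => ?_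
    congr 2
    exact (ZMod.val_natCast_of_lt (Nat.lt_succ_of_le (q.s.edgeKey_le _ _ _))).symm

theorem feas_etable :
    Feas ((scale dir p₀ q₀ r p₁ q₁ c).pull (Idx.s : Idx (fun x : BitInput dir p₀ q₀ r p₁ q₁ =>
        x.s.I.G.m) → _)) (fun q => .pair (.ofFin q.i) q.s.encode)
      fun q => Table.encode ((q.s.problem L).etable q.i) := by
  set V := Idx fun x : BitInput dir p₀ q₀ r p₁ q₁ => x.s.I.G.m
  have henc : Feas ((scale dir p₀ q₀ r p₁ q₁ c).pull (Idx.s : V → _))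
    (fun q => .pair (.ofFin q.i) q.s.encode) fun q => q.s.encode := Feas.id.weaken
  have hvec := henc.comp ((lift AlgInput.feas_edgeClass).pull (Idx.s : V → _))
  have hcls := Feas.get (n := fun q : V => q.s.s.I.G.m)
      (β := fun q => Fin q₀ → Bool) (eβ := fun _ => Data.ofElt) (x := fun q => memLabel q.s.s.I.FY)
      (i := fun q => q.i) ((AlgInput.modest_m.pull BitInput.s).pull _) hvec Feas.var0
  exact Feas.listConstFilter (eβ := fun _ => Row.encode) _
    (p := fun q y => (q.s.problem L).okE q.i y.2.2) (fun y _ => (Feas.lookup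
        (fun C : Fin q₀ → Bool =>
      .ofBool (decide ((fun j => y.2.2 (.inl j)) = C))) hcls))
    fun y _ => feas_erow L y

theorem feas_tables : Feas (scale dir p₀ q₀ r p₁ q₁ c) encode fun x =>
    .ofList Table.encode (x.problem L).tables := by
  have hV := Feas.map (κ := scale dir p₀ q₀ r p₁ q₁ c) (a := encode)
    (α := fun x => Fin x.s.I.G.n) (eα := fun _ => Data.ofFin)
    (β := fun x => List (Row (Cell L.VLabel L.M) x.s.I.G.n (numKeys p₁ q₁) (x.s.keyBound p₁ q₁)))
    (eβ := fun _ => Table.encode) (l := fun x => List.finRange x.s.I.G.n)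
    (f := fun x => (x.problem L).vtable)
    ((AlgInput.modest_n.pull BitInput.s).1.mono (by simp))
    (Feas.finRange (AlgInput.modest_n.pull BitInput.s).1 (AlgInput.modest_n.pull BitInput.s).2
      (lift AlgInput.feas_n))
    ((feas_vtable L).pull fun q : Feas.Entry (fun x : BitInput dir p₀ q₀ r p₁ q₁ =>
      List.finRange x.s.I.G.n) =>
        (⟨q.s, q.x⟩ : Idx fun x : BitInput dir p₀ q₀ r p₁ q₁ => x.s.I.G.n))
  have hE := Feas.map (κ := scale dir p₀ q₀ r p₁ q₁ c) (a := encode)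
    (α := fun x => Fin x.s.I.G.m) (eα := fun _ => Data.ofFin)
    (β := fun x => List (Row (Cell L.VLabel L.M) x.s.I.G.n (numKeys p₁ q₁) (x.s.keyBound p₁ q₁)))
    (eβ := fun _ => Table.encode) (l := fun x => List.finRange x.s.I.G.m)
    (f := fun x => (x.problem L).etable)
    ((AlgInput.modest_m.pull BitInput.s).1.mono (by simp))
    (Feas.finRange (AlgInput.modest_m.pull BitInput.s).1 (AlgInput.modest_m.pull BitInput.s).2
      (lift AlgInput.feas_m))
    ((feas_etable L).pull fun q : Feas.Entry (fun x : BitInput dir p₀ q₀ r p₁ q₁ =>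
      List.finRange x.s.I.G.m) =>
        (⟨q.s, q.x⟩ : Idx fun x : BitInput dir p₀ q₀ r p₁ q₁ => x.s.I.G.m))
  exact Feas.append (eα := fun _ => Table.encode)
    ((AlgInput.modest_n.pull BitInput.s).1.mono fun x => by simp) hV hE

end BitInput

end

/-! ### The decision after the coin tosses is feasible -/

theorem TreeDecomp.card_bag_le {dir : Bool} {G : FinGraph dir} (T : TreeDecomp G)
    (x : Fin T.tree.n) : (T.bag x).card ≤ T.width + 1 := by
  have := Finset.le_sup (f := fun x => (T.bag x).card) (Finset.mem_univ x)
  rw [TreeDecomp.width]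
  omega

section

variable {dir : Bool} {p₀ q₀ r p₁ q₁ c : ℕ}

theorem AlgInput.elimOrder_spec (s : AlgInput dir p₀ q₀ r) :
    (elimOrder s.T.bag).Nodup ∧ (∀ v, v ∈ elimOrder s.T.bag) ∧
      ∀ pre v, pre ++ [v] <+: elimOrder s.T.bag →
        ∃ x, ∀ y, v ∈ s.T.bag y → ∀ u ∈ s.T.bag y, u ∉ pre → u ∈ s.T.bag x :=
  _root_.elimOrder_spec s.T.exists_simplicial

theorem AlgInput.length_elimOrder (s : AlgInput dir p₀ q₀ r) :
    (elimOrder s.T.bag).length ≤ s.I.G.n := by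
  simpa using s.elimOrder_spec.1.length_le_card

namespace BitInput

variable (L : LocalSystem (XSym p₀ p₁ q₁) (Fin q₀ ⊕ Fin q₁))

/-- A bound for the lengths of all the tables. -/
def tableBound (x : BitInput dir p₀ q₀ r p₁ q₁) : ℕ :=
  Fintype.card (Cell L.VLabel L.M) ^ (x.s.T.width + 1) *
    (x.s.keyBound p₁ q₁ + 1) ^ numKeys p₁ q₁ + (Fintype.card L.VLabel +
      Fintype.card (L.VLabel × L.VLabel × (Fin q₀ ⊕ Fin q₁ → Bool)))

/-- The factor `(c + 1) ^ t` of the time scale takes care of the number of rows on a bag. -/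
theorem polyBdd_tableBound (hc : Fintype.card (Cell L.VLabel L.M) ≤ c + 1) :
    PolyBdd (scale dir p₀ q₀ r p₁ q₁ c).time (tableBound L) := by
  have h2 := (scale dir p₀ q₀ r p₁ q₁ c).two_le_time
  have hw : PolyBdd (scale dir p₀ q₀ r p₁ q₁ c).time fun x => (c + 1) ^ x.s.T.width :=
    PolyBdd.base.mono fun x => Nat.le_mul_of_pos_right _ (Nat.succ_pos _)
  have hE : PolyBdd (scale dir p₀ q₀ r p₁ q₁ c).time fun x =>
      Fintype.card (Cell L.VLabel L.M) ^ (x.s.T.width + 1) :=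
    (hw.mul (.const h2 (c + 1))).mono fun x => by
      rw [← pow_succ]
      exact Nat.pow_le_pow_left hc _
  have hR : PolyBdd (scale dir p₀ q₀ r p₁ q₁ c).time fun x => x.s.keyBound p₁ q₁ :=
    (AlgInput.modest_keyBound.pull BitInput.s).1
  exact (hE.mul ((hR.add h2 (.const h2 1)).pow _)).add h2 (.const h2 _)

/-- The table of a vertex or of an edge lives on a bag. -/
theorem tables_spec (x : BitInput dir p₀ q₀ r p₁ q₁) :
    ∀ t ∈ (x.problem L).tables, t.length ≤ x.tableBound L ∧
      ∃ y, Table.SuppIn (x.s.T.bag y) t := by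
  intro t ht
  rcases List.mem_append.1 ht with ht | ht
  · obtain ⟨v, -, rfl⟩ := List.mem_map.1 ht
    refine ⟨?_, ?_⟩
    · rw [LocalProblem.vtable, List.length_map, Finset.length_toList, Finset.card_univ, tableBound]
      omega
    · obtain ⟨y, hy⟩ := x.s.T.vertex_cover v
      refine ⟨y, fun row hrow u hu => ?_⟩
      obtain ⟨a, -, rfl⟩ := List.mem_map.1 hrow
      by_cases huv : u = v
      · exact huv ▸ hy
      · exact absurd (if_neg huv) hu
  · obtain ⟨e, -, rfl⟩ := List.mem_map.1 ht
    refine ⟨?_, ?_⟩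
    · rw [LocalProblem.etable, List.length_map]
      refine (List.length_filter_le _ _).trans ?_
      rw [Finset.length_toList, Finset.card_univ, tableBound]
      omega
    · obtain ⟨y, hy, hy'⟩ := x.s.T.edge_cover e
      refine ⟨y, fun row hrow u hu => ?_⟩
      obtain ⟨a, -, rfl⟩ := List.mem_map.1 hrow
      by_cases hu1 : u = (x.s.I.G.ends e).1
      · exact hu1 ▸ hy
      · by_cases hu2 : u = (x.s.I.G.ends e).2
        · exact hu2 ▸ hy'
        · exact absurd ((if_neg hu1).trans (if_neg hu2)) hu

theorem card_rows_le (x : BitInput dir p₀ q₀ r p₁ q₁) (y) :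
    Fintype.card (Cell L.VLabel L.M) ^ (x.s.T.bag y).card *
      (x.s.keyBound p₁ q₁ + 1) ^ numKeys p₁ q₁ ≤ x.tableBound L :=
  (Nat.mul_le_mul_right _ (Nat.pow_le_pow_right (Fintype.card_pos_iff.2 ⟨0⟩)
    (x.s.T.card_bag_le y))).trans (Nat.le_add_right _ _)

theorem length_elimAll_le (x : BitInput dir p₀ q₀ r p₁ q₁)
    (ok : Fin x.s.I.G.n → Cell L.VLabel L.M → Bool) (pre : List (Fin x.s.I.G.n))
    (hpre : pre <+: elimOrder x.s.T.bag) :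
    (∀ t ∈ Table.elimAll ok pre (x.problem L).tables, t.length ≤ x.tableBound L) ∧
      ∀ v, pre ++ [v] <+: elimOrder x.s.T.bag →
        ∀ G, G <+: (Table.elimAll ok pre (x.problem L).tables).filter (Table.involves v) →
          (Table.prod G).length ≤ x.tableBound L := by
  obtain ⟨h1, h2⟩ := Table.length_elimAll_le ok (bag := x.s.T.bag) (F := (x.problem L).tables)
    (ord := elimOrder x.s.T.bag) (L := x.tableBound L) (x.card_rows_le L) (x.tables_spec L)
    x.s.elimOrder_spec.2.2 pre hpre
  exact ⟨fun t ht => (h1 t ht).1, h2⟩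

/-- The admissibility of a cell depends on the vertex only through the fixed sets that contain
it. -/
def okClass (C : Fin p₀ → Bool) : Cell L.VLabel L.M → Bool
  | .val a m => decide ((fun i => a.1 (.inl i)) = C) && L.ok a.1 a.2 m
  | _ => false

theorem okCell_problem (x : BitInput dir p₀ q₀ r p₁ q₁) :
    (x.problem L).okCell = fun v => okClass L (memLabel x.s.I.FX v) := by
  funext v z
  cases z <;> rfl

theorem length_tables (x : BitInput dir p₀ q₀ r p₁ q₁) :
    (x.problem L).tables.length = x.s.I.G.n + x.s.I.G.m := by
  simp [LocalProblem.tables]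

/-- The tables that are left after the elimination of all the vertices. -/
noncomputable def finalTables (x : BitInput dir p₀ q₀ r p₁ q₁) :
    List (List (Row (Cell L.VLabel L.M) x.s.I.G.n (numKeys p₁ q₁) (x.s.keyBound p₁ q₁))) :=
  Table.elimAll (fun v => okClass L (memLabel x.s.I.FX v)) (elimOrder x.s.T.bag)
    (x.problem L).tables

theorem length_elimAll {E : Type} [AddCommMonoid E] [DecidableEq E] {n r R : ℕ}
    (ok : Fin n → E → Bool) (ord : List (Fin n)) (F : List (List (Row E n r R))) :
    (Table.elimAll ok ord F).length ≤ F.length + ord.length := by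
  induction ord using List.reverseRecOn with
  | nil => simp [Table.elimAll]
  | append_singleton ord v ih =>
    have := List.length_filter_le (fun t => !Table.involves v t) (Table.elimAll ok ord F)
    rw [Table.elimAll, List.foldl_append]
    rw [Table.elimAll] at ih this
    simp only [List.foldl_cons, List.foldl_nil, Table.elimStep, List.length_cons,
      List.length_append, List.length_nil]
    omega

/-- When all the vertices are eliminated, only the keys are left. -/
theorem suppIn_finalTables (x : BitInput dir p₀ q₀ r p₁ q₁) :
    ∀ t ∈ x.finalTables L, Table.SuppIn ∅ t := by
  intro t ht
  obtain ⟨h1, -⟩ := Table.length_elimAll_le (fun v => okClass L (memLabel x.s.I.FX v))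
    (bag := x.s.T.bag) (F := (x.problem L).tables) (ord := elimOrder x.s.T.bag)
    (L := x.tableBound L) (x.card_rows_le L) (x.tables_spec L) x.s.elimOrder_spec.2.2
    (elimOrder x.s.T.bag) (List.prefix_refl _)
  obtain ⟨-, y, hy⟩ := h1 t ht
  intro row hrow u hu
  exact absurd (List.mem_toFinset.2 (x.s.elimOrder_spec.2.1 u))
    (Finset.mem_sdiff.1 (hy row hrow u hu)).2

theorem length_prod_finalTables (x : BitInput dir p₀ q₀ r p₁ q₁) (G) (hG : G <+: x.finalTables L) :
    (Table.prod G).length ≤ x.tableBound L := by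
  refine ((Table.SuppIn.prod fun t ht => x.suppIn_finalTables L t (hG.subset ht)).length_le
    (Table.nodup_rep_prod G).1).trans ?_
  rw [Finset.card_empty, tableBound]
  refine le_trans (Nat.mul_le_mul_right _ (Nat.pow_le_pow_right (Fintype.card_pos_iff.2 ⟨0⟩)
    (Nat.zero_le _))) (Nat.le_add_right _ _)

theorem feas_finalTables (hc : Fintype.card (Cell L.VLabel L.M) ≤ c + 1) :
    Feas (scale dir p₀ q₀ r p₁ q₁ c) encode fun x => .ofList Table.encode (x.finalTables L) := by
  have hn : Modest (scale dir p₀ q₀ r p₁ q₁ c) fun x => x.s.I.G.n :=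
    AlgInput.modest_n.pull BitInput.s
  have hm : Modest (scale dir p₀ q₀ r p₁ q₁ c) fun x => x.s.I.G.m :=
    AlgInput.modest_m.pull BitInput.s
  exact Feas.tableElimAll (n := fun x : BitInput dir p₀ q₀ r p₁ q₁ => x.s.I.G.n)
    (R := fun x => x.s.keyBound p₁ q₁) (cls := fun x => memLabel x.s.I.FX) (ok := okClass L)
    (F := fun x => (x.problem L).tables) (ord := fun x => elimOrder x.s.T.bag)
    (L := tableBound L) dims ((hn.add hm).1.mono fun x => (x.length_tables L).le)
    (hn.1.mono fun x => x.s.length_elimOrder) (polyBdd_tableBound L hc)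
    (fun x pre hpre => (x.length_elimAll_le L _ pre hpre).1)
    (fun x pre v hv => (x.length_elimAll_le L _ pre ((List.prefix_append _ _).trans hv)).2 v hv)
    (lift AlgInput.feas_vertexClass) (feas_tables L) (lift AlgInput.feas_elimOrder)

theorem feas_result (hc : Fintype.card (Cell L.VLabel L.M) ≤ c + 1) :
    Feas (scale dir p₀ q₀ r p₁ q₁ c) encode fun x =>
      Table.encode ((x.problem L).result (elimOrder x.s.T.bag)) := by
  have hn : Modest (scale dir p₀ q₀ r p₁ q₁ c) fun x => x.s.I.G.n :=
    AlgInput.modest_n.pull BitInput.s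
  have hm : Modest (scale dir p₀ q₀ r p₁ q₁ c) fun x => x.s.I.G.m :=
    AlgInput.modest_m.pull BitInput.s
  refine (Feas.tableProd (n := fun x : BitInput dir p₀ q₀ r p₁ q₁ => x.s.I.G.n)
    (R := fun x => x.s.keyBound p₁ q₁) (F := finalTables L) (L := tableBound L) dims
    (((hn.add hm).add hn).1.mono fun x => ?_) (polyBdd_tableBound L hc)
    (fun x => (x.length_elimAll_le L _ _ (List.prefix_refl _)).1)
    (fun x G hG => x.length_prod_finalTables L G hG) (feas_finalTables L hc)).congr fun x => ?_
  · refine (length_elimAll _ _ _).trans (Nat.add_le_add (x.length_tables L).le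
      x.s.length_elimOrder)
  · rw [LocalProblem.result, okCell_problem, finalTables]

open Classical in
theorem feas_holds (φ : ArFormula r (CountVar p₀ q₀ p₁ q₁)) {S : Type}
    {π : S → BitInput dir p₀ q₀ r p₁ q₁} {a : S → Data}
    (h : Feas ((scale dir p₀ q₀ r p₁ q₁ c).pull π) a fun s => (π s).encode)
    {y : ∀ s, Row (Cell L.VLabel L.M) (π s).s.I.G.n (numKeys p₁ q₁) ((π s).s.keyBound p₁ q₁)}
    (hy : Feas ((scale dir p₀ q₀ r p₁ q₁ c).pull π) a fun s => (y s).encode) :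
    Feas ((scale dir p₀ q₀ r p₁ q₁ c).pull π) a fun s =>
      .ofBool (decide (φ.Holds (π s).s.I.k ((π s).s.I.keyCounts (rowKeys (y s).2)))) := by
  have hlift : ∀ {f : AlgInput dir p₀ q₀ r → Data}, Feas (AlgInput.scale dir p₀ q₀ r c)
      AlgInput.encode f → Feas ((scale dir p₀ q₀ r p₁ q₁ c).pull π) a fun s => f (π s).s :=
    fun hf => h.comp ((lift hf).pull π)
  have hmod : ∀ {f : AlgInput dir p₀ q₀ r → ℕ}, Modest (AlgInput.scale dir p₀ q₀ r c) f →
      Modest ((scale dir p₀ q₀ r p₁ q₁ c).pull π) fun s => f (π s).s :=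
    fun hf => (hf.pull BitInput.s).pull π
  have hkey : ∀ k : KeySym p₁ q₁, Feas ((scale dir p₀ q₀ r p₁ q₁ c).pull π) a fun s =>
      .int (rowKeys (y s).2 k : ℕ) := fun k =>
    Feas.rowKey (x := y) (j := fun _ => keyIdx p₁ q₁ k) hy (Feas.const _)
  have hkey' : ∀ k : KeySym p₁ q₁, PolyBdd ((scale dir p₀ q₀ r p₁ q₁ c).pull π).word fun s =>
      rowKeys (y s).2 k := fun k =>
    (hmod AlgInput.modest_keyBound).2.mono fun s => Nat.le_of_lt_succ (ZMod.val_lt _)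
  refine Feas.arFormula (k := fun s => (π s).s.I.k) (c := fun s =>
    (π s).s.I.keyCounts (rowKeys (y s).2)) (fun i => hlift (AlgInput.feas_k i))
    (fun i => ((AlgInput.polyBdd_k (c := c) i).pull BitInput.s).pull π) (fun x => ?_) (fun x =>
        ?_) φ
  · cases x with
    | numV => exact hlift AlgInput.feas_n
    | numE => exact hlift AlgInput.feas_m
    | cardFX i => exact hlift (AlgInput.feas_cardFX i)
    | cardFY j => exact hlift (AlgInput.feas_cardFY j)
    | cardX i => exact hkey _
    | cardY j => exact hkey _
    | ccFX i => exact hlift (AlgInput.feas_ccFX i)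
    | ccFY j => exact hlift (AlgInput.feas_ccFY j)
    | ccX i => exact hkey _
    | ccY j => exact hkey _
  · cases x with
    | numV => exact (hmod AlgInput.modest_n).2
    | numE => exact (hmod AlgInput.modest_m).2
    | cardFX i => exact (hmod AlgInput.modest_n).2.mono fun s =>
        (Finset.card_le_univ _).trans (by simp)
    | cardFY j => exact (hmod AlgInput.modest_m).2.mono fun s =>
        (Finset.card_le_univ _).trans (by simp)
    | cardX i => exact hkey' _
    | cardY j => exact hkey' _
    | ccFX i =>
      refine (hmod AlgInput.modest_n).2.mono fun s => ?_
      rw [Inst.keyCounts, FinGraph.ccV_eq]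
      exact (Finset.card_le_univ _).trans (by simp)
    | ccFY j =>
      refine (hmod AlgInput.modest_n).2.mono fun s => ?_
      rw [Inst.keyCounts, FinGraph.ccE_eq]
      exact (Finset.card_le_univ _).trans (by simp)
    | ccX i => exact hkey' _
    | ccY j => exact hkey' _

end BitInput

open Classical in
/-- The decision rule is feasible once the coins are tossed, with a base `c + 1` that is at least
the number of the cells. -/
theorem ECMLC.feas_accepts (φ : ECMLC dir p₀ q₀ r)
    (L : LocalSystem (XSym p₀ φ.p₁ φ.q₁) (Fin q₀ ⊕ Fin φ.q₁))
    (hc : Fintype.card (Cell L.VLabel L.M) ≤ c + 1) :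
    Feas (BitInput.scale dir p₀ q₀ r φ.p₁ φ.q₁ c) BitInput.encode fun x =>
      .ofBool (decide (φ.Accepts L x.s.I (elimOrder x.s.T.bag) x.weight
        (x.s.keyBound φ.p₁ φ.q₁))) := by
  set l := fun x : BitInput dir p₀ q₀ r φ.p₁ φ.q₁ => (x.problem L).result (elimOrder x.s.T.bag)
  have hlen : PolyBdd (BitInput.scale dir p₀ q₀ r φ.p₁ φ.q₁ c).time fun x => (l x).length :=
    (BitInput.polyBdd_tableBound L hc).mono fun x => by
      have := x.length_prod_finalTables L _ (List.prefix_refl _)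
      rwa [BitInput.finalTables, ← BitInput.okCell_problem] at this
  have hholds := BitInput.feas_holds (c := c) L φ.arith
    (S := Feas.Entry l) (π := fun q => q.s) (a := fun q => .pair q.x.encode q.s.encode)
    (y := fun q => q.x) Feas.id.weaken Feas.var0
  refine (Feas.any (l := l) (eα := fun _ => Row.encode) (p := fun x row =>
    decide (φ.arith.Holds x.s.I.k (x.s.I.keyCounts (rowKeys row.2)))) hlen
    (BitInput.feas_result L hc) hholds).congr fun x => congrArg _ ?_
  rw [Bool.eq_iff_iff, decide_eq_true_iff, List.any_eq_true, ECMLC.Accepts]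
  simp only [decide_eq_true_iff]
  rfl

end

/-! ### The randomized algorithm -/

section

variable {dir : Bool} {p₀ q₀ r : ℕ}

/-- The input together with the coin tosses that are needed, read off an infinite sequence. -/
def AlgInput.toss (p₁ q₁ : ℕ) (s : AlgInput dir p₀ q₀ r) (ω : ℕ → Bool) :
    BitInput dir p₀ q₀ r p₁ q₁ where
  s := s
  bits := (List.range (s.numBits p₁ q₁)).map ω
  len := by simp

/-- The finitely many tosses that are read determine the weights. -/
theorem AlgInput.toss_weight (p₁ q₁ : ℕ) (s : AlgInput dir p₀ q₀ r) (ω : ℕ → Bool) :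
    (s.toss p₁ q₁ ω).weight = bitWeight (fun u => itemIdx p₁ q₁ s.I.G.n s.I.G.m u)
      (bitLen (s.numItems p₁ q₁)) ω := by
  funext u
  change Nat.ofBits (fun j : Fin (bitLen (s.numItems p₁ q₁)) =>
    ((List.range (s.numBits p₁ q₁)).map ω).getD
      ((itemIdx p₁ q₁ s.I.G.n s.I.G.m u : ℕ) * bitLen (s.numItems p₁ q₁) + j) false) =
    Nat.ofBits fun j : Fin (bitLen (s.numItems p₁ q₁)) =>
      ω ((itemIdx p₁ q₁ s.I.G.n s.I.G.m u : ℕ) * bitLen (s.numItems p₁ q₁) + j)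
  congr 1
  funext j
  have hu : (itemIdx p₁ q₁ s.I.G.n s.I.G.m u : ℕ) + 1 ≤ s.numItems p₁ q₁ :=
    (itemIdx p₁ q₁ s.I.G.n s.I.G.m u).2
  have hlt : (itemIdx p₁ q₁ s.I.G.n s.I.G.m u : ℕ) * bitLen (s.numItems p₁ q₁) + j <
      s.numBits p₁ q₁ := by
    have := Nat.mul_le_mul_right (bitLen (s.numItems p₁ q₁)) hu
    rw [Nat.succ_mul] at this
    rw [AlgInput.numBits]
    omega
  rw [List.getD_eq_getElem _ _ (by simpa using hlt)]
  simp

open Classical in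
/-- The program tosses all its coins, and then decides from the instance and the resulting weights
whether to answer YES. -/
theorem ECMLC.exists_prog (φ : ECMLC dir p₀ q₀ r)
    (L : LocalSystem (XSym p₀ φ.p₁ φ.q₁) (Fin q₀ ⊕ Fin φ.q₁)) :
    ∃ (P : Prog) (c d : ℕ), ∀ (s : AlgInput dir p₀ q₀ r) (W : ℕ),
      (AlgInput.scale dir p₀ q₀ r c).word s ^ d ≤ W → ∀ ω : ℕ → Bool,
        ∃ t ≤ (AlgInput.scale dir p₀ q₀ r c).time s ^ d, P.Answers W s.encode ω
          (decide (φ.Accepts L s.I (elimOrder s.T.bag) (s.toss φ.p₁ φ.q₁ ω).weight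
            (s.keyBound φ.p₁ φ.q₁))) t := by
  set c := Fintype.card (Cell L.VLabel L.M)
  obtain ⟨p, d₁, hp⟩ := Feas.exists_toss (κ := AlgInput.scale dir p₀ q₀ r c)
    (AlgInput.modest_numBits (p₁ := φ.p₁) (q₁ := φ.q₁)) AlgInput.feas_numBits
  obtain ⟨q, d₂, hq⟩ := φ.feas_accepts L (Nat.le_succ c)
  refine ⟨.comp q p, c, d₁ + d₂ + 2, fun s W hW ω => ?_⟩
  have hpow : ∀ {b : ℕ}, 2 ≤ b → b ^ d₁ + b ^ d₂ + 1 ≤ b ^ (d₁ + d₂ + 2) := fun {b} hb => by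
    have h1 := Nat.one_le_pow d₁ b (by omega)
    have h2 := Nat.one_le_pow d₂ b (by omega)
    have h3 : 4 ≤ b ^ 2 := by nlinarith
    have h4 := Nat.mul_le_mul_left (b ^ d₁ * b ^ d₂) h3
    have h5 : b ^ d₁ ≤ b ^ d₁ * b ^ d₂ := Nat.le_mul_of_pos_right _ h2
    have h6 : b ^ d₂ ≤ b ^ d₁ * b ^ d₂ := Nat.le_mul_of_pos_left _ h1
    rw [pow_add, pow_add]
    omega
  have hw := hpow ((AlgInput.scale dir p₀ q₀ r c).two_le_word s)
  have ht := hpow ((AlgInput.scale dir p₀ q₀ r c).two_le_time s)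
  obtain ⟨t, ht', hpe⟩ := hp s W (by omega) ((List.range (s.numBits φ.p₁ φ.q₁)).map ω) (by simp)
  have hw' : (AlgInput.scale dir p₀ q₀ r c).word s ^ d₂ ≤ W := by omega
  obtain ⟨t', ht'', hqe⟩ := hq (s.toss φ.p₁ φ.q₁ ω) W hw'
  have ht''' : t' ≤ (AlgInput.scale dir p₀ q₀ r c).time s ^ d₂ := ht''
  refine ⟨t + t' + 1, by omega, s.numBits φ.p₁ φ.q₁, ?_⟩
  have := Prog.Eval.comp hpe hqe
  rwa [List.append_nil] at this

open Classical in
/-- The weights read off the coin tosses isolate a member of `F` with probability at least one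
half. -/
theorem AlgInput.coinMeasure_toss_le (p₁ q₁ : ℕ) (s : AlgInput dir p₀ q₀ r)
    {F : Finset (Visible p₁ q₁ s.I.G.n s.I.G.m)} (hF : F.Nonempty) :
    coinMeasure {ω | ¬ Isolated F Visible.mem (s.toss p₁ q₁ ω).weight} ≤ 1 / 2 := by
  set N := s.numItems p₁ q₁
  have hcard : Fintype.card (Item p₁ q₁ s.I.G.n s.I.G.m) = N := by
    rw [Fintype.card_congr (itemIdx p₁ q₁ _ _), Fintype.card_fin]; rfl
  have h1 := card_not_isolated_le (mem := Visible.mem) hF Visible.mem_injective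
    (K := 2 ^ bitLen N) (Nat.two_pow_pos _) (by rw [hcard]; exact le_two_pow_bitLen N)
  rw [hcard] at h1
  refine le_trans (le_of_eq ?_) (coinMeasure_bitWeight_le (itemIdx p₁ q₁ s.I.G.n s.I.G.m)
    (bitLen N) _ h1)
  congr 1
  ext ω
  simp only [Set.mem_ofPred_eq, Finset.mem_filter, Finset.mem_univ, true_and]
  rw [s.toss_weight]

end

theorem theorem2 {dir : Bool} {p₀ q₀ r : ℕ} (K : Set (Inst dir p₀ q₀ r))
    (hK : ExpressibleECMLC K) :
    ∃ (P : Prog) (c d : ℕ), ∀ (I : Inst dir p₀ q₀ r) (T : TreeDecomp I.G) (W : ℕ),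
      W = (I.G.size + T.tree.n + (∑ i, (I.k i).natAbs) + 1) ^ d →
      -- for all coin tosses, `P` answers within the time bound
      (∀ ω : ℕ → Bool, ∃ (ans : Bool) (s : ℕ),
        s ≤ c ^ T.width * (I.G.size + T.tree.n + 1) ^ d ∧
          P.Answers W (.pair I.encode T.encode) ω ans s) ∧
      -- no false positives
      (I ∉ K → ∀ (ω : ℕ → Bool) (s : ℕ),
        ¬ P.Answers W (.pair I.encode T.encode) ω true s) ∧
      -- false negatives with probability at most one half
      (I ∈ K → coinMeasure
        {ω | ∃ s : ℕ, P.Answers W (.pair I.encode T.encode) ω false s} ≤ 1 / 2) := by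
  classical
  obtain ⟨φ, hφ⟩ := hK
  obtain ⟨L, hL⟩ := φ.exists_accepts
  obtain ⟨P, c, d, hP⟩ := φ.exists_prog L
  -- the factor `(c + 1) ^ t` of the time scale is itself raised to the power `d`
  refine ⟨P, (c + 1) ^ d, d, fun I T W hW => ?_⟩
  set s : AlgInput dir p₀ q₀ r := ⟨I, T⟩
  have hans := hP s W hW.ge
  obtain ⟨hnodup, hall, -⟩ := s.elimOrder_spec
  obtain ⟨hsound, hcomplete⟩ := hL I (elimOrder T.bag) hnodup hall
  refine ⟨fun ω => ?_, fun hI ω t ht => ?_, fun hI => ?_⟩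
  · obtain ⟨t, ht, h⟩ := hans ω
    refine ⟨_, t, ht.trans (le_of_eq ?_), h⟩
    change ((c + 1) ^ T.width * (I.G.size + T.tree.n + 1)) ^ d = _
    rw [mul_pow, ← pow_mul, ← pow_mul, mul_comm d]
  · obtain ⟨t', -, h⟩ := hans ω
    have := of_decide_eq_true (h.ans_unique ht)
    exact hI ((hφ I).2 (hsound _ _ (s.toss φ.p₁ φ.q₁ ω).keyBound_weight this))
  · obtain ⟨F, hF, hiso⟩ := hcomplete ((hφ I).1 hI)
    refine le_trans (MeasureTheory.measure_mono (t := {ω | ¬ Isolated F Visible.mem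
      (s.toss φ.p₁ φ.q₁ ω).weight}) fun ω hω hi => ?_) (s.coinMeasure_toss_le φ.p₁ φ.q₁ hF)
    obtain ⟨t, ht⟩ := hω
    obtain ⟨t', -, h⟩ := hans ω
    exact of_decide_eq_false (h.ans_unique ht)
      (hiso _ _ (s.toss φ.p₁ φ.q₁ ω).keyBound_weight hi)
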